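/- Let $R$ be a (left and right) noetherian ring with identity which is a finitely generated module over its centre $Z(R)$. Notation. $\mathrm{Kdim}$ denotes the Krull dimension of modules in the sense of Rentschler and Gabriel (the deviation of the lattice of submodules), and $\mathrm{Kdim}(R)$ that of the regular module. For a left $R$-module $M$ put $j^{\ell}_R(M)=\min\{i:\mathrm{Ext}^i_R(M,R)\neq 0\}$, or $\infty$ if there is no such $i$; for a right module $j^r_R(M)$ is defined in the same way with $\mathrm{Ext}^i_R(M,R_R)$. For a commutative ring $C$, an ideal $\mathfrak i$ of $C$ and a $C$-module $X$, $G_C(\mathfrak i,X)$ is the length of a maximal regular sequence on $X$ with entries in $\mathfrak i$. The height of a prime (two-sided) ideal of $R$ is the greatest length of a chain of prime ideals descending from it. For a maximal ideal $\mathfrak m$ of $Z(R)$, $R_{\mathfrak m}$ is the localisation of $R$ at $Z(R)\setminus\mathfrak m$. Say that - $R$ is *Krull-Macaulay* if $\mathrm{Kdim}(R)<\infty$ and $\mathrm{Kdim}(R)=\mathrm{Kdim}(M)+j_R(M)$ for all non-zero finitely generated left and all non-zero finitely generated right $R$-modules $M$ (with $j_R=j_R^{\ell}$, resp. $j_R=j_R^{r}$);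 - $R$ is *locally Krull-Macaulay* if $R_{\mathfrak m}$ is Krull-Macaulay for every maximal ideal $\mathfrak m$ of $Z(R)$; - $R$ is *equicodimensional* if all maximal (two-sided) ideals of $R$ have the same height; - $R$ is *$Z(R)$-Macaulay* if it is a maximal Cohen-Macaulay $Z(R)$-module, that is, $G_{Z(R)}(\mathfrak m,R)=\mathrm{Kdim}_{Z(R)_{\mathfrak m}}(R_{\mathfrak m})=\mathrm{Kdim}(Z(R)_{\mathfrak m})$ for all maximal ideals $\mathfrak m$ of $Z(R)$; - $R$ is *grade symmetric* if $j^{\ell}_R(M)=j^r_R(M)$ for every $R$-bimodule $M$ which is finitely generated on both sides and central (that is, $zm=mz$ for all $z\in Z(R)$, $m\in M$). Then the following are equivalent: (i) $R$ is Krull-Macaulay; (ii) $R$ is equicodimensional and locally Krull-Macaulay; (iii) $R$ is $Z(R)$-Macaulay, equicodimensional and grade symmetric; (iv) $G_{Z(R)}(\mathfrak m,R)=\mathrm{Kdim}(R)$ for every maximal ideal $\mathfrak m$ of $Z(R)$, and $R$ is grade symmetric. -/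

import Mathlib

noncomputable section

universe u

namespace CentrallyMacaulay

/-! ### Krull dimension of modules in the sense of Rentschler and Gabriel -/

/-- `DevLT n a b` says that the deviation of the interval `[a, b]` of a partially ordered set is
`< n`. An interval with at most one element has deviation `-∞`, and `[a, b]` has deviation `≤ n`
if in every descending chain `s 0 ≥ s 1 ≥ ⋯` in `[a, b]` all but finitely many of the factors
`[s (i + 1), s i]` have deviation `< n`. So `DevLT 1 a b` is the descending chain condition. -/
def DevLT {L : Type*} [PartialOrder L] : ℕ → L → L → Prop
  | 0, a, b => (Set.Icc a b).Subsingleton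
  | n + 1, a, b => ∀ s : ℕ → L, Antitone s → (∀ i, s i ∈ Set.Icc a b) →
      ∃ N, ∀ i, N ≤ i → DevLT n (s (i + 1)) (s i)

open scoped Classical in
/-- The Krull dimension of an `R`-module `M`: the deviation of its lattice of submodules.
It is `⊥` (that is, `-∞`) for the zero module, a natural number if the deviation is finite, and
`⊤` (that is, `∞`) if the deviation is an infinite ordinal or is not defined. -/
def Kdim (R : Type*) [Ring R] (M : Type*) [AddCommGroup M] [Module R M] : WithBot ℕ∞ :=
  if DevLT 0 (⊥ : Submodule R M) ⊤ then ⊥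
  else ((⨅ (n : ℕ) (_ : DevLT (n + 1) (⊥ : Submodule R M) ⊤), (n : ℕ∞) : ℕ∞) : WithBot ℕ∞)

/-! ### Homological grade. Right `R`-modules are modules over `Rᵐᵒᵖ`. -/

/-- The least `i` with `Ext^i_R(M, N) ≠ 0`, or `∞` if there is none. -/
def extGrade (R : Type u) [Ring R] (M N : Type u) [AddCommGroup M] [Module R M]
    [AddCommGroup N] [Module R N] : ℕ∞ :=
  ⨅ (i : ℕ) (_ : Nontrivial
    (CategoryTheory.Abelian.Ext (ModuleCat.of R M) (ModuleCat.of R N) i)), (i : ℕ∞)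

/-- The left homological grade of a left `R`-module. -/
def leftGrade (R : Type u) [Ring R] (M : Type u) [AddCommGroup M] [Module R M] : ℕ∞ :=
  extGrade R M R

/-- The right homological grade of a right `R`-module; the second argument of `Ext` is the ring
`R` with its right multiplication. -/
def rightGrade (R : Type u) [Ring R] (M : Type u) [AddCommGroup M] [Module Rᵐᵒᵖ M] : ℕ∞ :=
  extGrade Rᵐᵒᵖ M R

/-- `R` is grade symmetric: left and right grades agree on every `R`-bimodule that is finitely
generated on both sides and on which the centre of `R` acts centrally. -/
def IsGradeSymmetric (R : Type u) [Ring R] : Prop :=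
  ∀ (M : Type u) [AddCommGroup M] [Module R M] [Module Rᵐᵒᵖ M] [SMulCommClass R Rᵐᵒᵖ M],
    Module.Finite R M → Module.Finite Rᵐᵒᵖ M →
    (∀ z ∈ Subring.center R, ∀ m : M, z • m = MulOpposite.op z • m) →
    leftGrade R M = rightGrade R M

/-- `R` is Krull-Macaulay: `Kdim R < ∞` and `Kdim R = Kdim M + j(M)` for every non-zero finitely
generated left or right `R`-module `M`. -/
structure IsKrullMacaulay (R : Type u) [Ring R] : Prop where
  left_finite : Kdim R R < ⊤
  right_finite : Kdim Rᵐᵒᵖ R < ⊤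
  left_eq : ∀ (M : Type u) [AddCommGroup M] [Module R M], Module.Finite R M → Nontrivial M →
    Kdim R R = Kdim R M + (leftGrade R M : WithBot ℕ∞)
  right_eq : ∀ (M : Type u) [AddCommGroup M] [Module Rᵐᵒᵖ M], Module.Finite Rᵐᵒᵖ M →
    Nontrivial M → Kdim Rᵐᵒᵖ R = Kdim Rᵐᵒᵖ M + (rightGrade R M : WithBot ℕ∞)

/-- The localisation `R_𝔪` of `R` at the central multiplicative set `Z(R) ∖ 𝔪`, with its ring
structure. -/
abbrev CentralLocalization (R : Type u) [Ring R] (m : Ideal (Subring.center R)) [m.IsPrime] :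
    Type u :=
  LocalizedModule m.primeCompl R

/-- `R` is locally Krull-Macaulay: `R_𝔪` is Krull-Macaulay for every maximal ideal `𝔪` of the
centre. -/
def IsLocallyKrullMacaulay (R : Type u) [Ring R] : Prop :=
  ∀ (m : Ideal (Subring.center R)) [m.IsMaximal], IsKrullMacaulay (CentralLocalization R m)

/-! ### Grade through regular sequences, and Macaulay modules -/

/-- `G_C(I, X)`: the largest length of a regular sequence on `X` with entries in `I`. -/
def seqGrade {C : Type*} [CommRing C] (I : Ideal C) (X : Type*) [AddCommGroup X] [Module C X] :
    ℕ∞ :=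
  ⨆ (rs : List C) (_ : (∀ r ∈ rs, r ∈ I) ∧ RingTheory.Sequence.IsRegular X rs),
    (rs.length : ℕ∞)

/-- `X` is a Cohen-Macaulay `C`-module. -/
def IsCohenMacaulayModule (C : Type*) [CommRing C] (X : Type*) [AddCommGroup X] [Module C X] :
    Prop :=
  ∀ (m : Ideal C) [m.IsMaximal], (seqGrade m X : WithBot ℕ∞) =
    Kdim (Localization.AtPrime m) (LocalizedModule m.primeCompl X)

/-- `X` is a maximal Cohen-Macaulay `C`-module. -/
structure IsMaximalCohenMacaulayModule (C : Type*) [CommRing C] (X : Type*) [AddCommGroup X]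
    [Module C X] : Prop where
  isCohenMacaulay : IsCohenMacaulayModule C X
  maximal : ∀ (m : Ideal C) [m.IsMaximal], (seqGrade m X : WithBot ℕ∞) =
    Kdim (Localization.AtPrime m) (Localization.AtPrime m)

/-- `R` is `Z(R)`-Macaulay. -/
def IsCenterMacaulay (R : Type*) [Ring R] : Prop :=
  IsMaximalCohenMacaulayModule (Subring.center R) R

/-! ### Prime two-sided ideals, height, equicodimensionality -/

/-- A two-sided ideal `P ≠ R` is prime if `IJ ⊆ P` implies `I ⊆ P` or `J ⊆ P`, for two-sided
ideals `I` and `J`. -/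
structure IsPrimeIdeal {R : Type*} [Ring R] (P : TwoSidedIdeal R) : Prop where
  ne_top : P ≠ ⊤
  le_or_le : ∀ I J : TwoSidedIdeal R, (∀ a ∈ I, ∀ b ∈ J, a * b ∈ P) → I ≤ P ∨ J ≤ P

/-- Maximal two-sided ideals are prime. -/
theorem isPrimeIdeal_of_isCoatom {R : Type*} [Ring R] {M : TwoSidedIdeal R} (hM : IsCoatom M) :
    IsPrimeIdeal M := by
  refine ⟨hM.1, fun I J h => ?_⟩
  by_contra hcon
  rw [not_or] at hcon
  have h1 : M ⊔ I = ⊤ := hM.2 _ (lt_of_le_of_ne le_sup_left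
    (fun e => hcon.1 (e ▸ le_sup_right)))
  have h2 : M ⊔ J = ⊤ := hM.2 _ (lt_of_le_of_ne le_sup_left
    (fun e => hcon.2 (e ▸ le_sup_right)))
  have e1 : (1 : R) ∈ M ⊔ I := h1 ▸ trivial
  have e2 : (1 : R) ∈ M ⊔ J := h2 ▸ trivial
  rw [TwoSidedIdeal.mem_sup] at e1 e2
  obtain ⟨m, hm, i, hi, e1⟩ := e1
  obtain ⟨n, hn, j, hj, e2⟩ := e2
  refine hM.1 ((TwoSidedIdeal.one_mem_iff M).1 ?_)
  have : (1 : R) = m * (n + j) + (i * n + i * j) := by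
    rw [← mul_add, ← add_mul, e1, e2, one_mul]
  rw [this]
  exact M.add_mem (M.mul_mem_right _ _ hm) (M.add_mem (M.mul_mem_left _ _ hn) (h i hi j hj))

/-- The prime two-sided ideals of `R`, ordered by inclusion. -/
abbrev PrimeIdeals (R : Type*) [Ring R] := {P : TwoSidedIdeal R // IsPrimeIdeal P}

/-- `R` is equicodimensional: all maximal two-sided ideals of `R` have the same height, where the
height of a prime `P` is the supremum of the lengths of chains of primes descending from `P`. -/
def IsEquicodimensional (R : Type*) [Ring R] : Prop :=
  ∀ (M N : TwoSidedIdeal R) (hM : IsCoatom M) (hN : IsCoatom N),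
    Order.height (⟨M, isPrimeIdeal_of_isCoatom hM⟩ : PrimeIdeals R) =
      Order.height (⟨N, isPrimeIdeal_of_isCoatom hN⟩ : PrimeIdeals R)

end CentrallyMacaulay

end

/-!
Write `Z` for the centre of `R`. By Eakin–Nagata `Z` is noetherian, and since `R` is finite over `Z`
the Krull dimension of a finitely generated `R`-module is the dimension of its support over `Z`.

Let `rs` be a maximal `R`-regular sequence in `ann_Z M`, of length `n`. Elements of `ann_Z M` act as
zero on `Ext_R(M, -)`, so the long exact sequences give `Ext^i_R(M, R) = 0` for `i < n`, and
`Ext^n_R(M, R) ≠ 0` exactly when there is a non-zero homomorphism `M → R / rs R`. Hence the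
Krull-Macaulay condition splits into two parts: all maximal ideals of `Z` have `R`-depth `Kdim R`,
and there are enough such homomorphisms on both sides. The second part follows from grade symmetry,
applied to the bimodules `M ⊗_Z R`, and it can be tested after localising at maximal ideals of `Z`.

Contraction to `Z` is strictly monotone on primes of `R`, and a regular sequence contained in a
prime of `R` yields a chain of primes of its length below that prime. So if the `R`-depth of each
maximal ideal `m` of `Z` is the height of `m`, then every maximal ideal of `R` over `m` has the same
height as `m`, and equicodimensionality of `R` makes these depths equal.
-/

noncomputable section

universe u

namespace CentrallyMacaulay

open RingTheory.Sequence
open scoped Pointwise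

/-! ### Deviation of intervals -/

section Deviation

variable {L L' : Type*} [PartialOrder L] [PartialOrder L']

theorem DevLT.of_strictMonoOn {n : ℕ} {f : L → L'} {a b : L} (h : DevLT n (f a) (f b))
    (hf : StrictMonoOn f (Set.Icc a b)) : DevLT n a b := by
  induction n generalizing a b with
  | zero =>
    intro x hx y hy
    have hab : a ≤ b := hx.1.trans hx.2
    have mono := hf.monotoneOn
    have hmem {c : L} (hc : c ∈ Set.Icc a b) : f c ∈ Set.Icc (f a) (f b) :=
      ⟨mono (Set.left_mem_Icc.mpr hab) hc hc.1, mono hc (Set.right_mem_Icc.mpr hab) hc.2⟩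
    have heq : a = b := (hab.eq_or_lt).resolve_right fun hlt =>
      (hf (Set.left_mem_Icc.mpr hab) (Set.right_mem_Icc.mpr hab) hlt).ne
        (h (hmem (Set.left_mem_Icc.mpr hab)) (hmem (Set.right_mem_Icc.mpr hab)))
    subst heq
    exact (le_antisymm hx.2 hx.1).trans (le_antisymm hy.1 hy.2)
  | succ n ih =>
    intro s hs hsI
    have hab : a ≤ b := (hsI 0).1.trans (hsI 0).2
    have mono := hf.monotoneOn
    obtain ⟨N, hN⟩ := h (fun i => f (s i)) (fun i j hij => mono (hsI j) (hsI i) (hs hij))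
      fun i => ⟨mono (Set.left_mem_Icc.mpr hab) (hsI i) (hsI i).1,
        mono (hsI i) (Set.right_mem_Icc.mpr hab) (hsI i).2⟩
    exact ⟨N, fun i hi => ih (hN i hi) (hf.mono (Set.Icc_subset_Icc (hsI _).1 (hsI _).2))⟩

theorem DevLT.mono {n : ℕ} {a b a' b' : L} (h : DevLT n a b) (ha : a ≤ a') (hb : b' ≤ b) :
    DevLT n a' b' := by
  cases n with
  | zero => exact Set.Subsingleton.anti h (Set.Icc_subset_Icc ha hb)
  | succ n => exact fun s hs hsI => h s hs fun i => ⟨ha.trans (hsI i).1, (hsI i).2.trans hb⟩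

theorem devLT_self (n : ℕ) (a : L) : DevLT n a a := by
  induction n generalizing a with
  | zero => exact fun x hx y hy => by simp_all
  | succ n ih =>
    intro s _ hsI
    have hs (i : ℕ) : s i = a := le_antisymm (hsI i).2 (hsI i).1
    exact ⟨0, fun i _ => by rw [hs, hs]; exact ih a⟩

theorem DevLT.prod {n : ℕ} {a b : L × L'} (h₁ : DevLT n a.1 b.1) (h₂ : DevLT n a.2 b.2) :
    DevLT n a b := by
  induction n generalizing a b with
  | zero =>
    intro x hx y hy
    exact Prod.ext (h₁ ⟨hx.1.1, hx.2.1⟩ ⟨hy.1.1, hy.2.1⟩) (h₂ ⟨hx.1.2, hx.2.2⟩ ⟨hy.1.2, hy.2.2⟩)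
  | succ n ih =>
    intro s hs hsI
    obtain ⟨N₁, hN₁⟩ := h₁ (fun i => (s i).1) (fun i j hij => (hs hij).1)
      fun i => ⟨(hsI i).1.1, (hsI i).2.1⟩
    obtain ⟨N₂, hN₂⟩ := h₂ (fun i => (s i).2) (fun i j hij => (hs hij).2)
      fun i => ⟨(hsI i).1.2, (hsI i).2.2⟩
    exact ⟨max N₁ N₂, fun i hi =>
      ih (hN₁ i ((le_max_left _ _).trans hi)) (hN₂ i ((le_max_right _ _).trans hi))⟩

theorem DevLT.trans {L : Type*} [Lattice L] [IsModularLattice L] {n : ℕ} {a b c : L}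
    (hab : a ≤ b) (hbc : b ≤ c) (h₁ : DevLT n a b) (h₂ : DevLT n b c) : DevLT n a c := by
  refine DevLT.of_strictMonoOn (f := fun x : L => (x ⊓ b, x ⊔ b)) (DevLT.prod ?_ ?_)
    (strictMono_inf_prod_sup.strictMonoOn _)
  · simpa only [inf_eq_left.mpr hab, inf_eq_right.mpr hbc] using h₁
  · simpa only [sup_eq_right.mpr hab, sup_eq_left.mpr hbc] using h₂

end Deviation

section SubmoduleIntervals

variable {A M N : Type*} [Ring A] [AddCommGroup M] [Module A M] [AddCommGroup N] [Module A N]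
  (f : M →ₗ[A] N)

theorem strictMonoOn_submodule_map : StrictMonoOn (Submodule.map f) (Set.Ici (LinearMap.ker f)) :=
  fun W hW W' hW' hlt => (Submodule.map_mono hlt.le).lt_of_ne fun h => hlt.ne <| by
    simpa only [Submodule.comap_map_eq, sup_eq_left.mpr (Set.mem_Ici.mp hW),
      sup_eq_left.mpr (Set.mem_Ici.mp hW')] using congrArg (Submodule.comap f) h

theorem strictMonoOn_submodule_comap :
    StrictMonoOn (Submodule.comap f) (Set.Iic (LinearMap.range f)) :=
  fun W hW W' hW' hlt => (Submodule.comap_mono hlt.le).lt_of_ne fun h => hlt.ne <| by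
    simpa only [Submodule.map_comap_eq, inf_eq_right.mpr (Set.mem_Iic.mp hW),
      inf_eq_right.mpr (Set.mem_Iic.mp hW')] using congrArg (Submodule.map f) h

variable {f}

theorem devLT_ker_top {n : ℕ} (h : DevLT n (⊥ : Submodule A N) ⊤) :
    DevLT n (LinearMap.ker f) ⊤ :=
  (h.mono bot_le le_top).of_strictMonoOn
    ((strictMonoOn_submodule_map f).mono Set.Icc_subset_Ici_self)

theorem devLT_bot_range {n : ℕ} (h : DevLT n (⊥ : Submodule A M) ⊤) :
    DevLT n ⊥ (LinearMap.range f) :=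
  (h.mono bot_le le_top).of_strictMonoOn
    ((strictMonoOn_submodule_comap f).mono Set.Icc_subset_Iic_self)

theorem devLT_bot_top_of_exact {n : ℕ} {P : Type*} [AddCommGroup P] [Module A P] {g : N →ₗ[A] P}
    (hfg : Function.Exact f g) (hM : DevLT n (⊥ : Submodule A M) ⊤)
    (hP : DevLT n (⊥ : Submodule A P) ⊤) : DevLT n (⊥ : Submodule A N) ⊤ :=
  (devLT_bot_range hM).trans bot_le le_top (hfg.linearMap_ker_eq ▸ devLT_ker_top hP)

theorem devLT_subquotient {n : ℕ} {P : Type*} [AddCommGroup P] [Module A P] {g : M →ₗ[A] P}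
    (hf : Function.Injective f) (hg : Function.Surjective g)
    (h : DevLT n ((LinearMap.ker g).map f) (LinearMap.range f)) :
    DevLT n (⊥ : Submodule A P) ⊤ := by
  refine DevLT.of_strictMonoOn (f := fun W : Submodule A P => (W.comap g).map f) ?_
    (StrictMono.strictMonoOn ((Submodule.map_strictMono_of_injective hf).comp
      (Submodule.comap_strictMono_of_surjective hg)) _)
  rwa [Submodule.comap_bot, Submodule.comap_top, Submodule.map_top]

end SubmoduleIntervals

/-! ### Krull dimension and the dimension of the support -/

section Support

variable {Z : Type*} [CommRing Z] {M : Type*} [AddCommGroup M] [Module Z M]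

theorem natCast_le_supportDim_iff {n : ℕ} :
    (n : WithBot ℕ∞) ≤ Module.supportDim Z M ↔
      ∃ p ∈ Module.support Z M, (n : ℕ∞) ≤ Order.coheight p := by
  rw [Module.supportDim, Order.le_krullDim_iff]
  constructor
  · rintro ⟨l, rfl⟩
    exact ⟨l.head.1, l.head.2,
      Order.length_le_coheight (p := l.map Subtype.val fun _ _ h => h) le_rfl⟩
  · rintro ⟨p, hp, hn⟩
    obtain ⟨l, rfl, rfl⟩ := Order.exists_series_of_le_coheight p hn
    exact ⟨⟨l.length, fun i => ⟨l i, Module.mem_support_mono (l.head_le i) hp⟩,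
      fun i => l.step i⟩, rfl⟩

theorem coheight_le_supportDim {p : PrimeSpectrum Z} (hp : p ∈ Module.support Z M) :
    (Order.coheight p : WithBot ℕ∞) ≤ Module.supportDim Z M := by
  have : Nontrivial M := Module.nonempty_support_iff.mp ⟨p, hp⟩
  obtain ⟨k, hk⟩ := WithBot.ne_bot_iff_exists.mp (Module.supportDim_ne_bot_of_nontrivial Z M)
  rw [← hk, WithBot.coe_le_coe, ← ENat.forall_natCast_le_iff_le]
  intro n hn
  rw [← WithBot.coe_le_coe, hk]
  exact natCast_le_supportDim_iff.mpr ⟨p, hp, hn⟩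

theorem supportDim_quotSMulTop_add_one_le [IsNoetherianRing Z] [Module.Finite Z M] {x : Z}
    (hx : IsSMulRegular M x) :
    Module.supportDim Z (QuotSMulTop x M) + 1 ≤ Module.supportDim Z M :=
  Module.supportDim_quotSMulTop_succ_le_of_notMem_minimalPrimes
    fun _ => hx.notMem_of_mem_minimalPrimes

theorem exists_isSMulRegular_smul_top_le {p : Ideal Z} [p.IsPrime] (e : M ≃ₗ[Z] Z ⧸ p)
    {W : Submodule Z M} (hW : W ≠ ⊥) :
    ∃ a : Z, IsSMulRegular M a ∧ a • (⊤ : Submodule Z M) ≤ W := by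
  obtain ⟨x, hx, hx0⟩ := (Submodule.ne_bot_iff _).mp hW
  obtain ⟨a, ha⟩ := Ideal.Quotient.mk_surjective (e x)
  have ha0 : Ideal.Quotient.mk p a ≠ 0 := ha ▸ (map_ne_zero_iff e e.injective).mpr hx0
  refine ⟨a, (LinearEquiv.isSMulRegular_congr e a).mpr ?_, ?_⟩
  · exact (isSMulRegular_iff_right_eq_zero_of_smul (M := Z ⧸ p)).mpr fun y hy =>
      (mul_eq_zero.mp (Algebra.smul_def a y ▸ hy)).resolve_left ha0
  · rintro _ ⟨y, -, rfl⟩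
    obtain ⟨b, hb⟩ := Ideal.Quotient.mk_surjective (e y)
    have hay : a • y = b • x := e.injective <| by
      rw [map_smul, map_smul, ← hb, ← ha, Algebra.smul_def, Algebra.smul_def]
      exact mul_comm _ _
    change a • y ∈ W
    exact hay ▸ W.smul_mem b hx

end Support

section ScalarMultiples

variable (Z : Type*) [CommRing Z] {A : Type*} [Ring A] [Algebra Z A]
  {M : Type*} [AddCommGroup M] [Module A M] [Module Z M] [IsScalarTower Z A M]

variable (A M) in
/-- The quotient of an `A`-module `M` by the multiples of a scalar `z`, computed over `Z` or over
the `Z`-algebra `A`. -/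
def quotSMulTopEquiv (z : Z) : QuotSMulTop z M ≃ₗ[Z] M ⧸ (z • (⊤ : Submodule A M)) :=
  (Submodule.quotEquivOfEq _ _ (by
    ext x
    simp [Submodule.mem_smul_pointwise_iff_exists])).trans
      (Submodule.Quotient.restrictScalarsEquiv Z (z • (⊤ : Submodule A M)))

variable {Z}

theorem mem_support_smul_top {p : PrimeSpectrum Z} (hp : p ∈ Module.support Z M) {s : Z}
    (hs : s ∉ p.asIdeal) : p ∈ Module.support Z (s • (⊤ : Submodule A M) : Submodule A M) := by
  rw [Module.mem_support_iff'] at hp ⊢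
  obtain ⟨x, hx⟩ := hp
  refine ⟨⟨s • x, Submodule.smul_mem_pointwise_smul _ _ _ trivial⟩, fun r hr h => ?_⟩
  refine hx (r * s) (fun hrs => (p.isPrime.mem_or_mem hrs).elim hr hs) ?_
  rw [mul_smul]
  exact congrArg Subtype.val h

theorem submodule_map_scalar_smul {N : Type*} [AddCommGroup N] [Module A N] [Module Z N]
    [IsScalarTower Z A N] (f : M →ₗ[A] N) (z : Z) (W : Submodule A M) :
    (z • W).map f = z • W.map f := by
  ext
  simp [Submodule.mem_smul_pointwise_iff_exists]

theorem devLT_quotient_smul_top {n N : ℕ} {c : Z}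
    (h : DevLT n (c ^ (N + 1) • (⊤ : Submodule A M)) (c ^ N • ⊤)) :
    DevLT n (⊥ : Submodule A ((c ^ N • ⊤ : Submodule A M) ⧸
      (c • ⊤ : Submodule A (c ^ N • ⊤ : Submodule A M)))) ⊤ := by
  refine devLT_subquotient (Submodule.injective_subtype _) (Submodule.mkQ_surjective _) ?_
  rwa [Submodule.ker_mkQ, submodule_map_scalar_smul, Submodule.map_top, Submodule.range_subtype,
    smul_smul, ← pow_succ']

end ScalarMultiples

section KrullDimension

variable {Z : Type*} [CommRing Z] [IsNoetherianRing Z]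

-- If `p < q` and `c ∈ q \ p`, all the factors of the chain `cⁱ M` have `q` in their support.
theorem not_devLT_of_le_coheight {A : Type*} [Ring A] [Algebra Z A] {n : ℕ}
    {M : Type*} [AddCommGroup M] [Module A M] [Module Z M] [IsScalarTower Z A M]
    [Module.Finite Z M] {p : PrimeSpectrum Z} (hp : p ∈ Module.support Z M)
    (hn : (n : ℕ∞) ≤ Order.coheight p) : ¬ DevLT n (⊥ : Submodule A M) ⊤ := by
  induction n generalizing M p with
  | zero =>
    have : Nontrivial M := Module.nonempty_support_iff.mp ⟨p, hp⟩
    exact fun h => bot_ne_top (α := Submodule A M) (h ⟨le_rfl, bot_le⟩ ⟨bot_le, le_rfl⟩)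
  | succ n ih =>
    obtain ⟨q, hpq, hq⟩ : ∃ q, p < q ∧ (n : ℕ∞) ≤ Order.coheight q := by
      have hlt : ¬ Order.coheight p ≤ n :=
        not_le.mpr (((ENat.natCast_lt_natCast).mpr n.lt_succ_self).trans_le hn)
      simpa only [Order.coheight_le_coe_iff, not_forall, not_lt, exists_prop] using hlt
    obtain ⟨c, hcq, hcp⟩ := Set.exists_of_ssubset (show (p.asIdeal : Set Z) ⊂ q.asIdeal from hpq)
    intro h
    obtain ⟨N, hN⟩ := h (fun i => c ^ i • (⊤ : Submodule A M))
      (antitone_nat_of_succ_le fun i => by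
        rw [pow_succ, mul_smul]
        exact smul_mono_right _ le_top)
      fun i => ⟨bot_le, le_top⟩
    set K : Submodule A M := c ^ N • ⊤
    have : Module.Finite Z K := inferInstanceAs (Module.Finite Z (K.restrictScalars Z))
    have hpK : p ∈ Module.support Z K :=
      mem_support_smul_top hp fun h => hcp (p.isPrime.mem_of_pow_mem _ h)
    have hqK : q ∈ Module.support Z (K ⧸ (c • (⊤ : Submodule A K))) := by
      rw [← (quotSMulTopEquiv Z A K c).support_eq, Module.support_quotSMulTop]
      exact ⟨Module.mem_support_mono hpq.le hpK, by simpa using hcq⟩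
    have : Module.Finite Z (K ⧸ (c • (⊤ : Submodule A K))) :=
      Module.Finite.equiv (quotSMulTopEquiv Z A K c)
    exact ih hqK hq (devLT_quotient_smul_top (hN N le_rfl))

theorem devLT_succ_of_equiv_quotient_prime {n : ℕ} {N : Type*} [AddCommGroup N] [Module Z N]
    [Module.Finite Z N] {p : Ideal Z} [p.IsPrime] (e : N ≃ₗ[Z] Z ⧸ p)
    (h : ∀ W : Submodule Z N, Module.supportDim Z (N ⧸ W) < n →
      DevLT n (⊥ : Submodule Z (N ⧸ W)) ⊤)
    (hN : Module.supportDim Z N < (n + 1 : ℕ)) : DevLT (n + 1) (⊥ : Submodule Z N) ⊤ := by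
  intro s hs _
  by_cases hbot : ∃ i, s i = ⊥
  · obtain ⟨i, hi⟩ := hbot
    have hj {j : ℕ} (hij : i ≤ j) : s j = ⊥ := le_bot_iff.mp ((hs hij).trans_eq hi)
    exact ⟨i, fun j hij => by rw [hj hij, hj (hij.trans j.le_succ)]; exact devLT_self _ _⟩
  · push Not at hbot
    refine ⟨0, fun i _ => DevLT.mono (b := ⊤) ?_ le_rfl le_top⟩
    obtain ⟨a, ha, hle⟩ := exists_isSMulRegular_smul_top_le e (hbot (i + 1))
    have hdim : Module.supportDim Z (N ⧸ s (i + 1)) + 1 < n + 1 := calc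
      _ ≤ Module.supportDim Z (QuotSMulTop a N) + 1 := by
        gcongr
        exact Module.supportDim_le_of_surjective (Submodule.factor hle)
          (Submodule.factor_surjective hle)
      _ ≤ Module.supportDim Z N := supportDim_quotSMulTop_add_one_le ha
      _ < n + 1 := mod_cast hN
    simpa using devLT_ker_top (f := (s (i + 1)).mkQ) (h _ (lt_of_add_lt_add_right hdim))

theorem devLT_of_supportDim_lt {n : ℕ} {M : Type*} [AddCommGroup M] [Module Z M]
    [Module.Finite Z M] (hM : Module.supportDim Z M < n) : DevLT n (⊥ : Submodule Z M) ⊤ := by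
  induction n generalizing M with
  | zero =>
    have : Subsingleton M := by
      rw [← Module.supportDim_eq_bot_iff_subsingleton Z]
      exact (WithBot.lt_zero_iff_eq_bot _).mp hM
    exact Set.subsingleton_of_subsingleton
  | succ n ih =>
    induction ‹Module.Finite Z M› using
      IsNoetherianRing.induction_on_isQuotientEquivQuotientPrime Z with
    | subsingleton N =>
      rw [Subsingleton.elim (⊥ : Submodule Z N) ⊤]
      exact devLT_self _ _
    | quotient N p e => exact devLT_succ_of_equiv_quotient_prime e (fun _ => ih) hM
    | exact N₁ N₂ N₃ f g hf hg hfg ih₁ ih₃ =>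
      exact devLT_bot_top_of_exact hfg
        (ih₁ ((Module.supportDim_le_of_injective f hf).trans_lt hM))
        (ih₃ ((Module.supportDim_le_of_surjective g hg).trans_lt hM))

theorem devLT_iff_supportDim_lt {A : Type*} [Ring A] [Algebra Z A] {n : ℕ}
    {M : Type*} [AddCommGroup M] [Module A M] [Module Z M] [IsScalarTower Z A M]
    [Module.Finite Z M] :
    DevLT n (⊥ : Submodule A M) ⊤ ↔ Module.supportDim Z M < n := by
  refine ⟨fun h => ?_, fun h => ?_⟩
  · by_contra! hn
    obtain ⟨p, hp, hpn⟩ := natCast_le_supportDim_iff.mp hn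
    exact not_devLT_of_le_coheight hp hpn h
  · exact DevLT.of_strictMonoOn (f := Submodule.restrictScalars Z) (devLT_of_supportDim_lt h)
      (StrictMono.strictMonoOn (fun _ _ hlt => hlt) _)

variable (Z) in
theorem kdim_eq_supportDim (A : Type*) [Ring A] [Algebra Z A]
    (M : Type*) [AddCommGroup M] [Module A M] [Module Z M] [IsScalarTower Z A M]
    [Module.Finite Z M] : Kdim A M = Module.supportDim Z M := by
  simp only [Kdim, devLT_iff_supportDim_lt (Z := Z)]
  rcases eq_or_ne (Module.supportDim Z M) ⊥ with h | h
  · rw [if_pos (by rw [h]; exact WithBot.bot_lt_coe _), h]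
  obtain ⟨k, hk⟩ := WithBot.ne_bot_iff_exists.mp h
  have coe_lt (n : ℕ) : (k : WithBot ℕ∞) < (n : WithBot ℕ∞) ↔ k < (n : ℕ∞) :=
    WithBot.coe_lt_coe (b := (n : ℕ∞))
  simp only [← hk, coe_lt]
  rw [if_neg (by simp)]
  congr 1
  refine le_antisymm ?_ (le_iInf₂ fun n hn => Order.le_of_lt_add_one (mod_cast hn))
  induction k using ENat.recTopCoe with
  | top => exact le_top
  | coe n => exact iInf₂_le n (mod_cast n.lt_succ_self)

end KrullDimension

/-! ### Associated primes and regular sequences -/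

section AssociatedPrimes

variable {Z : Type*} [CommRing Z] {Y : Type*} [AddCommGroup Y] [Module Z Y]

theorem annihilator_le_of_mem_associatedPrimes {p : Ideal Z} (hp : p ∈ associatedPrimes Z Y) :
    Module.annihilator Z Y ≤ p :=
  Submodule.annihilator_top (R := Z) (M := Y) ▸ IsAssociatedPrime.annihilator_le hp

theorem quotSMulTop_map_subtype_injective {U : Submodule Z Y} {x : Z}
    (hU : ∀ y, x • y ∈ U → y ∈ U) : Function.Injective (QuotSMulTop.map x U.subtype) := by
  rw [injective_iff_map_eq_zero]
  intro w hw
  obtain ⟨u, rfl⟩ := Submodule.Quotient.mk_surjective _ w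
  rw [QuotSMulTop.map_apply_mk, Submodule.Quotient.mk_eq_zero] at hw
  obtain ⟨v, -, hv⟩ := (Submodule.mem_smul_pointwise_iff_exists _ _ _).mp hw
  rw [Submodule.Quotient.mk_eq_zero]
  exact (Submodule.mem_smul_pointwise_iff_exists _ _ _).mpr
    ⟨⟨v, hU v (hv ▸ u.2)⟩, trivial, Subtype.ext hv⟩

variable [IsNoetherianRing Z]

theorem notMem_of_isSMulRegular {x : Z} (hx : IsSMulRegular Y x) {p : Ideal Z}
    (hp : p ∈ associatedPrimes Z Y) : x ∉ p := by
  intro h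
  have : x ∈ ⋃ p ∈ associatedPrimes Z Y, (p : Set Z) := Set.mem_iUnion₂_of_mem hp h
  rw [biUnion_associatedPrimes_eq_compl_regular] at this
  exact this hx

theorem annihilator_torsionBySet_of_mem_associatedPrimes {p : Ideal Z}
    (hp : p ∈ associatedPrimes Z Y) :
    Module.annihilator Z (Submodule.torsionBySet Z Y (p : Set Z)) = p := by
  refine le_antisymm (fun a ha => ?_) fun a ha => Module.mem_annihilator.mpr fun u =>
    Submodule.torsionBySet_isTorsionBySet (p : Set Z) (x := u) (a := ⟨a, ha⟩)
  obtain ⟨-, u, hu⟩ := isAssociatedPrime_iff.mp hp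
  have hpu : ∀ b, b ∈ p ↔ b • u = 0 := fun b => by
    rw [hu, Submodule.mem_colon_singleton, Submodule.mem_bot]
  have hmem : u ∈ Submodule.torsionBySet Z Y (p : Set Z) :=
    (Submodule.mem_torsionBySet_iff _ _).mpr fun b => (hpu b).mp b.2
  exact (hpu a).mpr (congrArg Subtype.val (Module.mem_annihilator.mp ha ⟨u, hmem⟩))

variable [Module.Finite Z Y]

theorem exists_associatedPrime_le_of_mem_support {m : PrimeSpectrum Z}
    (hm : m ∈ Module.support Z Y) : ∃ q ∈ associatedPrimes Z Y, q ≤ m.asIdeal := by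
  obtain ⟨q, hq, hqm⟩ := Ideal.exists_minimalPrimes_le (Module.mem_support_iff_of_finite.mp hm)
  exact ⟨q, Module.associatedPrimes.minimalPrimes_annihilator_subset_associatedPrimes Z Y hq, hqm⟩

theorem exists_le_associatedPrime_of_forall_not_isSMulRegular {I : Ideal Z}
    (h : ∀ x ∈ I, ¬ IsSMulRegular Y x) : ∃ p ∈ associatedPrimes Z Y, I ≤ p := by
  refine (Ideal.subset_union_prime_finite (associatedPrimes.finite Z Y) ⊥ ⊥
    (f := id) fun p hp _ _ => hp.isPrime).mp ?_
  simp only [id]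
  rw [biUnion_associatedPrimes_eq_compl_regular]
  exact h

-- The `p`-torsion `U` of `Y` has annihilator `p`, and `U ⧸ xU` embeds into `Y ⧸ xY`.
theorem exists_associatedPrime_quotSMulTop {p m : Ideal Z} [hm : m.IsPrime]
    (hp : p ∈ associatedPrimes Z Y) (hpm : p ≤ m) {x : Z} (hxm : x ∈ m) (hx : IsSMulRegular Y x) :
    ∃ q ∈ associatedPrimes Z (QuotSMulTop x Y), p < q ∧ q ≤ m := by
  set U := Submodule.torsionBySet Z Y (p : Set Z) with hU
  have hpure : ∀ y, x • y ∈ U → y ∈ U := fun y hy => by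
    rw [hU, Submodule.mem_torsionBySet_iff] at hy ⊢
    exact fun a => hx (by simpa [smul_comm x] using hy a)
  have hmU : (⟨m, hm⟩ : PrimeSpectrum Z) ∈ Module.support Z (QuotSMulTop x U) := by
    rw [Module.support_quotSMulTop, Set.mem_inter_iff, Module.mem_support_iff_of_finite,
      annihilator_torsionBySet_of_mem_associatedPrimes hp]
    exact ⟨hpm, by simpa using hxm⟩
  obtain ⟨q, hq, hqm⟩ := exists_associatedPrime_le_of_mem_support hmU
  have hle : Module.annihilator Z U ⊔ Ideal.span {x} ≤ q := by
    refine le_trans (sup_le ?_ ?_) (annihilator_le_of_mem_associatedPrimes hq)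
    · exact LinearMap.annihilator_le_of_surjective _ (Submodule.mkQ_surjective _)
    · exact (Ideal.span_singleton_le_iff_mem _).mpr (QuotSMulTop.mem_annihilator _ x)
  rw [annihilator_torsionBySet_of_mem_associatedPrimes hp, sup_le_iff,
    Ideal.span_singleton_le_iff_mem] at hle
  refine ⟨q, associatedPrimes.subset_of_injective (quotSMulTop_map_subtype_injective hpure) hq,
    lt_of_le_of_ne hle.1 ?_, hqm⟩
  rintro rfl
  exact notMem_of_isSMulRegular hx hp hle.2

theorem exists_ltSeries_of_isWeaklyRegular {p m : PrimeSpectrum Z}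
    (hp : p.asIdeal ∈ associatedPrimes Z Y) (hpm : p ≤ m) {rs : List Z}
    (hm : ∀ r ∈ rs, r ∈ m.asIdeal) (hrs : IsWeaklyRegular Y rs) :
    ∃ l : LTSeries (PrimeSpectrum Z), l.head = p ∧ l.last ≤ m ∧ l.length = rs.length := by
  induction rs generalizing Y p with
  | nil => exact ⟨RelSeries.singleton _ p, rfl, hpm, rfl⟩
  | cons x rs ih =>
    rw [isWeaklyRegular_cons_iff] at hrs
    obtain ⟨q, hq, hpq, hqm⟩ := exists_associatedPrime_quotSMulTop hp hpm (hm x (by simp)) hrs.1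
    obtain ⟨l, hl, hlm, hlen⟩ := ih (p := ⟨q, hq.isPrime⟩) hq hqm
      (fun r hr => hm r (by simp [hr])) hrs.2
    exact ⟨l.cons p (by rw [hl]; exact hpq), by simp, by simpa using hlm, by simp [hlen]⟩

theorem supportDim_quotient_ofList_add_length_le {rs : List Z} (hrs : IsWeaklyRegular Y rs) :
    Module.supportDim Z (Y ⧸ (Ideal.ofList rs • ⊤ : Submodule Z Y)) + rs.length ≤
      Module.supportDim Z Y := by
  induction rs generalizing Y with
  | nil => simpa using Module.supportDim_le_of_surjective _ (Submodule.mkQ_surjective _)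
  | cons x rs ih =>
    rw [isWeaklyRegular_cons_iff] at hrs
    rw [Module.supportDim_eq_of_equiv (Submodule.quotOfListConsSMulTopEquivQuotSMulTopInner Y x rs)]
    refine le_trans ?_ (supportDim_quotSMulTop_add_one_le hrs.1)
    have := add_le_add_left (ih hrs.2) 1
    simpa [add_assoc] using this

end AssociatedPrimes

/-! ### Change of rings along a regular sequence of central elements -/

section IdealSMulTop

variable {Z : Type*} [CommRing Z] (A : Type*) [Ring A] [Algebra Z A] (I : Ideal Z)
  (Y : Type*) [AddCommGroup Y] [Module A Y] [Module Z Y] [IsScalarTower Z A Y]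

/-- The `A`-submodule `I Y` of an `A`-module `Y`, for an ideal `I` of central scalars. Its
underlying `Z`-submodule is `I • ⊤`. -/
def idealSMulTop : Submodule A Y where
  __ := (I • ⊤ : Submodule Z Y).toAddSubmonoid
  smul_mem' a _ hy := Submodule.smul_top_le_comap_smul_top I (Algebra.lsmul Z Z Y a) hy

/-- The identification of the quotients of `Y` by `I Y` over `Z` and over `A`. -/
def idealSMulTopQuotEquiv : (Y ⧸ (I • ⊤ : Submodule Z Y)) ≃ₗ[Z] Y ⧸ idealSMulTop A I Y :=
  Submodule.Quotient.restrictScalarsEquiv Z (idealSMulTop A I Y)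

variable {A I Y}

theorem mem_idealSMulTop {y : Y} : y ∈ idealSMulTop A I Y ↔ y ∈ (I • ⊤ : Submodule Z Y) := Iff.rfl

theorem idealSMulTop_map_mkQ (N : Submodule A Y) :
    (idealSMulTop A I Y).map N.mkQ = idealSMulTop A I (Y ⧸ N) := by
  have h : (I • ⊤ : Submodule Z Y).map (N.mkQ.restrictScalars Z) = I • ⊤ := by
    have hrange : LinearMap.range (N.mkQ.restrictScalars Z) = ⊤ :=
      LinearMap.range_eq_top.mpr (Submodule.mkQ_surjective N)
    rw [Submodule.map_smul'', Submodule.map_top, hrange]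
  exact SetLike.ext fun y => SetLike.ext_iff.mp h y

variable (A Y)

theorem smul_top_le_idealSMulTop_ofList_cons (z : Z) (rs : List Z) :
    z • (⊤ : Submodule A Y) ≤ idealSMulTop A (Ideal.ofList (z :: rs)) Y := by
  intro y hy
  obtain ⟨w, -, rfl⟩ := (Submodule.mem_smul_pointwise_iff_exists _ _ _).mp hy
  rw [mem_idealSMulTop, Ideal.ofList_cons_smul]
  exact Submodule.mem_sup_left (Submodule.smul_mem_pointwise_smul _ _ _ trivial)

theorem idealSMulTop_ofList_cons_map_mkQ (z : Z) (rs : List Z) :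
    (idealSMulTop A (Ideal.ofList (z :: rs)) Y).map (z • (⊤ : Submodule A Y)).mkQ =
      idealSMulTop A (Ideal.ofList rs) (Y ⧸ z • (⊤ : Submodule A Y)) := by
  rw [← idealSMulTop_map_mkQ]
  refine le_antisymm (Submodule.map_le_iff_le_comap.mpr fun y hy => ?_)
    (Submodule.map_mono fun y hy => ?_)
  · rw [mem_idealSMulTop, Ideal.ofList_cons_smul] at hy
    obtain ⟨u, hu, v, hv, rfl⟩ := Submodule.mem_sup.mp hy
    obtain ⟨w, -, rfl⟩ := (Submodule.mem_smul_pointwise_iff_exists _ _ _).mp hu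
    refine ⟨v, hv, ((Submodule.Quotient.eq _).mpr ?_)⟩
    rw [sub_add_cancel_right, ← smul_neg]
    exact Submodule.smul_mem_pointwise_smul _ _ _ trivial
  · rw [mem_idealSMulTop, Ideal.ofList_cons_smul]
    exact Submodule.mem_sup_right hy

/-- Dividing `Y` by `(z, rs) Y` is dividing `Y ⧸ z Y` by `rs`. -/
def quotientOfListConsEquiv (z : Z) (rs : List Z) :
    ((Y ⧸ z • (⊤ : Submodule A Y)) ⧸
        idealSMulTop A (Ideal.ofList rs) (Y ⧸ z • (⊤ : Submodule A Y))) ≃ₗ[A]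
      Y ⧸ idealSMulTop A (Ideal.ofList (z :: rs)) Y :=
  (Submodule.quotEquivOfEq _ _ (idealSMulTop_ofList_cons_map_mkQ A Y z rs).symm).trans
    (Submodule.quotientQuotientEquivQuotient _ _ (smul_top_le_idealSMulTop_ofList_cons A Y z rs))

end IdealSMulTop

section Rees

open CategoryTheory Abelian

variable {Z A : Type u} [CommRing Z] [Ring A] [Algebra Z A]

open scoped ModuleCat.Algebra in
theorem ext_comp_central {X Y : ModuleCat.{u} A} (z : Z) {f : X ⟶ X} {g : Y ⟶ Y}
    (hf : ∀ x, f.hom x = algebraMap Z A z • x) (hg : ∀ y, g.hom y = algebraMap Z A z • y) {i : ℕ}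
    (x : Ext X Y i) : x.comp (Ext.mk₀ g) (add_zero i) = (Ext.mk₀ f).comp x (zero_add i) := by
  have hgz : g = z • 𝟙 Y := by
    ext y
    exact hg y
  have hfz : f = z • 𝟙 X := by
    ext y
    exact hf y
  rw [hgz, hfz, Ext.mk₀_smul, Ext.mk₀_smul, Ext.comp_smul, Ext.comp_mk₀_id, Ext.smul_comp,
    Ext.mk₀_id_comp]

variable {M Y : Type u} [AddCommGroup M] [Module A M] [AddCommGroup Y] [Module A Y]

theorem nontrivial_ext_zero_iff :
    Nontrivial (Ext (ModuleCat.of A M) (ModuleCat.of A Y) 0) ↔ ∃ f : M →ₗ[A] Y, f ≠ 0 := by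
  have e : Ext (ModuleCat.of A M) (ModuleCat.of A Y) 0 ≃ (M →ₗ[A] Y) :=
    Ext.addEquiv₀.toEquiv.trans ModuleCat.homAddEquiv.toEquiv
  rw [e.nontrivial_congr, nontrivial_iff_exists_ne 0]

theorem extGrade_le_of_nontrivial {n : ℕ}
    (h : Nontrivial (Ext (ModuleCat.of A M) (ModuleCat.of A Y) n)) : extGrade A M Y ≤ n :=
  iInf₂_le (f := fun (i : ℕ) (_ : Nontrivial (Ext (ModuleCat.of A M) (ModuleCat.of A Y) i)) =>
    (i : ℕ∞)) n h

theorem natCast_le_extGrade_iff {n : ℕ} :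
    (n : ℕ∞) ≤ extGrade A M Y ↔
      ∀ i < n, Subsingleton (Ext (ModuleCat.of A M) (ModuleCat.of A Y) i) := by
  simp only [extGrade, le_iInf_iff, Nat.cast_le, ← not_nontrivial_iff_subsingleton]
  exact forall_congr' fun i => by rw [← not_lt, imp_not_comm]

variable [Module Z M] [IsScalarTower Z A M] [Module Z Y] [IsScalarTower Z A Y]

theorem ext_comp_smul_eq_zero {z : Z} (hz : ∀ x : M, z • x = 0) {i : ℕ}
    (x : Ext (ModuleCat.of A M) (ModuleCat.of A Y) i) :
    x.comp (Ext.mk₀ (ModuleCat.ofHom (z • (LinearMap.id : Y →ₗ[A] Y)))) (add_zero i) = 0 := by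
  rw [ext_comp_central z (f := 0), Ext.mk₀_zero, Ext.zero_comp]
  · exact fun y => ((algebraMap_smul A z (y : M)).trans (hz y)).symm
  · exact fun y => (algebraMap_smul A z (y : Y)).symm

-- Multiplication by `z` acts as zero on `Ext(M, Y)`, so the long exact sequence of
-- `0 → Y → Y → Y ⧸ zY → 0` breaks into short ones.
theorem subsingleton_ext_quotient_smul_top_iff {z : Z} (hz : ∀ x : M, z • x = 0)
    (hreg : IsSMulRegular Y z) (i : ℕ) :
    Subsingleton (Ext (ModuleCat.of A M) (ModuleCat.of A (Y ⧸ z • (⊤ : Submodule A Y))) i) ↔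
      Subsingleton (Ext (ModuleCat.of A M) (ModuleCat.of A Y) i) ∧
        Subsingleton (Ext (ModuleCat.of A M) (ModuleCat.of A Y) (i + 1)) := by
  have hexact : Function.Exact (z • (LinearMap.id : Y →ₗ[A] Y)) (z • (⊤ : Submodule A Y)).mkQ :=
    fun x => by simp [Submodule.mem_smul_pointwise_iff_exists]
  let S : ShortComplex (ModuleCat.{u} A) :=
    ModuleCat.shortComplexOfCompEqZero _ _ hexact.linearMap_comp_eq_zero
  have hS : S.ShortExact :=
    { exact := ModuleCat.shortComplex_exact _ hexact
      mono_f := (ModuleCat.mono_iff_injective _).mpr hreg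
      epi_g := (ModuleCat.epi_iff_surjective _).mpr (Submodule.mkQ_surjective _) }
  have hzero : ∀ {j : ℕ} (x : Ext (ModuleCat.of A M) (ModuleCat.of A Y) j),
      x.comp (Ext.mk₀ S.f) (add_zero j) = 0 := fun x => ext_comp_smul_eq_zero hz x
  refine ⟨fun h => ⟨subsingleton_of_forall_eq 0 fun x => ?_,
    subsingleton_of_forall_eq 0 fun x => ?_⟩, fun h => subsingleton_of_forall_eq 0 fun x => ?_⟩
  · obtain ⟨y, rfl⟩ := Ext.covariant_sequence_exact₂ (ModuleCat.of A M) hS x (h.elim _ _)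
    exact hzero y
  · obtain ⟨y, rfl⟩ := Ext.covariant_sequence_exact₁ (ModuleCat.of A M) hS x (hzero x) rfl
    rw [show y = 0 from h.elim _ _, Ext.zero_comp]
  · obtain ⟨y, rfl⟩ :=
      Ext.covariant_sequence_exact₃ (ModuleCat.of A M) hS x rfl (h.2.elim _ _)
    rw [show y = 0 from h.1.elim _ _, Ext.zero_comp]

theorem subsingleton_ext_zero_of_isSMulRegular {z : Z} (hz : ∀ x : M, z • x = 0)
    (hreg : IsSMulRegular Y z) :
    Subsingleton (Ext (ModuleCat.of A M) (ModuleCat.of A Y) 0) := by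
  rw [← not_nontrivial_iff_subsingleton, nontrivial_ext_zero_iff]
  rintro ⟨f, hf⟩
  refine hf (LinearMap.ext fun x => hreg ?_)
  simpa [hz] using (LinearMap.map_smul_of_tower f z x).symm

variable {rs : List Z} (hM : ∀ r ∈ rs, ∀ x : M, r • x = 0) (hrs : IsWeaklyRegular Y rs)

include hM hrs

theorem subsingleton_ext_of_lt_length {i : ℕ} (hi : i < rs.length) :
    Subsingleton (Ext (ModuleCat.of A M) (ModuleCat.of A Y) i) := by
  induction rs generalizing Y i with
  | nil => simp at hi
  | cons z rs ih =>
    rw [isWeaklyRegular_cons_iff] at hrs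
    have hz : ∀ x : M, z • x = 0 := hM z (by simp)
    cases i with
    | zero => exact subsingleton_ext_zero_of_isSMulRegular hz hrs.1
    | succ i =>
      exact ((subsingleton_ext_quotient_smul_top_iff hz hrs.1 i).mp
        (ih (fun r hr => hM r (by simp [hr]))
          (((quotSMulTopEquiv Z A Y z).isWeaklyRegular_congr rs).mp hrs.2) (by simpa using hi))).2

theorem length_le_extGrade : (rs.length : ℕ∞) ≤ extGrade A M Y :=
  natCast_le_extGrade_iff.mpr fun _ => subsingleton_ext_of_lt_length hM hrs

theorem subsingleton_ext_length_iff :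
    Subsingleton (Ext (ModuleCat.of A M) (ModuleCat.of A Y) rs.length) ↔
      Subsingleton (M →ₗ[A] Y ⧸ idealSMulTop A (Ideal.ofList rs) Y) := by
  induction rs generalizing Y with
  | nil =>
    have hbot : idealSMulTop A (Ideal.ofList ([] : List Z)) Y = ⊥ := by
      ext y
      simp [mem_idealSMulTop]
    have e : (M →ₗ[A] Y ⧸ idealSMulTop A (Ideal.ofList ([] : List Z)) Y) ≃+ (M →ₗ[A] Y) :=
      (LinearEquiv.refl A M).arrowCongrAddEquiv (Submodule.quotEquivOfEqBot _ hbot)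
    rw [e.toEquiv.subsingleton_congr, ← not_nontrivial_iff_subsingleton,
      ← not_nontrivial_iff_subsingleton, List.length_nil, nontrivial_ext_zero_iff,
      nontrivial_iff_exists_ne 0]
  | cons z rs ih =>
    have hlt := subsingleton_ext_of_lt_length (A := A) hM hrs (i := rs.length) (by simp)
    rw [isWeaklyRegular_cons_iff] at hrs
    have e : (M →ₗ[A] _) ≃+ (M →ₗ[A] _) :=
      (LinearEquiv.refl A M).arrowCongrAddEquiv (quotientOfListConsEquiv A Y z rs)
    rw [← e.toEquiv.subsingleton_congr, ← ih (fun r hr => hM r (by simp [hr]))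
      (((quotSMulTopEquiv Z A Y z).isWeaklyRegular_congr rs).mp hrs.2),
      subsingleton_ext_quotient_smul_top_iff (hM z (by simp)) hrs.1, List.length_cons]
    exact (and_iff_right hlt).symm

theorem nontrivial_ext_length_iff :
    Nontrivial (Ext (ModuleCat.of A M) (ModuleCat.of A Y) rs.length) ↔
      ∃ f : M →ₗ[A] Y ⧸ idealSMulTop A (Ideal.ofList rs) Y, f ≠ 0 := by
  rw [← not_subsingleton_iff_nontrivial, subsingleton_ext_length_iff hM hrs,
    not_subsingleton_iff_nontrivial, nontrivial_iff_exists_ne 0]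

theorem extGrade_eq_length_iff :
    extGrade A M Y = rs.length ↔ ∃ f : M →ₗ[A] Y ⧸ idealSMulTop A (Ideal.ofList rs) Y, f ≠ 0 := by
  rw [← nontrivial_ext_length_iff hM hrs]
  refine ⟨fun h => ?_, fun h =>
    le_antisymm (extGrade_le_of_nontrivial h) (length_le_extGrade hM hrs)⟩
  by_contra hn
  have : ((rs.length + 1 : ℕ) : ℕ∞) ≤ extGrade A M Y := natCast_le_extGrade_iff.mpr fun i hi =>
    (Nat.lt_succ_iff_lt_or_eq.mp hi).elim (subsingleton_ext_of_lt_length hM hrs) fun hi =>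
      hi ▸ not_nontrivial_iff_subsingleton.mp hn
  rw [h, Nat.cast_le] at this
  omega

theorem length_add_one_le_extGrade
    (h : ¬ ∃ f : M →ₗ[A] Y ⧸ idealSMulTop A (Ideal.ofList rs) Y, f ≠ 0) :
    (rs.length : ℕ∞) + 1 ≤ extGrade A M Y :=
  Order.add_one_le_of_lt (lt_of_le_of_ne (length_le_extGrade hM hrs)
    fun he => h ((extGrade_eq_length_iff hM hrs).mp he.symm))

end Rees

section Exchange

variable {Z : Type u} [CommRing Z] [IsNoetherianRing Z]
  {Y : Type u} [AddCommGroup Y] [Module Z Y] [Module.Finite Z Y]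

-- Otherwise `Z ⧸ I` maps nontrivially to `Y ⧸ rs Y`, so `Ext(Z ⧸ I, Y)` does not vanish in degree
-- `rs.length`, whereas it vanishes below degree `ss.length`.
theorem exists_isSMulRegular_of_length_lt {I : Ideal Z} {rs ss : List Z}
    (hrs : IsWeaklyRegular Y rs) (hrI : ∀ r ∈ rs, r ∈ I)
    (hss : IsWeaklyRegular Y ss) (hsI : ∀ s ∈ ss, s ∈ I) (hlt : rs.length < ss.length) :
    ∃ x ∈ I, IsSMulRegular (Y ⧸ (Ideal.ofList rs • ⊤ : Submodule Z Y)) x := by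
  by_contra! h
  obtain ⟨p, hp, hIp⟩ := exists_le_associatedPrime_of_forall_not_isSMulRegular h
  obtain ⟨hprime, g, hg⟩ := (isAssociatedPrime_iff_exists_injective_linearMap _ _).mp hp
  have hkill : ∀ {ts : List Z}, (∀ t ∈ ts, t ∈ I) → ∀ t ∈ ts, ∀ x : Z ⧸ I, t • x = 0 :=
    fun hts t ht x => by
      obtain ⟨x, rfl⟩ := Ideal.Quotient.mk_surjective x
      rw [Algebra.smul_def, Ideal.Quotient.algebraMap_eq,
        Ideal.Quotient.eq_zero_iff_mem.mpr (hts t ht), zero_mul]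
  have hsub := subsingleton_ext_of_lt_length (A := Z) (hkill hsI) hss hlt
  refine not_nontrivial_iff_subsingleton.mpr hsub
    ((nontrivial_ext_length_iff (A := Z) (hkill hrI) hrs).mpr
      ⟨(idealSMulTopQuotEquiv Z (Ideal.ofList rs) Y).toLinearMap ∘ₗ g ∘ₗ
        Submodule.factor hIp, fun h0 => ?_⟩)
  have h1 : g 1 = 0 := by simpa using! LinearMap.congr_fun h0 1
  have := Ideal.Quotient.nontrivial_iff.mpr hprime.ne_top
  exact one_ne_zero (hg (h1.trans g.map_zero.symm))

end Exchange

/-! ### Modules of constant depth -/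

section MaximalRegularSequences

variable {Z : Type*} [CommRing Z] {Y : Type*} [AddCommGroup Y] [Module Z Y]

theorem le_annihilator_quotient_smul_top (I : Ideal Z) :
    I ≤ Module.annihilator Z (Y ⧸ (I • ⊤ : Submodule Z Y)) := by
  intro a ha
  rw [Module.mem_annihilator]
  intro y
  obtain ⟨y, rfl⟩ := Submodule.Quotient.mk_surjective _ y
  rw [← Submodule.Quotient.mk_smul, Submodule.Quotient.mk_eq_zero]
  exact Submodule.smul_mem_smul ha trivial

theorem isWeaklyRegular_concat {rs : List Z} (hrs : IsWeaklyRegular Y rs) {x : Z}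
    (hx : IsSMulRegular (Y ⧸ (Ideal.ofList rs • ⊤ : Submodule Z Y)) x) :
    IsWeaklyRegular Y (rs ++ [x]) :=
  (isWeaklyRegular_append_iff Y rs [x]).mpr ⟨hrs, (isWeaklyRegular_singleton_iff _ x).mpr hx⟩

variable [IsNoetherianRing Z] [Module.Finite Z Y]

theorem exists_isWeaklyRegular_le_associatedPrime {I : Ideal Z} {d : ℕ}
    (hd : ∀ rs : List Z, (∀ r ∈ rs, r ∈ I) → IsWeaklyRegular Y rs → rs.length ≤ d) :
    ∃ rs : List Z, (∀ r ∈ rs, r ∈ I) ∧ IsWeaklyRegular Y rs ∧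
      ∃ p ∈ associatedPrimes Z (Y ⧸ (Ideal.ofList rs • ⊤ : Submodule Z Y)), I ≤ p := by
  by_contra! hcon
  have hall : ∀ n, ∃ rs : List Z, rs.length = n ∧ (∀ r ∈ rs, r ∈ I) ∧ IsWeaklyRegular Y rs := by
    intro n
    induction n with
    | zero => exact ⟨[], rfl, by simp, by simp⟩
    | succ n ih =>
      obtain ⟨rs, hlen, hrI, hrs⟩ := ih
      obtain ⟨x, hxI, hx⟩ :
          ∃ x ∈ I, IsSMulRegular (Y ⧸ (Ideal.ofList rs • ⊤ : Submodule Z Y)) x := by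
        by_contra! h
        obtain ⟨p, hp, hIp⟩ := exists_le_associatedPrime_of_forall_not_isSMulRegular h
        exact hcon rs hrI hrs p hp hIp
      exact ⟨rs ++ [x], by simp [hlen], by simpa [or_imp, forall_and, hxI] using hrI,
        isWeaklyRegular_concat hrs hx⟩
  obtain ⟨rs, hlen, hrI, hrs⟩ := hall (d + 1)
  have := hd rs hrI hrs
  omega

end MaximalRegularSequences

section FaithfulModules

variable {Z : Type*} [CommRing Z] {Y : Type*} [AddCommGroup Y] [Module Z Y] [Module.Finite Z Y]

theorem mem_support_quotient_ofList (hY : Module.annihilator Z Y = ⊥) {rs : List Z}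
    {p : PrimeSpectrum Z} :
    p ∈ Module.support Z (Y ⧸ (Ideal.ofList rs • ⊤ : Submodule Z Y)) ↔ ∀ r ∈ rs, r ∈ p.asIdeal := by
  rw [Module.support_quotient, Set.mem_inter_iff, Module.mem_support_iff_of_finite, hY,
    and_iff_right bot_le, PrimeSpectrum.mem_zeroLocus]
  exact Ideal.span_le

theorem supportDim_eq_ringKrullDim_of_annihilator_eq_bot (hY : Module.annihilator Z Y = ⊥) :
    Module.supportDim Z Y = ringKrullDim Z := by
  have : Module.support Z Y = Set.univ := by
    ext p
    simp [Module.mem_support_iff_of_finite, hY]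
  rw [Module.supportDim, this, ringKrullDim]
  exact Order.krullDim_eq_of_orderIso OrderIso.Set.univ

theorem length_add_le_ringKrullDim [IsNoetherianRing Z] (hY : Module.annihilator Z Y = ⊥)
    {M : Type*} [AddCommGroup M] [Module Z M] [Module.Finite Z M] {k : ℕ}
    (hk : Module.supportDim Z M = k) {rs : List Z} (hrM : ∀ r ∈ rs, r ∈ Module.annihilator Z M)
    (hrs : IsWeaklyRegular Y rs) : ((k + rs.length : ℕ) : WithBot ℕ∞) ≤ ringKrullDim Z := by
  obtain ⟨p, hp, hpk⟩ := natCast_le_supportDim_iff.mp hk.ge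
  have hpY := (mem_support_quotient_ofList hY (rs := rs)).mpr
    fun r hr => Module.mem_support_iff_of_finite.mp hp (hrM r hr)
  have hkY : (k : WithBot ℕ∞) ≤ _ := natCast_le_supportDim_iff.mpr ⟨p, hpY, hpk⟩
  rw [← supportDim_eq_ringKrullDim_of_annihilator_eq_bot hY]
  push_cast
  exact (add_le_add_left hkY _).trans (supportDim_quotient_ofList_add_length_le hrs)

end FaithfulModules

section Depth

variable {Z : Type u} [CommRing Z] {Y : Type u} [AddCommGroup Y] [Module Z Y]

variable (Z Y) in
/-- `Y` has depth at least `d` at every maximal ideal of `Z`: each of them contains a weakly regular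
sequence of length `d` on `Y`. -/
def HasDepth (d : ℕ) : Prop :=
  ∀ m : Ideal Z, m.IsMaximal →
    ∃ rs : List Z, rs.length = d ∧ (∀ r ∈ rs, r ∈ m) ∧ IsWeaklyRegular Y rs

variable [IsNoetherianRing Z] [Module.Finite Z Y]

theorem exists_isWeaklyRegular_append {I : Ideal Z} {rs ss : List Z} (hrs : IsWeaklyRegular Y rs)
    (hrI : ∀ r ∈ rs, r ∈ I) (hss : IsWeaklyRegular Y ss) (hsI : ∀ s ∈ ss, s ∈ I) (n : ℕ)
    (hn : n + rs.length ≤ ss.length) :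
    ∃ ts : List Z, ts.length = n ∧ (∀ t ∈ ts, t ∈ I) ∧ IsWeaklyRegular Y (rs ++ ts) := by
  induction n with
  | zero => exact ⟨[], rfl, by simp, by simpa using hrs⟩
  | succ n ih =>
    obtain ⟨ts, hlen, htI, hts⟩ := ih (by omega)
    obtain ⟨x, hxI, hx⟩ := exists_isSMulRegular_of_length_lt hts
      (by simpa [or_imp, forall_and] using ⟨hrI, htI⟩) hss hsI
      (by simp only [List.length_append]; omega)
    refine ⟨ts ++ [x], by simp [hlen], by simpa [or_imp, forall_and, hxI] using htI, ?_⟩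
    rw [← List.append_assoc]
    exact isWeaklyRegular_concat hts hx

theorem exists_isWeaklyRegular_quotient {I : Ideal Z} {rs ss : List Z} (hrs : IsWeaklyRegular Y rs)
    (hrI : ∀ r ∈ rs, r ∈ I) (hss : IsWeaklyRegular Y ss) (hsI : ∀ s ∈ ss, s ∈ I) :
    ∃ ts : List Z, ss.length ≤ rs.length + ts.length ∧ (∀ t ∈ ts, t ∈ I) ∧
      IsWeaklyRegular (Y ⧸ (Ideal.ofList rs • ⊤ : Submodule Z Y)) ts := by
  rcases le_total ss.length rs.length with h | h
  · exact ⟨[], by simpa using h, by simp, by simp⟩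
  · obtain ⟨ts, hlen, htI, hts⟩ :=
      exists_isWeaklyRegular_append hrs hrI hss hsI (ss.length - rs.length) (by omega)
    exact ⟨ts, by omega, htI, ((isWeaklyRegular_append_iff Y rs ts).mp hts).2⟩

namespace HasDepth

variable {d : ℕ} (hd : HasDepth Z Y d)

include hd

theorem exists_ltSeries {rs : List Z} (hrs : IsWeaklyRegular Y rs) {p m : PrimeSpectrum Z}
    (hm : m.asIdeal.IsMaximal)
    (hp : p.asIdeal ∈ associatedPrimes Z (Y ⧸ (Ideal.ofList rs • ⊤ : Submodule Z Y)))
    (hpm : p ≤ m) :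
    ∃ l : LTSeries (PrimeSpectrum Z), l.head = p ∧ l.last ≤ m ∧ d ≤ rs.length + l.length := by
  obtain ⟨ss, rfl, hsm, hss⟩ := hd m.asIdeal hm
  have hrm : ∀ r ∈ rs, r ∈ m.asIdeal := fun r hr => hpm
    (annihilator_le_of_mem_associatedPrimes hp (le_annihilator_quotient_smul_top _
      (Ideal.subset_span hr)))
  obtain ⟨ts, hlen, htm, hts⟩ := exists_isWeaklyRegular_quotient hrs hrm hss hsm
  obtain ⟨l, hhead, hlast, hl⟩ := exists_ltSeries_of_isWeaklyRegular hp hpm htm hts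
  exact ⟨l, hhead, hlast, hl ▸ hlen⟩

theorem le_length_add_coheight {rs : List Z} (hrs : IsWeaklyRegular Y rs) {p : PrimeSpectrum Z}
    (hp : p.asIdeal ∈ associatedPrimes Z (Y ⧸ (Ideal.ofList rs • ⊤ : Submodule Z Y))) :
    (d : ℕ∞) ≤ rs.length + Order.coheight p := by
  obtain ⟨m, hm, hpm⟩ := Ideal.exists_le_maximal p.asIdeal p.isPrime.ne_top
  obtain ⟨l, rfl, -, hl⟩ := hd.exists_ltSeries hrs (m := ⟨m, hm.isPrime⟩) hm hp hpm
  calc (d : ℕ∞) ≤ rs.length + l.length := by exact_mod_cast hl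
    _ ≤ _ := by
      gcongr
      exact Order.length_le_coheight_head

-- A maximal weakly regular sequence in the annihilator of `M` has length at most `d - k` for
-- dimension reasons, and at least `d - k` since an associated prime contains the annihilator.
theorem exists_isWeaklyRegular_annihilator (hdim : ringKrullDim Z = d)
    (hY : Module.annihilator Z Y = ⊥)
    {M : Type*} [AddCommGroup M] [Module Z M] [Module.Finite Z M] {k : ℕ}
    (hk : Module.supportDim Z M = k) :
    ∃ rs : List Z, (∀ r ∈ rs, r ∈ Module.annihilator Z M) ∧ IsWeaklyRegular Y rs ∧
      rs.length + k = d ∧ ∃ p ∈ associatedPrimes Z (Y ⧸ (Ideal.ofList rs • ⊤ : Submodule Z Y)),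
        Module.annihilator Z M ≤ p := by
  have hbound : ∀ rs : List Z, (∀ r ∈ rs, r ∈ Module.annihilator Z M) → IsWeaklyRegular Y rs →
      k + rs.length ≤ d := fun rs hrM hrs => by
    exact_mod_cast hdim ▸ length_add_le_ringKrullDim hY hk hrM hrs
  obtain ⟨rs, hrM, hrs, p, hp, hMp⟩ := exists_isWeaklyRegular_le_associatedPrime
    fun rs hrM hrs => (Nat.le_add_left _ k).trans (hbound rs hrM hrs)
  have hpk : Order.coheight (⟨p, hp.isPrime⟩ : PrimeSpectrum Z) ≤ (k : ℕ∞) := by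
    have := coheight_le_supportDim (M := M) (p := ⟨p, hp.isPrime⟩)
      (Module.mem_support_iff_of_finite.mpr hMp)
    rw [hk] at this
    exact WithBot.coe_le_coe.mp this
  have hdk : (d : ℕ∞) ≤ rs.length + k :=
    (hd.le_length_add_coheight hrs (p := ⟨p, hp.isPrime⟩) hp).trans (by gcongr)
  refine ⟨rs, hrM, hrs, le_antisymm ?_ (by exact_mod_cast hdk), p, hp, hMp⟩
  exact add_comm rs.length k ▸ hbound rs hrM hrs

end HasDepth

end Depth

/-! ### The grade formula -/

section KrullMacaulay

variable (Z : Type u) [CommRing Z] (A : Type u) [Ring A] [Algebra Z A]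
  (Y : Type u) [AddCommGroup Y] [Module A Y] [Module Z Y] [IsScalarTower Z A Y]

/-- A finite `A`-module `M` killed by a weakly regular sequence `rs` on `Y` has a nonzero
homomorphism to `Y ⧸ rs Y` over `A` as soon as it has one over `Z`, that is, as soon as the
annihilator of `M` lies in an associated prime of `Y ⧸ rs Y`. -/
def HasEnoughHoms : Prop :=
  ∀ (M : Type u) [AddCommGroup M] [Module A M] [Module Z M] [IsScalarTower Z A M],
    Module.Finite A M → ∀ rs : List Z, (∀ r ∈ rs, r ∈ Module.annihilator Z M) →
      IsWeaklyRegular Y rs →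
      ∀ p ∈ associatedPrimes Z (Y ⧸ (Ideal.ofList rs • ⊤ : Submodule Z Y)),
        Module.annihilator Z M ≤ p →
          ∃ f : M →ₗ[A] Y ⧸ idealSMulTop A (Ideal.ofList rs) Y, f ≠ 0

/-- The equality of dimensions that defines Krull-Macaulay rings, on one side: there `Y` is the
regular module. -/
def HasGradeFormula (A : Type u) [Ring A] (Y : Type u) [AddCommGroup Y] [Module A Y] : Prop :=
  ∀ (M : Type u) [AddCommGroup M] [Module A M], Module.Finite A M → Nontrivial M →
    Kdim A Y = Kdim A M + (extGrade A M Y : WithBot ℕ∞)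

variable {Z A Y}

theorem exists_supportDim_eq_natCast {d : ℕ} (hdim : ringKrullDim Z = d) {M : Type*}
    [AddCommGroup M] [Module Z M] [Nontrivial M] : ∃ k : ℕ, Module.supportDim Z M = k := by
  obtain ⟨k, hk⟩ := WithBot.ne_bot_iff_exists.mp (Module.supportDim_ne_bot_of_nontrivial Z M)
  have h := Module.supportDim_le_ringKrullDim Z M
  rw [hdim, ← hk] at h
  have hkd : k ≤ (d : ℕ∞) := WithBot.coe_le_coe.mp h
  obtain ⟨n, rfl⟩ := ENat.ne_top_iff_exists.mp (ne_top_of_le_ne_top (ENat.natCast_ne_top d) hkd)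
  exact ⟨n, hk.symm⟩

theorem supportDim_eq_zero_of_isMaximal_le_annihilator {M : Type*} [AddCommGroup M] [Module Z M]
    [Module.Finite Z M] [Nontrivial M] {m : Ideal Z} (hm : m.IsMaximal)
    (hmM : m ≤ Module.annihilator Z M) : Module.supportDim Z M = 0 := by
  have hne : Module.annihilator Z M ≠ ⊤ := fun h =>
    not_subsingleton M (Module.annihilator_eq_top_iff.mp h)
  rw [Module.supportDim_eq_ringKrullDim_quotient_annihilator, ← hm.eq_of_le hne hmM]
  let _ := Ideal.Quotient.field m
  exact ringKrullDim_eq_zero_of_field _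

theorem exists_linearMap_quotient_ne_zero [IsNoetherianRing Z] {I p : Ideal Z}
    (hp : p ∈ associatedPrimes Z Y) (hIp : I ≤ p) :
    ∃ f : A ⧸ idealSMulTop A I A →ₗ[A] Y, f ≠ 0 := by
  obtain ⟨hprime, x, hx⟩ := isAssociatedPrime_iff.mp hp
  have hpx : ∀ z, z ∈ p ↔ z • x = 0 := fun z => by
    rw [hx, Submodule.mem_colon_singleton, Submodule.mem_bot]
  have hle : idealSMulTop A I A ≤ LinearMap.ker (LinearMap.toSpanSingleton A Y x) := fun a ha =>
    Submodule.smul_induction_on (mem_idealSMulTop.mp ha)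
      (fun z hz a _ => by
        rw [LinearMap.mem_ker, LinearMap.toSpanSingleton_apply, smul_assoc, smul_comm,
          (hpx z).mp (hIp hz), smul_zero])
      fun a b ha hb => Submodule.add_mem _ ha hb
  refine ⟨Submodule.liftQ _ _ hle, fun h0 => (Ideal.ne_top_iff_one p).mp hprime.ne_top ?_⟩
  simpa [hpx] using LinearMap.congr_fun h0 (Submodule.Quotient.mk 1)

variable [IsNoetherianRing Z] [Module.Finite Z Y]

theorem HasDepth.hasGradeFormula [Module.Finite Z A] {d : ℕ} (hd : HasDepth Z Y d)
    (hdim : ringKrullDim Z = d) (hY : Module.annihilator Z Y = ⊥) (hom : HasEnoughHoms Z A Y) :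
    HasGradeFormula A Y := by
  intro M _ _ hM _
  let _ : Module Z M := Module.compHom M (algebraMap Z A)
  have : IsScalarTower Z A M := IsScalarTower.of_algebraMap_smul fun _ _ => rfl
  have : Module.Finite Z M := Module.Finite.trans A M
  obtain ⟨k, hk⟩ := exists_supportDim_eq_natCast hdim (M := M)
  obtain ⟨rs, hrM, hrs, hlen, p, hp, hMp⟩ := hd.exists_isWeaklyRegular_annihilator hdim hY hk
  have hgrade := (extGrade_eq_length_iff (A := A)
    (fun r hr => Module.mem_annihilator.mp (hrM r hr)) hrs).mpr (hom M hM rs hrM hrs p hp hMp)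
  rw [hgrade, kdim_eq_supportDim Z, kdim_eq_supportDim Z, hk,
    supportDim_eq_ringKrullDim_of_annihilator_eq_bot hY, hdim, ← hlen]
  push_cast
  exact add_comm _ _

namespace HasGradeFormula

variable (h : HasGradeFormula A Y) {d : ℕ} (hdim : ringKrullDim Z = d)
  (hY : Module.annihilator Z Y = ⊥)

include h hdim hY

theorem eq_add_extGrade {M : Type u} [AddCommGroup M] [Module A M] [Module Z M]
    [IsScalarTower Z A M] [Module.Finite Z M] [Nontrivial M] {k : ℕ}
    (hk : Module.supportDim Z M = k) : (d : ℕ∞) = k + extGrade A M Y := by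
  have hM := h M (Module.Finite.of_restrictScalars_finite Z A M) inferInstance
  rw [kdim_eq_supportDim Z, kdim_eq_supportDim Z, hk,
    supportDim_eq_ringKrullDim_of_annihilator_eq_bot hY, hdim] at hM
  exact_mod_cast hM

variable [Module.Finite Z A]

-- The test module is `A ⧸ mA`, which has dimension `0` and hence grade `d`.
theorem hasDepth : HasDepth Z Y d := by
  intro m hm
  have hmY : (⟨m, hm.isPrime⟩ : PrimeSpectrum Z) ∈ Module.support Z A := by
    refine Module.mem_support_iff_of_finite.mpr fun z hz => ?_
    have : z ∈ Module.annihilator Z Y := Module.mem_annihilator.mpr fun y => by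
      rw [← one_smul A y, ← smul_assoc, Module.mem_annihilator.mp hz, zero_smul]
    simp [show z = 0 by simpa [hY] using this]
  let M := A ⧸ idealSMulTop A m A
  have hmM : m ≤ Module.annihilator Z M :=
    (idealSMulTopQuotEquiv A m A).annihilator_eq ▸ le_annihilator_quotient_smul_top m
  have : Nontrivial M := by
    rw [← Module.nonempty_support_iff (R := Z), ← (idealSMulTopQuotEquiv A m A).support_eq,
      Module.support_quotient]
    exact ⟨_, hmY, (PrimeSpectrum.mem_zeroLocus _ _).mpr le_rfl⟩
  have hgrade : (d : ℕ∞) = extGrade A M Y := by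
    simpa using h.eq_add_extGrade hdim hY (M := M) (k := 0)
      (supportDim_eq_zero_of_isMaximal_le_annihilator hm hmM)
  have hkill : ∀ rs : List Z, (∀ r ∈ rs, r ∈ m) → ∀ r ∈ rs, ∀ x : M, r • x = 0 :=
    fun _ hrm r hr => Module.mem_annihilator.mp (hmM (hrm r hr))
  obtain ⟨rs, hrm, hrs, p, hp, hmp⟩ := exists_isWeaklyRegular_le_associatedPrime (Y := Y)
    fun rs hrm hrs => by exact_mod_cast hgrade ▸ length_le_extGrade (A := A) (hkill rs hrm) hrs
  rw [LinearEquiv.AssociatedPrimes.eq (idealSMulTopQuotEquiv A (Ideal.ofList rs) Y)] at hp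
  have hlen := (extGrade_eq_length_iff (A := A) (hkill rs hrm) hrs).mpr
    (exists_linearMap_quotient_ne_zero hp hmp)
  exact ⟨rs, by exact_mod_cast (hgrade.trans hlen).symm, hrm, hrs⟩

theorem hasEnoughHoms : HasEnoughHoms Z A Y := by
  intro M _ _ _ _ hM rs hrM hrs p hp hMp
  by_contra hcon
  have : Module.Finite Z M := Module.Finite.trans A M
  have hpM : (⟨p, hp.isPrime⟩ : PrimeSpectrum Z) ∈ Module.support Z M :=
    Module.mem_support_iff_of_finite.mpr hMp
  have : Nontrivial M := Module.nonempty_support_iff.mp ⟨_, hpM⟩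
  obtain ⟨k, hk⟩ := exists_supportDim_eq_natCast hdim (M := M)
  have hpk : Order.coheight (⟨p, hp.isPrime⟩ : PrimeSpectrum Z) ≤ (k : ℕ∞) :=
    WithBot.coe_le_coe.mp ((coheight_le_supportDim hpM).trans_eq hk)
  have hle : (d : ℕ∞) ≤ rs.length + k :=
    ((h.hasDepth hdim hY).le_length_add_coheight hrs (p := ⟨p, hp.isPrime⟩) hp).trans (by gcongr)
  have hlt : ((k + (rs.length + 1) : ℕ) : ℕ∞) ≤ d := by
    rw [h.eq_add_extGrade hdim hY hk]
    push_cast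
    gcongr
    exact length_add_one_le_extGrade (fun r hr => Module.mem_annihilator.mp (hrM r hr)) hrs hcon
  norm_cast at hle hlt
  omega

end HasGradeFormula

end KrullMacaulay

/-! ### Grade symmetry -/

section TensorProduct

open scoped TensorProduct

variable (Z A B : Type*) [CommRing Z] [Ring A] [Algebra Z A] [Ring B] [Algebra Z B]
  (M N : Type*) [AddCommGroup M] [Module A M] [Module Z M] [IsScalarTower Z A M]
  [AddCommGroup N] [Module B N] [Module Z N] [IsScalarTower Z B N]

/-- The action of a `Z`-algebra on the second factor of a tensor product over `Z`. It is not an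
instance, as it would compete with the action on the first factor. -/
abbrev tensorRightModule : Module B (M ⊗[Z] N) :=
  Module.compHom _
    ((Module.End.lTensorAlgHom Z N M).comp (Algebra.lsmul Z Z N : B →ₐ[Z] Module.End Z N)).toRingHom

variable {Z A B M N}

theorem tensorRight_smul_tmul (b : B) (x : M) (y : N) :
    letI := tensorRightModule Z B M N
    b • (x ⊗ₜ[Z] y) = x ⊗ₜ[Z] (b • y) := rfl

theorem tensorRight_isScalarTower :
    letI := tensorRightModule Z B M N
    IsScalarTower Z B (M ⊗[Z] N) :=
  letI := tensorRightModule Z B M N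
  { smul_assoc := fun z b t => by
      induction t with
      | zero => simp
      | tmul x y => rw [tensorRight_smul_tmul, tensorRight_smul_tmul, smul_assoc,
          TensorProduct.tmul_smul]
      | add s t hs ht => rw [smul_add, smul_add, hs, ht, smul_add] }

theorem tensorRight_smulCommClass :
    letI := tensorRightModule Z B M N
    SMulCommClass A B (M ⊗[Z] N) :=
  letI := tensorRightModule Z B M N
  { smul_comm := fun a b t => by
      induction t with
      | zero => simp
      | tmul x y => rw [tensorRight_smul_tmul, TensorProduct.smul_tmul', TensorProduct.smul_tmul',
          tensorRight_smul_tmul]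
      | add s t hs ht => simp only [smul_add, hs, ht] }

theorem tensorRight_finite [Module.Finite Z M] [Module.Finite Z N] :
    letI := tensorRightModule Z B M N
    Module.Finite B (M ⊗[Z] N) :=
  letI := tensorRightModule Z B M N
  have : IsScalarTower Z B (M ⊗[Z] N) := tensorRight_isScalarTower
  Module.Finite.of_restrictScalars_finite Z B _

theorem tensorRight_algebraMap_smul (z : Z) (t : M ⊗[Z] N) :
    letI := tensorRightModule Z B M N
    algebraMap Z B z • t = algebraMap Z A z • t := by
  let _ := tensorRightModule Z B M N
  have : IsScalarTower Z B (M ⊗[Z] N) := tensorRight_isScalarTower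
  change algebraMap Z B z • t = algebraMap Z A z • t
  rw [algebraMap_smul, algebraMap_smul]

theorem exists_tensorRight_linearMap_ne_zero {X : Type*} [AddCommGroup X] [Module B X] [Module Z X]
    [IsScalarTower Z B X] {φ : M →ₗ[Z] X} (hφ : φ ≠ 0) :
    letI := tensorRightModule Z B M B
    ∃ ψ : M ⊗[Z] B →ₗ[B] X, ψ ≠ 0 := by
  let _ := tensorRightModule Z B M B
  let ψ : M ⊗[Z] B →ₗ[Z] X := TensorProduct.lift ((Algebra.lsmul Z Z X).toLinearMap.flip ∘ₗ φ)
  have hψ : ∀ m b, ψ (m ⊗ₜ b) = b • φ m := fun m b => TensorProduct.lift.tmul m b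
  refine ⟨{ ψ with map_smul' := fun b t => ?_ }, fun h0 => hφ (LinearMap.ext fun m => ?_)⟩
  · change ψ (b • t) = b • ψ t
    induction t with
    | zero => simp
    | tmul m c => rw [tensorRight_smul_tmul, hψ, hψ, smul_eq_mul, mul_smul]
    | add s t hs ht => rw [smul_add, map_add, map_add, smul_add, hs, ht]
  · have hm : ψ (m ⊗ₜ 1) = 0 := LinearMap.congr_fun h0 (m ⊗ₜ 1)
    rwa [hψ, one_smul] at hm

theorem exists_linearMap_ne_zero_of_tensor {X : Type*} [AddCommGroup X] [Module A X] [Module Z X]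
    [IsScalarTower Z A X] {g : M ⊗[Z] N →ₗ[A] X} (hg : g ≠ 0) : ∃ f : M →ₗ[A] X, f ≠ 0 := by
  by_contra! hcon
  exact hg (TensorProduct.AlgebraTensorModule.ext fun m n => LinearMap.congr_fun
    (hcon ((TensorProduct.AlgebraTensorModule.curry g).flip n)) m)

end TensorProduct

section GradeSymmetry

open scoped TensorProduct

theorem exists_linearMap_ne_zero_of_annihilator_le {Z : Type*} [CommRing Z] [IsNoetherianRing Z]
    {M X : Type*} [AddCommGroup M] [Module Z M] [Module.Finite Z M] [AddCommGroup X] [Module Z X]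
    [Module.Finite Z X] {p : Ideal Z} (hp : p ∈ associatedPrimes Z X)
    (hMp : Module.annihilator Z M ≤ p) : ∃ φ : M →ₗ[Z] X, φ ≠ 0 := by
  by_contra! hcon
  obtain ⟨r, hr, hreg⟩ := IsSMulRegular.subsingleton_linearMap_iff.mp
    (subsingleton_of_forall_eq (0 : M →ₗ[Z] X) hcon)
  exact notMem_of_isSMulRegular hreg hp (hMp hr)

variable (Z A B : Type u) [CommRing Z] [Ring A] [Algebra Z A] [Ring B] [Algebra Z B]

/-- For every finite `A`-module `M`, the bimodule `M ⊗[Z] B` has the same grade over `A` and over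
`B`. -/
def TensorGradeSymmetric (Y : Type u) [AddCommGroup Y] [Module A Y] [Module B Y] : Prop :=
  ∀ (M : Type u) [AddCommGroup M] [Module A M] [Module Z M] [IsScalarTower Z A M],
    Module.Finite A M →
      extGrade A (M ⊗[Z] B) Y = @extGrade B _ (M ⊗[Z] B) Y _ (tensorRightModule Z B M B) _ _

variable {Z A B}

-- A nonzero map `M → Y ⧸ rs Y` over `Z` extends to `M ⊗ B` over `B`; symmetry turns it into a
-- nonzero map over `A`.
theorem TensorGradeSymmetric.hasEnoughHoms [IsNoetherianRing Z] [Module.Finite Z A]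
    {Y : Type u} [AddCommGroup Y] [Module A Y] [Module B Y] [Module Z Y] [IsScalarTower Z A Y]
    [IsScalarTower Z B Y] [Module.Finite Z Y] (h : TensorGradeSymmetric Z A B Y) :
    HasEnoughHoms Z A Y := by
  intro M _ _ _ _ hM rs hrM hrs p hp hMp
  have : Module.Finite Z M := Module.Finite.trans A M
  let _ := tensorRightModule Z B M B
  have : IsScalarTower Z B (M ⊗[Z] B) := tensorRight_isScalarTower
  have hkill : ∀ r ∈ rs, ∀ t : M ⊗[Z] B, r • t = 0 := by
    intro r hr t
    induction t with
    | zero => simp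
    | tmul m n => rw [TensorProduct.smul_tmul', Module.mem_annihilator.mp (hrM r hr),
        TensorProduct.zero_tmul]
    | add s t hs ht => rw [smul_add, hs, ht, add_zero]
  have := Module.Finite.equiv (idealSMulTopQuotEquiv B (Ideal.ofList rs) Y)
  rw [LinearEquiv.AssociatedPrimes.eq (idealSMulTopQuotEquiv B (Ideal.ofList rs) Y)] at hp
  obtain ⟨φ, hφ⟩ := exists_linearMap_ne_zero_of_annihilator_le hp hMp
  have hB := (extGrade_eq_length_iff (A := B) hkill hrs).mpr
    (exists_tensorRight_linearMap_ne_zero hφ)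
  obtain ⟨g, hg⟩ := (extGrade_eq_length_iff (A := A) hkill hrs).mp ((h M hM).trans hB)
  exact exists_linearMap_ne_zero_of_tensor hg

variable {R : Type u} [Ring R] [Module.Finite (Subring.center R) R]

theorem IsGradeSymmetric.tensorGradeSymmetric_left (h : IsGradeSymmetric R) :
    TensorGradeSymmetric (Subring.center R) R Rᵐᵒᵖ R := by
  intro M _ _ _ _ hM
  have : Module.Finite (Subring.center R) M := Module.Finite.trans R M
  exact @h _ _ _ (tensorRightModule (Subring.center R) Rᵐᵒᵖ M Rᵐᵒᵖ) tensorRight_smulCommClass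
    (Module.Finite.of_restrictScalars_finite (Subring.center R) R _) tensorRight_finite
    fun z hz t =>
      (tensorRight_algebraMap_smul (A := R) (B := Rᵐᵒᵖ) (⟨z, hz⟩ : Subring.center R) t).symm

theorem IsGradeSymmetric.tensorGradeSymmetric_right (h : IsGradeSymmetric R) :
    TensorGradeSymmetric (Subring.center R) Rᵐᵒᵖ R R := by
  intro M _ _ _ _ hM
  have : Module.Finite (Subring.center R) M := Module.Finite.trans Rᵐᵒᵖ M
  let _ := tensorRightModule (Subring.center R) R M R
  have : SMulCommClass Rᵐᵒᵖ R (M ⊗[Subring.center R] R) := tensorRight_smulCommClass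
  exact (@h _ _ (tensorRightModule (Subring.center R) R M R) _ (SMulCommClass.symm _ _ _)
    tensorRight_finite (Module.Finite.of_restrictScalars_finite (Subring.center R) Rᵐᵒᵖ _)
    fun z hz t => tensorRight_algebraMap_smul (A := Rᵐᵒᵖ) (B := R)
      (⟨z, hz⟩ : Subring.center R) t).symm

end GradeSymmetry

/-! ### Prime ideals of central extensions -/

section PrimeIdeals

variable {R : Type*} [Ring R]

/-- The largest two-sided ideal `I` with `I * R * s ⊆ P`. -/
def leftColon (P : TwoSidedIdeal R) (s : Set R) : TwoSidedIdeal R :=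
  TwoSidedIdeal.mk' {x | ∀ b ∈ s, ∀ r, x * r * b ∈ P}
    (fun b _ r => by simp)
    (fun hx hy b hb r => by rw [add_mul, add_mul]; exact P.add_mem (hx b hb r) (hy b hb r))
    (fun hx b hb r => by rw [neg_mul, neg_mul]; exact P.neg_mem (hx b hb r))
    (fun hy b hb r => by
      rw [mul_assoc, mul_assoc, ← mul_assoc _ r]; exact P.mul_mem_left _ _ (hy b hb r))
    (fun {x y} hx b hb r => by rw [mul_assoc x]; exact hx b hb _)

/-- The largest two-sided ideal `I` with `s * R * I ⊆ P`. -/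
def rightColon (P : TwoSidedIdeal R) (s : Set R) : TwoSidedIdeal R :=
  TwoSidedIdeal.mk' {y | ∀ a ∈ s, ∀ r, a * r * y ∈ P}
    (fun a _ r => by simp)
    (fun hx hy a ha r => by rw [mul_add]; exact P.add_mem (hx a ha r) (hy a ha r))
    (fun hx a ha r => by rw [mul_neg]; exact P.neg_mem (hx a ha r))
    (fun {x y} hy a ha r => by rw [← mul_assoc, mul_assoc a]; exact hy a ha _)
    (fun hx a ha r => by rw [← mul_assoc]; exact P.mul_mem_right _ _ (hx a ha r))

theorem mem_leftColon {P : TwoSidedIdeal R} {s : Set R} {x : R} :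
    x ∈ leftColon P s ↔ ∀ b ∈ s, ∀ r, x * r * b ∈ P :=
  TwoSidedIdeal.mem_mk' _ _ _ _ _ _ _

theorem mem_rightColon {P : TwoSidedIdeal R} {s : Set R} {y : R} :
    y ∈ rightColon P s ↔ ∀ a ∈ s, ∀ r, a * r * y ∈ P :=
  TwoSidedIdeal.mem_mk' _ _ _ _ _ _ _

theorem le_leftColon (P : TwoSidedIdeal R) (s : Set R) : P ≤ leftColon P s := fun _ hx =>
  mem_leftColon.mpr fun _ _ _ => P.mul_mem_right _ _ (P.mul_mem_right _ _ hx)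

theorem le_rightColon (P : TwoSidedIdeal R) (s : Set R) : P ≤ rightColon P s := fun _ hx =>
  mem_rightColon.mpr fun _ _ _ => P.mul_mem_left _ _ hx

theorem IsPrimeIdeal.mem_or_mem {P : TwoSidedIdeal R} (hP : IsPrimeIdeal P) {a b : R}
    (h : ∀ r, a * r * b ∈ P) : a ∈ P ∨ b ∈ P := by
  have hmul : ∀ x ∈ leftColon P {b}, ∀ y ∈ rightColon P (leftColon P {b}), x * y ∈ P :=
    fun x hx y hy => by simpa using mem_rightColon.mp hy x hx 1
  have ha : a ∈ leftColon P {b} := mem_leftColon.mpr fun _ hb r => hb ▸ h r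
  have hb : b ∈ rightColon P (leftColon P {b}) :=
    mem_rightColon.mpr fun x hx r => mem_leftColon.mp hx b rfl r
  exact (hP.le_or_le _ _ hmul).imp (· ha) (· hb)

theorem IsPrimeIdeal.mem_or_mem_of_algebraMap_mul_mem {P : TwoSidedIdeal R} (hP : IsPrimeIdeal P)
    {Z : Type*} [CommRing Z] [Algebra Z R] {z : Z} {b : R} (h : algebraMap Z R z * b ∈ P) :
    algebraMap Z R z ∈ P ∨ b ∈ P :=
  hP.mem_or_mem fun r => by
    rw [Algebra.commutes, mul_assoc]
    exact P.mul_mem_left _ _ h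

theorem wellFoundedGT_twoSidedIdeal [IsNoetherianRing R] : WellFoundedGT (TwoSidedIdeal R) :=
  StrictMono.wellFoundedGT (f := (TwoSidedIdeal.asIdeal : TwoSidedIdeal R →o Ideal R))
    fun _ _ h => h

-- A maximal ideal `P` among those between `J` and `Q` modulo which `c` is regular is prime: if
-- `A * B ⊆ P`, then `L := leftColon P B` and `rightColon P L` are again `c`-saturated, and one of
-- them lies below `Q`.
theorem exists_isPrimeIdeal_lt [IsNoetherianRing R] {J Q : TwoSidedIdeal R} (hQ : IsPrimeIdeal Q)
    (hJQ : J ≤ Q) {c : R} (hc : ∀ r, c * r = r * c) (hcQ : c ∈ Q)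
    (hreg : ∀ x, c * x ∈ J → x ∈ J) :
    ∃ P : TwoSidedIdeal R, IsPrimeIdeal P ∧ J ≤ P ∧ P < Q := by
  have := wellFoundedGT_twoSidedIdeal (R := R)
  obtain ⟨P, ⟨hJP, hPQ, hsat⟩, hmax⟩ := exists_maximal_of_wellFoundedGT
    (fun I : TwoSidedIdeal R => J ≤ I ∧ I ≤ Q ∧ ∀ x, c * x ∈ I → x ∈ I) ⟨J, le_rfl, hJQ, hreg⟩
  have hcP : c ∉ P := fun h => hQ.ne_top (by
    rw [← TwoSidedIdeal.one_mem_iff]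
    exact hPQ (hsat 1 (by simpa using h)))
  refine ⟨P, ⟨fun h => hcP (h ▸ trivial), fun A B hAB => ?_⟩, hJP,
    lt_of_le_of_ne hPQ fun h => hcP (h ▸ hcQ)⟩
  let L := leftColon P B
  have hsatL : ∀ x, c * x ∈ L → x ∈ L := fun x hx => mem_leftColon.mpr fun b hb r =>
    hsat _ (by simpa only [mul_assoc] using mem_leftColon.mp hx b hb r)
  have hsatN : ∀ y, c * y ∈ rightColon P L → y ∈ rightColon P L := fun y hy =>
    mem_rightColon.mpr fun a ha r => hsat _ (by
      rw [← mul_assoc, hc, mul_assoc]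
      exact mem_rightColon.mp hy a ha r)
  rcases hQ.le_or_le L (rightColon P L)
    (fun x hx y hy => hPQ (by simpa using mem_rightColon.mp hy x hx 1)) with h | h
  · have hLP : L ≤ P := hmax ⟨hJP.trans (le_leftColon P B), h, hsatL⟩ (le_leftColon P B)
    exact .inl fun a ha => hLP (mem_leftColon.mpr fun b hb r => by
      rw [mul_assoc]
      exact hAB a ha _ (B.mul_mem_left _ _ hb))
  · have hNP : rightColon P L ≤ P := hmax ⟨hJP.trans (le_rightColon P L), h, hsatN⟩
      (le_rightColon P L)
    exact .inr fun b hb => hNP (mem_rightColon.mpr fun x hx r => mem_leftColon.mp hx b hb r)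

variable {Z : Type*} [CommRing Z] [Algebra Z R]

/-- The two-sided ideal `I R` generated by an ideal of central scalars. -/
def extendedIdeal (I : Ideal Z) : TwoSidedIdeal R :=
  TwoSidedIdeal.mk' (I • ⊤ : Submodule Z R) (Submodule.zero_mem _) (Submodule.add_mem _)
    (Submodule.neg_mem _)
    (fun {x _} hy => Submodule.smul_top_le_comap_smul_top I (LinearMap.mulLeft Z x) hy)
    (fun {_ y} hx => Submodule.smul_top_le_comap_smul_top I (LinearMap.mulRight Z y) hx)

theorem mem_extendedIdeal {I : Ideal Z} {x : R} :
    x ∈ (extendedIdeal I : TwoSidedIdeal R) ↔ x ∈ (I • ⊤ : Submodule Z R) :=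
  TwoSidedIdeal.mem_mk' _ _ _ _ _ _ _

theorem extendedIdeal_le_iff {I : Ideal Z} {P : TwoSidedIdeal R} :
    extendedIdeal I ≤ P ↔ I ≤ P.asIdeal.comap (algebraMap Z R) := by
  constructor
  · intro h z hz
    refine h (mem_extendedIdeal.mpr ?_)
    rw [Algebra.algebraMap_eq_smul_one]
    exact Submodule.smul_mem_smul hz trivial
  · intro h x hx
    refine Submodule.smul_induction_on (mem_extendedIdeal.mp hx) (fun z hz r _ => ?_)
      fun x y hx hy => P.add_mem hx hy
    rw [Algebra.smul_def]
    exact P.mul_mem_right _ _ (h hz)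

theorem length_le_height [IsNoetherianRing R] {rs : List Z} (hrs : IsWeaklyRegular R rs)
    (Q : PrimeIdeals R) (hQ : ∀ r ∈ rs, algebraMap Z R r ∈ Q.1) :
    (rs.length : ℕ∞) ≤ Order.height Q := by
  induction rs using List.reverseRecOn generalizing Q with
  | nil => simp
  | append_singleton ts c ih =>
    rw [isWeaklyRegular_append_iff, isWeaklyRegular_singleton_iff] at hrs
    have hle : extendedIdeal (Ideal.ofList ts) ≤ Q.1 := extendedIdeal_le_iff.mpr <|
      Ideal.span_le.mpr fun r hr => hQ r (List.mem_append_left _ hr)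
    have hreg : ∀ x : R, algebraMap Z R c * x ∈ extendedIdeal (Ideal.ofList ts) →
        x ∈ extendedIdeal (Ideal.ofList ts) := fun x hx => by
      rw [← Algebra.smul_def, mem_extendedIdeal, ← Submodule.Quotient.mk_eq_zero,
        Submodule.Quotient.mk_smul] at hx
      rw [mem_extendedIdeal, ← Submodule.Quotient.mk_eq_zero]
      exact hrs.2.right_eq_zero_of_smul hx
    obtain ⟨P, hP, hJP, hPQ⟩ := exists_isPrimeIdeal_lt Q.2 hle (Algebra.commutes c)
      (hQ c (by simp)) hreg
    calc ((ts ++ [c]).length : ℕ∞) = ts.length + 1 := by simp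
      _ ≤ Order.height (⟨P, hP⟩ : PrimeIdeals R) + 1 := by
        gcongr
        exact ih hrs.1 ⟨P, hP⟩ fun r hr => extendedIdeal_le_iff.mp hJP (Ideal.subset_span hr)
      _ ≤ Order.height Q := Order.height_add_one_le hPQ

variable (Z) in
/-- The contraction of a prime of `R` to the scalars. -/
def contraction (P : PrimeIdeals R) : PrimeSpectrum Z where
  asIdeal := P.1.asIdeal.comap (algebraMap Z R)
  isPrime :=
    { ne_top' := Ideal.comap_ne_top _ fun h => P.2.ne_top <|
        (TwoSidedIdeal.one_mem_iff P.1).mp ((Ideal.eq_top_iff_one _).mp h)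
      mem_or_mem' := fun {x y} h => P.2.mem_or_mem_of_algebraMap_mul_mem <| by
        rwa [Ideal.mem_comap, map_mul] at h }

theorem mem_contraction {P : PrimeIdeals R} {z : Z} :
    z ∈ (contraction Z P).asIdeal ↔ algebraMap Z R z ∈ P.1 :=
  Iff.rfl

end PrimeIdeals

section Maximal

variable {Z : Type*} [CommRing Z] {R : Type*} [Ring R] [Algebra Z R] [Module.Finite Z R]

-- Nakayama's lemma.
theorem isMaximal_contraction {P : TwoSidedIdeal R} (hP : IsCoatom P) :
    (contraction Z ⟨P, isPrimeIdeal_of_isCoatom hP⟩).asIdeal.IsMaximal := by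
  set p := contraction Z ⟨P, isPrimeIdeal_of_isCoatom hP⟩
  obtain ⟨m, hm, hpm⟩ := Ideal.exists_le_maximal p.asIdeal p.isPrime.ne_top
  suffices hmP : (extendedIdeal m : TwoSidedIdeal R) ≤ P by
    rwa [le_antisymm hpm (extendedIdeal_le_iff.mp hmP)]
  by_contra hcon
  have htop : P ⊔ extendedIdeal m = ⊤ := hP.2 _ (left_lt_sup.mpr hcon)
  have hle : (⊤ : Submodule Z (R ⧸ P.asIdeal)) ≤ m • ⊤ := by
    rintro x -
    obtain ⟨x, rfl⟩ := Ideal.Quotient.mk_surjective x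
    obtain ⟨a, ha, b, hb, rfl⟩ := TwoSidedIdeal.mem_sup.mp
      (htop ▸ trivial : x ∈ P ⊔ extendedIdeal m)
    rw [map_add, Ideal.Quotient.eq_zero_iff_mem.mpr (TwoSidedIdeal.mem_asIdeal.mpr ha), zero_add]
    exact Submodule.smul_top_le_comap_smul_top m
      (Ideal.Quotient.mkₐ Z P.asIdeal).toLinearMap (mem_extendedIdeal.mp hb)
  have : Module.Finite Z (R ⧸ P.asIdeal) := Module.Finite.of_surjective
    (Ideal.Quotient.mkₐ Z P.asIdeal).toLinearMap Ideal.Quotient.mk_surjective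
  obtain ⟨z, hz, hz0⟩ := Submodule.exists_sub_one_mem_and_smul_eq_zero_of_fg_of_le_smul m ⊤
    Module.Finite.fg_top hle
  have hzp : z ∈ p.asIdeal := by
    have h1 := hz0 (Ideal.Quotient.mk P.asIdeal 1) trivial
    rw [Algebra.smul_def, map_one, mul_one] at h1
    exact mem_contraction.mpr (TwoSidedIdeal.mem_asIdeal.mp (Ideal.Quotient.eq_zero_iff_mem.mp h1))
  exact hm.ne_top ((Ideal.eq_top_iff_one m).mpr (by simpa using m.sub_mem (hpm hzp) hz))

theorem exists_isCoatom_contraction_eq [IsNoetherianRing R]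
    (hR : Module.annihilator Z R = ⊥) (m : Ideal Z) [hm : m.IsMaximal] :
    ∃ (P : TwoSidedIdeal R) (hP : IsCoatom P),
      contraction Z ⟨P, isPrimeIdeal_of_isCoatom hP⟩ = ⟨m, hm.isPrime⟩ := by
  have hne : (extendedIdeal m : TwoSidedIdeal R) ≠ ⊤ := by
    intro h
    have hle : (⊤ : Submodule Z R) ≤ m • ⊤ := fun x _ =>
      mem_extendedIdeal.mp (h ▸ trivial : x ∈ (extendedIdeal m : TwoSidedIdeal R))
    obtain ⟨z, hz, hz0⟩ := Submodule.exists_sub_one_mem_and_smul_eq_zero_of_fg_of_le_smul m ⊤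
      Module.Finite.fg_top hle
    have hzR : z ∈ Module.annihilator Z R := Module.mem_annihilator.mpr fun x => hz0 x trivial
    rw [hR, Ideal.mem_bot] at hzR
    exact hm.ne_top ((Ideal.eq_top_iff_one m).mpr (by simpa [hzR] using hz))
  have := wellFoundedGT_twoSidedIdeal (R := R)
  obtain ⟨P, hP, hmP⟩ := (eq_top_or_exists_le_coatom (extendedIdeal m)).resolve_left hne
  exact ⟨P, hP, PrimeSpectrum.ext
    (hm.eq_of_le (contraction Z _).isPrime.ne_top (extendedIdeal_le_iff.mp hmP)).symm⟩

end Maximal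

section LocalizedAlgebra

variable {Z : Type*} [CommRing Z] (S : Submonoid Z) (R : Type*) [Ring R] [Algebra Z R]

/-- The localisation of a `Z`-algebra as an algebra over the localisation of `Z`. -/
abbrev localizedAlgebra : Algebra (Localization S) (LocalizedModule S R) :=
  Algebra.ofModule
    (fun x a b => by
      induction x with | _ x
      induction a with | _ a s
      induction b with | _ b t
      rw [LocalizedModule.mk_smul_mk, LocalizedModule.mk_mul_mk, LocalizedModule.mk_mul_mk,
        LocalizedModule.mk_smul_mk, smul_mul_assoc, mul_assoc])
    (fun x a b => by
      induction x with | _ x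
      induction a with | _ a s
      induction b with | _ b t
      rw [LocalizedModule.mk_smul_mk, LocalizedModule.mk_mul_mk, LocalizedModule.mk_mul_mk,
        LocalizedModule.mk_smul_mk, mul_smul_comm, mul_left_comm])

/-- The canonical homomorphism from an algebra to its localisation. -/
def localizationAlgHom : R →ₐ[Z] LocalizedModule S R :=
  { LocalizedModule.numeratorRingHom with
    commutes' := fun _ => rfl }

instance : IsLocalizedModule S (localizationAlgHom S R).toLinearMap :=
  localizedModuleIsLocalizedModule (M := R) S

end LocalizedAlgebra

section Incomparability

theorem IsPrimeIdeal.jacobson_eq_bot {A : Type*} [Ring A] [IsArtinianRing A]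
    (hA : IsPrimeIdeal (⊥ : TwoSidedIdeal A)) : Ring.jacobson A = ⊥ := by
  obtain ⟨n, hn⟩ := IsArtinianRing.isNilpotent_jacobson_bot (R := A)
  rw [Ideal.jacobson_bot] at hn
  by_contra hne
  obtain ⟨b, hb, hb0⟩ := (Submodule.ne_bot_iff _).mp hne
  suffices hpow : ∀ k, Ring.jacobson A ^ k ≠ ⊥ from hpow n hn
  intro k
  induction k with
  | zero =>
    rw [Submodule.pow_zero, Ideal.one_eq_top]
    exact fun h => hb0 ((Submodule.mem_bot A).mp (h ▸ Submodule.mem_top))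
  | succ k ih =>
    refine fun h => ih (eq_bot_iff.mpr fun a ha => ?_)
    refine (hA.mem_or_mem (a := a) (b := b) fun r => ?_).resolve_right hb0
    have hmem : a * r * b ∈ Ring.jacobson A ^ (k + 1) := by
      rw [Submodule.pow_succ, mul_assoc]
      exact Ideal.mul_mem_mul ha (Ideal.mul_mem_left _ _ hb)
    rwa [h] at hmem

theorem IsPrimeIdeal.eq_top_of_isArtinianRing {A : Type*} [Ring A] [IsArtinianRing A]
    (hA : IsPrimeIdeal (⊥ : TwoSidedIdeal A)) {I : TwoSidedIdeal A} (hI : I ≠ ⊥) : I = ⊤ := by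
  have := IsArtinianRing.isSemisimpleRing_iff_jacobson.mpr hA.jacobson_eq_bot
  obtain ⟨J, hJ⟩ := exists_isCompl I.asIdeal
  obtain ⟨a, ha, ha0⟩ : ∃ a ∈ I, a ≠ 0 := by
    by_contra! h
    exact hI (eq_bot_iff.mpr h)
  have hJ0 : J = ⊥ := eq_bot_iff.mpr fun b hb => by
    refine (hA.mem_or_mem (a := a) (b := b) fun r => ?_).resolve_left ha0
    have hmem : a * r * b ∈ I.asIdeal ⊓ J :=
      ⟨I.mul_mem_right _ _ (I.mul_mem_right _ _ ha), J.mul_mem_left _ hb⟩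
    rwa [hJ.inf_eq_bot] at hmem
  rw [← TwoSidedIdeal.one_mem_iff, ← TwoSidedIdeal.mem_asIdeal, ← sup_bot_eq I.asIdeal, ← hJ0,
    hJ.sup_eq_top]
  trivial

theorem IsPrimeIdeal.bot_of_comap_le_ker {A B : Type*} [Ring A] [Ring B] [Nontrivial B]
    {f : A →+* B} (hf : IsPrimeIdeal (TwoSidedIdeal.ker f))
    (h : ∀ I : TwoSidedIdeal B, I.comap f ≤ TwoSidedIdeal.ker f → I ≤ ⊥) :
    IsPrimeIdeal (⊥ : TwoSidedIdeal B) where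
  ne_top := bot_ne_top
  le_or_le I J hIJ := by
    refine (hf.le_or_le (I.comap f) (J.comap f) fun a ha b hb => ?_).imp (h I) (h J)
    rw [TwoSidedIdeal.mem_ker, map_mul]
    exact hIJ _ ((TwoSidedIdeal.mem_comap f).mp ha) _ ((TwoSidedIdeal.mem_comap f).mp hb)

section LocalizedIdeal

variable {Z : Type*} [CommRing Z] {S : Submonoid Z} {A A' : Type*} [Ring A] [Ring A']
  [Algebra Z A] [Algebra Z A'] (φ : A →ₐ[Z] A') [IsLocalizedModule S φ.toLinearMap]

variable (S) in
include S in
theorem isPrimeIdeal_bot_of_isLocalizedModule [Nontrivial A'] (hφ : Function.Injective φ)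
    (hA : IsPrimeIdeal (⊥ : TwoSidedIdeal A)) : IsPrimeIdeal (⊥ : TwoSidedIdeal A') := by
  have hker : TwoSidedIdeal.ker (φ : A →+* A') = ⊥ := (TwoSidedIdeal.ker_eq_bot _).mpr hφ
  refine IsPrimeIdeal.bot_of_comap_le_ker (f := (φ : A →+* A')) (hker ▸ hA) fun I hI a ha => ?_
  obtain ⟨⟨b, s⟩, hs : (s : Z) • a = φ b⟩ := IsLocalizedModule.surj S φ.toLinearMap a
  have hbI : φ b ∈ I := by
    rw [← hs, Algebra.smul_def]
    exact I.mul_mem_left _ _ ha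
  have hb : φ b = 0 := (TwoSidedIdeal.mem_ker _).mp (hI ((TwoSidedIdeal.mem_comap _).mpr hbI))
  refine IsLocalizedModule.smul_injective φ.toLinearMap s ?_
  simp only [Submonoid.smul_def, hs, hb, smul_zero]

variable (S) in
/-- The extension to a localisation of a two-sided ideal: its elements are the fractions with
numerator in `I`. -/
def localizedIdeal (I : TwoSidedIdeal A) : TwoSidedIdeal A' :=
  TwoSidedIdeal.mk' {a | ∃ s : S, ∃ x ∈ I, (s : Z) • a = φ x}
    ⟨1, 0, I.zero_mem, by simp⟩
    (by
      rintro a b ⟨s, x, hx, hs⟩ ⟨t, y, hy, ht⟩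
      refine ⟨s * t, algebraMap Z A t * x + algebraMap Z A s * y,
        I.add_mem (I.mul_mem_left _ _ hx) (I.mul_mem_left _ _ hy), ?_⟩
      rw [← Algebra.smul_def, ← Algebra.smul_def, map_add, map_smul, map_smul, ← hs, ← ht,
        smul_add, Submonoid.coe_mul, mul_smul, mul_smul, smul_comm (s : Z) (t : Z) a])
    (by
      rintro a ⟨s, x, hx, hs⟩
      exact ⟨s, -x, I.neg_mem hx, by rw [smul_neg, hs, map_neg]⟩)
    (by
      rintro b a ⟨s, x, hx, hs⟩
      obtain ⟨⟨c, t⟩, ht : (t : Z) • b = φ c⟩ := IsLocalizedModule.surj S φ.toLinearMap b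
      refine ⟨t * s, c * x, I.mul_mem_left _ _ hx, ?_⟩
      rw [Submonoid.coe_mul, ← smul_mul_smul_comm, ht, hs, map_mul])
    (by
      rintro a b ⟨s, x, hx, hs⟩
      obtain ⟨⟨c, t⟩, ht : (t : Z) • b = φ c⟩ := IsLocalizedModule.surj S φ.toLinearMap b
      refine ⟨s * t, x * c, I.mul_mem_right _ _ hx, ?_⟩
      rw [Submonoid.coe_mul, ← smul_mul_smul_comm, ht, hs, map_mul])

theorem mem_localizedIdeal {I : TwoSidedIdeal A} {a : A'} :
    a ∈ localizedIdeal S φ I ↔ ∃ s : S, ∃ x ∈ I, (s : Z) • a = φ x :=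
  TwoSidedIdeal.mem_mk' _ _ _ _ _ _ _

end LocalizedIdeal

-- The localisation of `T` at the nonzero elements of `D` is a prime finite-dimensional algebra,
-- hence simple.
theorem exists_algebraMap_mem_of_isPrimeIdeal_bot {D T : Type*} [CommRing D] [IsDomain D] [Ring T]
    [Algebra D T] [FaithfulSMul D T] [Module.Finite D T] (hT : IsPrimeIdeal (⊥ : TwoSidedIdeal T))
    {I : TwoSidedIdeal T} (hI : I ≠ ⊥) : ∃ d : D, d ≠ 0 ∧ algebraMap D T d ∈ I := by
  let S := nonZeroDivisors D
  let _ : Algebra (FractionRing D) (LocalizedModule S T) := localizedAlgebra S T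
  let φ := localizationAlgHom S T
  have hφ : Function.Injective φ := (injective_iff_map_eq_zero φ).mpr fun x hx => by
    obtain ⟨s, hs⟩ := (IsLocalizedModule.eq_zero_iff S φ.toLinearMap).mp hx
    rw [Submonoid.smul_def, Algebra.smul_def] at hs
    refine (hT.mem_or_mem_of_algebraMap_mul_mem hs).resolve_left fun h0 => ?_
    exact nonZeroDivisors.ne_zero s.2 ((FaithfulSMul.algebraMap_eq_zero_iff D T).mp h0)
  have : Nontrivial T := not_subsingleton_iff_nontrivial.mp fun _ =>
    hT.ne_top (eq_top_iff.mpr fun x _ => Subsingleton.elim x 0)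
  have : Nontrivial (LocalizedModule S T) := hφ.nontrivial
  have : IsArtinianRing (LocalizedModule S T) := IsArtinianRing.of_finite (FractionRing D) _
  have hne : localizedIdeal S φ I ≠ ⊥ := fun h => hI <| eq_bot_iff.mpr fun x hx => hφ <| by
    rw [map_zero, ← TwoSidedIdeal.mem_bot, ← h]
    exact (mem_localizedIdeal φ).mpr ⟨1, x, hx, one_smul _ _⟩
  have htop := (isPrimeIdeal_bot_of_isLocalizedModule S φ hφ hT).eq_top_of_isArtinianRing hne
  obtain ⟨s, x, hx, hs⟩ := (mem_localizedIdeal φ).mp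
    ((TwoSidedIdeal.one_mem_iff _).mpr htop)
  have hsx : algebraMap D T s = x := hφ <| by
    rw [← hs, AlgHom.commutes, Algebra.algebraMap_eq_smul_one]
  exact ⟨s, nonZeroDivisors.ne_zero s.2, hsx ▸ hx⟩

variable {Z : Type*} [CommRing Z] {R : Type*} [Ring R] [Algebra Z R]

theorem IsPrimeIdeal.bot_quotient {P : TwoSidedIdeal R} (hP : IsPrimeIdeal P) :
    IsPrimeIdeal (⊥ : TwoSidedIdeal (R ⧸ P.asIdeal)) := by
  have hne : P.asIdeal ≠ ⊤ := fun h =>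
    hP.ne_top ((TwoSidedIdeal.one_mem_iff P).mp ((Ideal.eq_top_iff_one _).mp h))
  have := Ideal.Quotient.nontrivial_iff.mpr hne
  have hker : TwoSidedIdeal.ker (Ideal.Quotient.mk P.asIdeal) = P := by
    ext x
    rw [TwoSidedIdeal.mem_ker, Ideal.Quotient.eq_zero_iff_mem, TwoSidedIdeal.mem_asIdeal]
  refine IsPrimeIdeal.bot_of_comap_le_ker (hker.symm ▸ hP) fun I hI a ha => ?_
  obtain ⟨a, rfl⟩ := Ideal.Quotient.mk_surjective a
  exact (TwoSidedIdeal.mem_ker _).mp (hI ((TwoSidedIdeal.mem_comap _).mpr ha))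

variable [Module.Finite Z R]

theorem contraction_strictMono : StrictMono (contraction Z : PrimeIdeals R → PrimeSpectrum Z) := by
  intro P Q hPQ
  have hle : contraction Z P ≤ contraction Z Q := fun z hz => hPQ.le hz
  let π := Ideal.Quotient.mk P.1.asIdeal
  have hmap : ∀ x, π x ∈ Q.1.asIdeal.map π ↔ x ∈ Q.1.asIdeal := fun x => by
    have hker : RingHom.ker π ≤ Q.1.asIdeal := (Ideal.mk_ker (I := P.1.asIdeal)).trans_le hPQ.le
    rw [← Ideal.mem_comap, Ideal.comap_map_of_surjective' π Ideal.Quotient.mk_surjective,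
      sup_eq_left.mpr hker]
  have hne : (Q.1.asIdeal.map π).toTwoSided ≠ ⊥ := fun h => hPQ.not_ge fun x hx => by
    have hx0 := Ideal.mem_toTwoSided.mpr ((hmap x).mpr hx)
    rw [h] at hx0
    exact Ideal.Quotient.eq_zero_iff_mem.mp hx0
  have : IsDomain (Z ⧸ P.1.asIdeal.comap (algebraMap Z R)) :=
    (Ideal.Quotient.isDomain_iff_prime _).mpr (contraction Z P).isPrime
  have : FaithfulSMul (Z ⧸ P.1.asIdeal.comap (algebraMap Z R)) (R ⧸ P.1.asIdeal) :=
    (faithfulSMul_iff_algebraMap_injective _ _).mpr Ideal.algebraMap_quotient_injective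
  have : Module.Finite (Z ⧸ P.1.asIdeal.comap (algebraMap Z R)) (R ⧸ P.1.asIdeal) :=
    have : IsScalarTower Z (Z ⧸ P.1.asIdeal.comap (algebraMap Z R)) (R ⧸ P.1.asIdeal) :=
      IsScalarTower.of_algebraMap_eq fun _ => rfl
    have : Module.Finite Z (R ⧸ P.1.asIdeal) := Module.Finite.of_surjective
      (Ideal.Quotient.mkₐ Z P.1.asIdeal).toLinearMap Ideal.Quotient.mk_surjective
    Module.Finite.of_restrictScalars_finite Z _ _
  obtain ⟨d, hd, hdQ⟩ := exists_algebraMap_mem_of_isPrimeIdeal_bot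
    (D := Z ⧸ P.1.asIdeal.comap (algebraMap Z R)) P.2.bot_quotient hne
  obtain ⟨z, rfl⟩ := Ideal.Quotient.mk_surjective d
  have hzQ : z ∈ (contraction Z Q).asIdeal := (hmap _).mp (Ideal.mem_toTwoSided.mp hdQ)
  exact lt_of_le_not_ge hle fun h => hd (Ideal.Quotient.eq_zero_iff_mem.mpr (h hzQ))

theorem height_le_height_contraction (P : PrimeIdeals R) :
    Order.height P ≤ Order.height (contraction Z P) :=
  Order.height_le_height_apply_of_strictMono _ contraction_strictMono P

end Incomparability

/-! ### Localisation of modules over central extensions -/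

section CentralLocalization

variable {Z : Type*} [CommRing Z] {S : Submonoid Z}

theorem isUnit_algebraMap_end_of_isLocalization (Z' : Type*) [CommRing Z'] [Algebra Z Z']
    [IsLocalization S Z'] {N : Type*} [AddCommGroup N] [Module Z N] [Module Z' N]
    [IsScalarTower Z Z' N] (s : S) : IsUnit (algebraMap Z (Module.End Z N) s) :=
  have := isLocalizedModule_id S N Z'
  IsLocalizedModule.map_units (LinearMap.id : N →ₗ[Z] N) s

theorem smul_right_injective_of_isUnit {X : Type*} [AddCommGroup X] [Module Z X] {z : Z}
    (hz : IsUnit (algebraMap Z (Module.End Z X) z)) : Function.Injective fun x : X => z • x :=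
  ((Module.End.isUnit_iff _).mp hz).1

theorem annihilator_le_of_isLocalizedModule {M N : Type*} [AddCommGroup M] [Module Z M]
    [AddCommGroup N] [Module Z N] (S : Submonoid Z) (ι : M →ₗ[Z] N) [IsLocalizedModule S ι] :
    Module.annihilator Z M ≤ Module.annihilator Z N := by
  refine fun z hz => Module.mem_annihilator.mpr fun n => ?_
  obtain ⟨⟨x, s⟩, hs : (s : Z) • n = ι x⟩ := IsLocalizedModule.surj S ι n
  refine smul_right_injective_of_isUnit (IsLocalizedModule.map_units ι s) ?_
  dsimp only
  rw [smul_comm, hs, ← map_smul, Module.mem_annihilator.mp hz, map_zero, smul_zero]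

theorem exists_mul_mem_annihilator {M N : Type*} [AddCommGroup M] [Module Z M] [Module.Finite Z M]
    [AddCommGroup N] [Module Z N] (ι : M →ₗ[Z] N) [IsLocalizedModule S ι] {z : Z}
    (hz : z ∈ Module.annihilator Z N) : ∃ t : S, (t : Z) * z ∈ Module.annihilator Z M := by
  obtain ⟨t, ht⟩ := Module.Finite.exists_smul_of_comp_eq_of_isLocalizedModule S ι
    (z • LinearMap.id) 0 (LinearMap.ext fun x => by
      simp [Module.mem_annihilator.mp hz])
  exact ⟨t, Module.mem_annihilator.mpr fun x => by
    simpa [mul_smul, Submonoid.smul_def] using LinearMap.congr_fun ht x⟩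

variable {A A' : Type*} [Ring A] [Ring A'] [Algebra Z A] [Algebra Z A'] (φ : A →ₐ[Z] A')

section Lift

theorem isUnit_algebraMap_end_of_isUnit {B : Type*} [Ring B] [Algebra Z B] {z : Z}
    (hz : IsUnit (algebraMap Z B z)) : IsUnit (algebraMap Z (Module.End Z B) z) := by
  simpa only [AlgHom.commutes] using hz.map (Algebra.lmul Z B)

variable [IsLocalizedModule S φ.toLinearMap]

/-- The factorisation through the localisation `φ` of an algebra homomorphism inverting `S`. -/
def localizationLift {B : Type*} [Ring B] [Algebra Z B] (ψ : A →ₐ[Z] B)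
    (hB : ∀ s : S, IsUnit (algebraMap Z B s)) : A' →ₐ[Z] B :=
  have hend : ∀ s : S, IsUnit (algebraMap Z (Module.End Z B) s) := fun s =>
    isUnit_algebraMap_end_of_isUnit (hB s)
  let G := IsLocalizedModule.lift S φ.toLinearMap ψ.toLinearMap hend
  have hG : ∀ a, G (φ a) = ψ a := IsLocalizedModule.lift_apply S φ.toLinearMap ψ.toLinearMap hend
  AlgHom.ofLinearMap G (by rw [← map_one φ, hG, map_one]) fun a b => by
    obtain ⟨⟨x, s⟩, hs : (s : Z) • a = φ x⟩ := IsLocalizedModule.surj S φ.toLinearMap a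
    obtain ⟨⟨y, t⟩, ht : (t : Z) • b = φ y⟩ := IsLocalizedModule.surj S φ.toLinearMap b
    refine smul_right_injective_of_isUnit (hend (s * t)) ?_
    dsimp only
    rw [← map_smul, Submonoid.coe_mul, ← smul_mul_smul_comm, ← smul_mul_smul_comm, hs, ht,
      ← map_mul, hG, map_mul, ← map_smul, ← map_smul, hs, ht, hG, hG]

theorem localizationLift_apply {B : Type*} [Ring B] [Algebra Z B] (ψ : A →ₐ[Z] B)
    (hB : ∀ s : S, IsUnit (algebraMap Z B s)) (a : A) : localizationLift φ ψ hB (φ a) = ψ a :=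
  IsLocalizedModule.lift_apply S φ.toLinearMap ψ.toLinearMap
    (fun s => isUnit_algebraMap_end_of_isUnit (hB s)) a

variable {M N : Type*} [AddCommGroup M] [Module A M] [Module Z M] [IsScalarTower Z A M]
  [AddCommGroup N] [Module Z N]

variable (S) in
/-- The action of the localised algebra on a localisation `ι` of an `A`-module. -/
def localizedAction (ι : M →ₗ[Z] N) [IsLocalizedModule S ι] : A' →ₐ[Z] Module.End Z N :=
  localizationLift φ
    ((AlgHom.ofLinearMap (IsLocalizedModule.map S ι ι) (IsLocalizedModule.map_id S ι) fun f g =>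
      IsLocalizedModule.map_comp' S ι ι ι g f).comp (Algebra.lsmul Z Z M))
    (IsLocalizedModule.map_units (S := S) ι)

variable (S) in
theorem localizedAction_apply (ι : M →ₗ[Z] N) [IsLocalizedModule S ι] (a : A) (x : M) :
    localizedAction S φ ι (φ a) (ι x) = ι (a • x) := by
  rw [localizedAction, localizationLift_apply]
  exact IsLocalizedModule.map_apply S ι ι _ x

end Lift

section LinearMaps

variable {M N X : Type*} [AddCommGroup M] [Module A M] [Module Z M] [AddCommGroup N] [Module A' N]
  [Module Z N] [IsScalarTower Z A' N] [AddCommGroup X] [Module A' X] [Module Z X]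
  [IsScalarTower Z A' X]

theorem exists_linearMap_of_map_smul [IsLocalizedModule S φ.toLinearMap]
    (hX : ∀ s : S, IsUnit (algebraMap Z (Module.End Z X) s)) (f : N →ₗ[Z] X)
    (hf : ∀ a n, f (φ a • n) = φ a • f n) : ∃ F : N →ₗ[A'] X, ∀ n, F n = f n := by
  refine ⟨{ toFun := f, map_add' := map_add f, map_smul' := fun a n => ?_ }, fun n => rfl⟩
  obtain ⟨⟨b, s⟩, hs : (s : Z) • a = φ b⟩ := IsLocalizedModule.surj S φ.toLinearMap a
  refine smul_right_injective_of_isUnit (hX s) ?_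
  dsimp only [RingHom.id_apply]
  rw [← map_smul, ← smul_assoc, ← smul_assoc, hs, hf]

theorem exists_linearMap_extension [IsLocalizedModule S φ.toLinearMap]
    (hX : ∀ s : S, IsUnit (algebraMap Z (Module.End Z X) s)) (ι : M →ₗ[Z] N)
    [IsLocalizedModule S ι] (hι : ∀ a x, ι (a • x) = φ a • ι x) (f : M →ₗ[Z] X)
    (hf : ∀ a x, f (a • x) = φ a • f x) : ∃ F : N →ₗ[A'] X, ∀ x, F (ι x) = f x := by
  let G := IsLocalizedModule.lift S ι f hX
  have hG : ∀ x, G (ι x) = f x := IsLocalizedModule.lift_apply S ι f hX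
  obtain ⟨F, hF⟩ := exists_linearMap_of_map_smul φ hX G fun a n => by
    have hcomm : G ∘ₗ Algebra.lsmul Z Z N (φ a) = Algebra.lsmul Z Z X (φ a) ∘ₗ G := by
      refine IsLocalizedModule.ext S ι hX (LinearMap.ext fun x => ?_)
      simp only [LinearMap.comp_apply, Algebra.lsmul_coe, ← hι, hG, hf]
    exact LinearMap.congr_fun hcomm n
  exact ⟨F, fun x => by rw [hF, hG]⟩

theorem exists_linearMap_clearing_denominators [IsNoetherianRing Z] [Module.Finite Z M]
    {V : Type*} [AddCommGroup V] [Module A V] [Module Z V] [IsScalarTower Z A V] [Module.Finite Z V]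
    (h : V →ₗ[Z] X) [IsLocalizedModule S h] (hh : ∀ a v, h (a • v) = φ a • h v)
    (f : M →ₗ[Z] X) (hf : ∀ a x, f (a • x) = φ a • f x) :
    ∃ (F : M →ₗ[A] V) (s : S), ∀ x, h (F x) = (s : Z) • f x := by
  have := Module.finitePresentation_of_finite Z M
  obtain ⟨G, s, hG⟩ := Module.FinitePresentation.exists_lift_of_isLocalizedModule S h f
  have hGx : ∀ x, h (G x) = (s : Z) • f x := LinearMap.congr_fun hG
  obtain ⟨t, ht⟩ := Module.Finite.exists_smul_of_comp_eq_of_isLocalizedModule S h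
    (LinearMap.ker h).subtype 0 (by rw [LinearMap.comp_zero]; exact LinearMap.ext fun v => v.2)
  have htker : ∀ v, h v = 0 → (t : Z) • v = 0 := fun v hv => by
    rw [smul_zero] at ht
    exact LinearMap.congr_fun ht (⟨v, hv⟩ : LinearMap.ker h)
  refine ⟨{ (t : Z) • G with map_smul' := fun a x => ?_ }, t * s, fun x => ?_⟩
  · change (t : Z) • G (a • x) = a • (t : Z) • G x
    rw [smul_comm a, ← sub_eq_zero, ← smul_sub]
    refine htker _ ?_
    rw [map_sub, hh, hGx, hGx, hf, smul_comm, sub_self]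
  · change h ((t : Z) • G x) = _
    rw [map_smul, hGx, smul_smul, Submonoid.coe_mul]

end LinearMaps

section Lattice

variable [IsLocalizedModule S φ.toLinearMap] {N : Type*} [AddCommGroup N] [Module A' N] [Module Z N]
  [IsScalarTower Z A' N] [Module A N] [IsScalarTower Z A N]

theorem exists_smul_mem_span (hφN : ∀ (a : A) (n : N), a • n = φ a • n) {T : Set N} {n : N}
    (hn : n ∈ Submodule.span A' T) : ∃ s : S, (s : Z) • n ∈ Submodule.span A T := by
  induction hn using Submodule.span_induction with
  | mem x hx => exact ⟨1, by simpa using Submodule.subset_span hx⟩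
  | zero => exact ⟨1, by simp⟩
  | add x y _ _ hx hy =>
    obtain ⟨s, hs⟩ := hx
    obtain ⟨t, ht⟩ := hy
    refine ⟨s * t, ?_⟩
    rw [smul_add, Submonoid.coe_mul, mul_smul, mul_smul, smul_comm (s : Z) (t : Z) x]
    exact add_mem (Submodule.smul_of_tower_mem _ _ hs) (Submodule.smul_of_tower_mem _ _ ht)
  | smul a x _ hx =>
    obtain ⟨s, hs⟩ := hx
    obtain ⟨⟨b, t⟩, ht : (t : Z) • a = φ b⟩ := IsLocalizedModule.surj S φ.toLinearMap a
    refine ⟨s * t, ?_⟩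
    rw [Submonoid.coe_mul, mul_smul, ← smul_assoc (t : Z) a x, ht, smul_comm, ← hφN]
    exact Submodule.smul_mem _ _ hs

theorem exists_finite_submodule_isLocalizedModule (hφN : ∀ (a : A) (n : N), a • n = φ a • n)
    (hN : ∀ s : S, IsUnit (algebraMap Z (Module.End Z N) s)) [Module.Finite A' N] :
    ∃ M : Submodule A N, Module.Finite A M ∧
      IsLocalizedModule S (M.subtype.restrictScalars Z) := by
  obtain ⟨T, hT⟩ := Module.Finite.fg_top (R := A') (M := N)
  refine ⟨Submodule.span A T, Module.Finite.span_of_finite A T.finite_toSet, hN, fun n => ?_,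
    fun {x y} h => ⟨1, by rw [Subtype.ext h]⟩⟩
  obtain ⟨s, hs⟩ := exists_smul_mem_span (S := S) φ hφN (n := n) (hT ▸ Submodule.mem_top)
  exact ⟨⟨⟨_, hs⟩, s⟩, rfl⟩

end Lattice

end CentralLocalization

section LocalizedQuotients

variable {Z : Type*} [CommRing Z] {S : Submonoid Z} (Z' : Type*) [CommRing Z'] [Algebra Z Z']
  [IsLocalization S Z'] {Y Y' : Type*} [AddCommGroup Y] [Module Z Y] [AddCommGroup Y']
  [Module Z Y'] [Module Z' Y'] [IsScalarTower Z Z' Y'] (g : Y →ₗ[Z] Y') [IsLocalizedModule S g]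

theorem localized'_ideal_smul_top (I : Ideal Z) :
    (I • ⊤ : Submodule Z Y).localized' Z' S g = I.map (algebraMap Z Z') • ⊤ := by
  refine Submodule.restrictScalars_injective Z _ _ ?_
  rw [Ideal.smul_restrictScalars, Submodule.restrictScalars_localized', Submodule.localized₀_smul,
    Submodule.localized₀_top, Submodule.restrictScalars_top]

include S g in
theorem annihilator_le_map_of_isLocalizedModule [Module.Finite Z Y] :
    Module.annihilator Z' Y' ≤ (Module.annihilator Z Y).map (algebraMap Z Z') := by
  rw [← IsLocalization.map_under S Z' (Module.annihilator Z' Y'), Ideal.under_def,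
    Module.comap_annihilator, Ideal.map_le_iff_le_comap]
  intro z hz
  obtain ⟨t, ht⟩ := exists_mul_mem_annihilator (S := S) g hz
  have hmem := Ideal.mem_map_of_mem (algebraMap Z Z') ht
  rwa [map_mul, Ideal.unit_mul_mem_iff_mem _ (IsLocalization.map_units Z' t)] at hmem

include S g in
theorem annihilator_eq_bot_of_isLocalizedModule [Module.Finite Z Y]
    (hY : Module.annihilator Z Y = ⊥) : Module.annihilator Z' Y' = ⊥ :=
  le_bot_iff.mp ((annihilator_le_map_of_isLocalizedModule (S := S) Z' g).trans_eq
    (by rw [hY, Ideal.map_bot]))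

variable {A A' : Type*} [Ring A] [Ring A'] [Algebra Z A] [Algebra Z A'] [Algebra Z' A']
  [Module A Y] [IsScalarTower Z A Y] [Module A' Y'] [IsScalarTower Z A' Y'] [IsScalarTower Z' A' Y']

theorem idealSMulTop_map_algebraMap (I : Ideal Z) :
    idealSMulTop A' (I.map (algebraMap Z Z')) Y' = idealSMulTop A' I Y' := by
  ext y
  rw [mem_idealSMulTop, mem_idealSMulTop, ← Submodule.restrictScalars_mem Z,
    Ideal.smul_restrictScalars, Submodule.restrictScalars_top]

include Z' in
theorem exists_isLocalizedModule_quotient (φ : A →ₐ[Z] A') (hg : ∀ a y, g (a • y) = φ a • g y)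
    (I : Ideal Z) :
    ∃ h : (Y ⧸ idealSMulTop A I Y) →ₗ[Z] Y' ⧸ idealSMulTop A' I Y',
      IsLocalizedModule S h ∧ ∀ a x, h (a • x) = φ a • h x := by
  have hI : (idealSMulTop A' I Y').restrictScalars Z' = (I • ⊤ : Submodule Z Y).localized' Z' S g :=
    by rw [localized'_ideal_smul_top, ← idealSMulTop_map_algebraMap Z']; rfl
  let e : (Y' ⧸ (I • ⊤ : Submodule Z Y).localized' Z' S g) ≃ₗ[Z] Y' ⧸ idealSMulTop A' I Y' :=
    ((Submodule.quotEquivOfEq _ _ hI.symm).trans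
      (Submodule.Quotient.restrictScalarsEquiv Z' (idealSMulTop A' I Y'))).restrictScalars Z
  let h := (e.toLinearMap ∘ₗ Submodule.toLocalizedQuotient' Z' S g (I • ⊤ : Submodule Z Y)) ∘ₗ
    (idealSMulTopQuotEquiv A I Y).symm.toLinearMap
  have hmk : ∀ y, h (Submodule.Quotient.mk y) = Submodule.Quotient.mk (g y) := fun y => rfl
  refine ⟨h, inferInstance, fun a x => ?_⟩
  obtain ⟨y, rfl⟩ := Submodule.Quotient.mk_surjective _ x
  rw [← Submodule.Quotient.mk_smul, hmk, hmk, hg, Submodule.Quotient.mk_smul]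

end LocalizedQuotients

section DescentOfHoms

variable {Z : Type*} [CommRing Z] [IsNoetherianRing Z] {S : Submonoid Z}
  {A A' : Type*} [Ring A] [Ring A'] [Algebra Z A] [Algebra Z A'] (φ : A →ₐ[Z] A')
  {M N V X : Type*} [AddCommGroup M] [Module A M] [Module Z M] [Module.Finite Z M]
  [AddCommGroup N] [Module A' N] [Module Z N] [IsScalarTower Z A' N]
  [AddCommGroup V] [Module A V] [Module Z V] [IsScalarTower Z A V] [Module.Finite Z V]
  [AddCommGroup X] [Module A' X] [Module Z X] [IsScalarTower Z A' X]

theorem exists_linearMap_ne_zero_of_isLocalizedModule (ι : M →ₗ[Z] N) [IsLocalizedModule S ι]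
    (hι : ∀ a x, ι (a • x) = φ a • ι x) (h : V →ₗ[Z] X) [IsLocalizedModule S h]
    (hh : ∀ a v, h (a • v) = φ a • h v) {F : N →ₗ[A'] X} (hF : F ≠ 0) :
    ∃ f : M →ₗ[A] V, f ≠ 0 := by
  obtain ⟨f, s, hf⟩ := exists_linearMap_clearing_denominators (S := S) φ h hh
    (F.restrictScalars Z ∘ₗ ι) fun a x => by
      simp only [LinearMap.comp_apply, LinearMap.coe_restrictScalars, hι, map_smul]
  refine ⟨f, fun hf0 => hF ?_⟩
  have hX := IsLocalizedModule.map_units (S := S) h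
  have hFι : F.restrictScalars Z ∘ₗ ι = 0 := LinearMap.ext fun x =>
    smul_right_injective_of_isUnit (hX s) (by
      dsimp only
      rw [← hf x, hf0, LinearMap.zero_apply, map_zero, LinearMap.zero_apply, smul_zero])
  exact LinearMap.restrictScalars_injective Z
    (IsLocalizedModule.ext S ι hX (by rw [hFι]; rfl))

end DescentOfHoms

section LocalizationAtPrime

variable {Z : Type u} [CommRing Z] [IsNoetherianRing Z] {Y : Type u} [AddCommGroup Y] [Module Z Y]
  [Module.Finite Z Y]

theorem length_le_height_of_isWeaklyRegular {m : Ideal Z} [hm : m.IsPrime]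
    (hY : Module.annihilator Z Y = ⊥) {rs : List Z} (hrs : IsWeaklyRegular Y rs)
    (hrm : ∀ r ∈ rs, r ∈ m) : (rs.length : ℕ∞) ≤ m.height := by
  obtain ⟨p, hp, hpm⟩ := exists_associatedPrime_le_of_mem_support (Z := Z) (Y := Y)
    (m := ⟨m, hm⟩) (Module.mem_support_iff_of_finite.mpr (by simp [hY]))
  obtain ⟨l, -, hlast, hlen⟩ := exists_ltSeries_of_isWeaklyRegular (p := ⟨p, hp.isPrime⟩)
    (m := ⟨m, hm⟩) hp hpm hrm hrs
  rw [← hlen]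
  exact (Order.length_le_height hlast).trans_eq (PrimeSpectrum.height_eq_orderHeight ⟨m, hm⟩).symm

theorem HasDepth.height_eq {m : Ideal Z} [hm : m.IsMaximal] {d : ℕ} (hd : HasDepth Z Y d)
    (hdim : ringKrullDim Z = d) (hY : Module.annihilator Z Y = ⊥) : m.height = d := by
  refine le_antisymm ?_ ?_
  · have := Ideal.height_le_ringKrullDim_of_ne_top hm.ne_top
    rw [hdim] at this
    exact WithBot.coe_le_coe.mp this
  · obtain ⟨ss, rfl, hsm, hss⟩ := hd m hm
    exact length_le_height_of_isWeaklyRegular hY hss hsm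

theorem HasDepth.mem_associatedPrimes_of_annihilator_le {d : ℕ} (hd : HasDepth Z Y d)
    {M : Type*} [AddCommGroup M] [Module Z M] [Module.Finite Z M] {k : ℕ}
    (hk : Module.supportDim Z M = k) {rs : List Z} (hrs : IsWeaklyRegular Y rs)
    (hlen : rs.length + k = d) {q : Ideal Z}
    (hq : q ∈ associatedPrimes Z (Y ⧸ (Ideal.ofList rs • ⊤ : Submodule Z Y)))
    (hMq : Module.annihilator Z M ≤ q) : q ∈ associatedPrimes Z M := by
  have hqp := hq.isPrime
  obtain ⟨r, hr, hrq⟩ := Ideal.exists_minimalPrimes_le (J := q) hMq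
  have hrM := Module.associatedPrimes.minimalPrimes_annihilator_subset_associatedPrimes Z M hr
  rcases hrq.eq_or_lt with rfl | hlt
  · exact hrM
  have hcoheight : Order.coheight (⟨q, hqp⟩ : PrimeSpectrum Z) + 1 ≤ (k : ℕ∞) := by
    have h := coheight_le_supportDim (M := M) (p := ⟨r, hrM.isPrime⟩)
      (Module.mem_support_iff_of_finite.mpr hr.1.2)
    rw [hk] at h
    refine le_trans ?_ (WithBot.coe_le_coe.mp h)
    exact Order.coheight_add_one_le (b := (⟨r, hrM.isPrime⟩ : PrimeSpectrum Z)) hlt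
  have hdk : ((d + 1 : ℕ) : ℕ∞) ≤ (rs.length + k : ℕ) := by
    push_cast
    calc (d : ℕ∞) + 1 ≤ rs.length + Order.coheight (⟨q, hqp⟩ : PrimeSpectrum Z) + 1 := by
          gcongr
          exact hd.le_length_add_coheight hrs (p := ⟨q, hqp⟩) hq
      _ ≤ rs.length + k := by
          rw [add_assoc]
          gcongr
  rw [hlen] at hdk
  exact absurd (Nat.cast_le.mp hdk) (by omega)

end LocalizationAtPrime

section AssociatedPrimes

variable {Z : Type*} [CommRing Z] {p : Ideal Z} [p.IsPrime]

theorem mem_associatedPrimes_localization (Z' : Type*) [CommRing Z'] [Algebra Z Z']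
    [IsLocalization.AtPrime Z' p] {Y Y' : Type*} [AddCommGroup Y] [Module Z Y] [AddCommGroup Y']
    [Module Z Y'] [Module Z' Y'] [IsScalarTower Z Z' Y'] (g : Y →ₗ[Z] Y')
    [IsLocalizedModule p.primeCompl g] {I q : Ideal Z} (hqp : q ≤ p)
    (hq : q ∈ associatedPrimes Z (Y ⧸ (I • ⊤ : Submodule Z Y))) :
    q.map (algebraMap Z Z') ∈
      associatedPrimes Z' (Y' ⧸ (I.map (algebraMap Z Z') • ⊤ : Submodule Z' Y')) := by
  rw [← localized'_ideal_smul_top (S := p.primeCompl) Z' g]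
  refine
    Module.associatedPrimes.mem_associatedPrimes_of_comap_mem_associatedPrimes_of_isLocalizedModule
      p.primeCompl (Submodule.toLocalizedQuotient' Z' p.primeCompl g (I • ⊤ : Submodule Z Y)) _ ?_
  have hdisj : Disjoint (p.primeCompl : Set Z) q :=
    Set.disjoint_left.mpr fun x hx hxq => hx (hqp hxq)
  rwa [← Ideal.under_def, IsLocalization.under_map_of_isPrime_disjoint p.primeCompl Z' hq.isPrime
    hdisj]

variable [IsNoetherianRing Z]

theorem exists_mem_map_ne_zero_of_associatedPrimes_le {X X' : Type*} [AddCommGroup X] [Module Z X]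
    [AddCommGroup X'] [Module Z X'] (h : X →ₗ[Z] X') [IsLocalizedModule p.primeCompl h]
    {K : Submodule Z X} (hK : K ≠ ⊥) (hp : ∀ q ∈ associatedPrimes Z K, q ≤ p) :
    ∃ x ∈ K, h x ≠ 0 := by
  have := (Submodule.nontrivial_iff_ne_bot (p := K)).mpr hK
  obtain ⟨q, hq⟩ := associatedPrimes.nonempty Z K
  obtain ⟨-, ⟨x, hxK⟩, hx⟩ := isAssociatedPrime_iff.mp hq
  refine ⟨x, hxK, fun h0 => ?_⟩
  obtain ⟨c, hc⟩ := (IsLocalizedModule.eq_zero_iff p.primeCompl h).mp h0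
  refine c.2 (hp q hq ?_)
  rw [hx, Submodule.mem_colon_singleton, Submodule.mem_bot]
  exact Subtype.ext hc

theorem le_of_mem_associatedPrimes_of_injective {M N : Type*} [AddCommGroup M] [Module Z M]
    [AddCommGroup N] [Module Z N]
    (hN : ∀ s : p.primeCompl, IsUnit (algebraMap Z (Module.End Z N) s)) {ι : M →ₗ[Z] N}
    (hι : Function.Injective ι) {q : Ideal Z} (hq : q ∈ associatedPrimes Z M) : q ≤ p := by
  intro z hzq
  by_contra hzp
  refine notMem_of_isSMulRegular (fun x y hxy => hι ?_) hq hzq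
  refine smul_right_injective_of_isUnit (hN ⟨z, hzp⟩) ?_
  dsimp only at hxy ⊢
  rw [← map_smul, hxy, map_smul]

end AssociatedPrimes

section LocalizationAtMaximal

variable {Z : Type u} [CommRing Z] {m : Ideal Z} [m.IsMaximal]
  {Y : Type u} [AddCommGroup Y] [Module Z Y] {d : ℕ}

variable (Z' : Type u) [CommRing Z'] [Algebra Z Z'] [IsLocalization.AtPrime Z' m]
  {Y' : Type u} [AddCommGroup Y'] [Module Z Y'] [Module Z' Y'] [IsScalarTower Z Z' Y']
  (g : Y →ₗ[Z] Y') [IsLocalizedModule m.primeCompl g]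

include m g in
theorem HasDepth.localization (hd : HasDepth Z Y d) : HasDepth Z' Y' d := by
  intro m' hm'
  obtain ⟨rs, hlen, hrm, hrs⟩ := hd m inferInstance
  have := IsLocalization.AtPrime.isLocalRing Z' m
  refine ⟨rs.map (algebraMap Z Z'), by simpa using hlen, List.forall_mem_map.mpr fun r hr => ?_,
    hrs.of_isLocalizedModule Z' m.primeCompl g⟩
  rw [IsLocalRing.eq_maximalIdeal hm', IsLocalization.AtPrime.to_map_mem_maximal_iff Z' m]
  exact hrm r hr

variable [IsNoetherianRing Z] [Module.Finite Z Y]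

theorem HasDepth.exists_localization_apply_ne_zero (hd : HasDepth Z Y d)
    {M : Type*} [AddCommGroup M] [Module Z M] [Module.Finite Z M] {k : ℕ}
    (hk : Module.supportDim Z M = k) {rs : List Z} (hrs : IsWeaklyRegular Y rs)
    (hlen : rs.length + k = d) (hm : ∀ q ∈ associatedPrimes Z M, q ≤ m)
    {f : M →ₗ[Z] Y ⧸ (Ideal.ofList rs • ⊤ : Submodule Z Y)} (hf : f ≠ 0)
    {X : Type*} [AddCommGroup X] [Module Z X]
    (h : (Y ⧸ (Ideal.ofList rs • ⊤ : Submodule Z Y)) →ₗ[Z] X) [IsLocalizedModule m.primeCompl h] :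
    ∃ x, h (f x) ≠ 0 := by
  have hK : LinearMap.range f ≠ ⊥ := fun hbot => hf (LinearMap.range_eq_bot.mp hbot)
  obtain ⟨_, ⟨x, rfl⟩, hx⟩ := exists_mem_map_ne_zero_of_associatedPrimes_le h hK fun q hq => by
    have hMq : Module.annihilator Z M ≤ q :=
      (LinearMap.annihilator_le_of_surjective f.rangeRestrict f.surjective_rangeRestrict).trans
        (annihilator_le_of_mem_associatedPrimes hq)
    have hqY := associatedPrimes.subset_of_injective (Submodule.injective_subtype _) hq
    exact hm q (hd.mem_associatedPrimes_of_annihilator_le hk hrs hlen hqY hMq)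
  exact ⟨x, hx⟩

variable {A A' : Type u} [Ring A] [Ring A'] [Algebra Z A] [Algebra Z A']
  [Algebra Z' A'] [Module A Y] [IsScalarTower Z A Y] [Module A' Y'] [IsScalarTower Z A' Y']
  [IsScalarTower Z' A' Y']
  (φ : A →ₐ[Z] A') [IsLocalizedModule m.primeCompl φ.toLinearMap]
  (hg : ∀ a y, g (a • y) = φ a • g y)

include Z' hg in
theorem HasDepth.exists_linearMap_localization_ne_zero (hd : HasDepth Z Y d) {M N : Type*}
    [AddCommGroup M] [Module A M] [Module Z M] [IsScalarTower Z A M] [Module.Finite Z M]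
    [AddCommGroup N] [Module A' N] [Module Z N] [IsScalarTower Z A' N]
    (ι : M →ₗ[Z] N) [IsLocalizedModule m.primeCompl ι] (hι : Function.Injective ι)
    (hφι : ∀ a x, ι (a • x) = φ a • ι x) {k : ℕ} (hk : Module.supportDim Z M = k) {rs : List Z}
    (hrs : IsWeaklyRegular Y rs) (hlen : rs.length + k = d)
    {f : M →ₗ[A] Y ⧸ idealSMulTop A (Ideal.ofList rs) Y} (hf : f ≠ 0) :
    ∃ F : N →ₗ[A'] Y' ⧸ idealSMulTop A' (Ideal.ofList rs) Y', F ≠ 0 := by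
  obtain ⟨h, hloc, hh⟩ :=
    exists_isLocalizedModule_quotient (S := m.primeCompl) Z' g φ hg (Ideal.ofList rs)
  let e := idealSMulTopQuotEquiv A (Ideal.ofList rs) Y
  obtain ⟨x, hx⟩ : ∃ x, h (f x) ≠ 0 := by
    obtain ⟨x, hx⟩ := hd.exists_localization_apply_ne_zero (m := m) hk hrs hlen
      (fun q => le_of_mem_associatedPrimes_of_injective (IsLocalizedModule.map_units ι) hι)
      (f := e.symm.toLinearMap ∘ₗ f.restrictScalars Z)
      (fun h0 => hf (LinearMap.ext fun x => e.symm.map_eq_zero_iff.mp (LinearMap.congr_fun h0 x)))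
      (h ∘ₗ e.toLinearMap)
    exact ⟨x, by simpa using hx⟩
  obtain ⟨F, hF⟩ := exists_linearMap_extension φ (S := m.primeCompl)
    (IsLocalizedModule.map_units h) ι hφι (h ∘ₗ f.restrictScalars Z) fun a x => by
      simp only [LinearMap.comp_apply, LinearMap.coe_restrictScalars, map_smul, hh]
  exact ⟨F, fun h0 => hx (by simpa [h0] using (hF x).symm)⟩

variable [Module.Finite Z A]

include m Z' hg in
-- `N` is the localisation of a finite `A`-submodule `M`. A maximal weakly regular sequence in the
-- annihilator of `M` computes the grade of `N`, since the associated primes of `M` lie in `m`.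
theorem HasEnoughHoms.exists_extGrade_localization_eq (hom : HasEnoughHoms Z A Y)
    (hd : HasDepth Z Y d) (hdim : ringKrullDim Z = d) (hY : Module.annihilator Z Y = ⊥)
    (N : Type u) [AddCommGroup N] [Module A' N] [Module Z N] [Module Z' N] [IsScalarTower Z A' N]
    [IsScalarTower Z Z' N] [Module.Finite A' N] [Nontrivial N] :
    ∃ rs : List Z, (∀ r ∈ rs, r ∈ Module.annihilator Z N) ∧ IsWeaklyRegular Y' rs ∧
      extGrade A' N Y' = rs.length := by
  let _ : Module A N := Module.compHom N φ.toRingHom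
  have hφN : ∀ (a : A) (n : N), a • n = φ a • n := fun _ _ => rfl
  have : IsScalarTower Z A N := IsScalarTower.of_algebraMap_smul fun z n => by
    rw [hφN, AlgHom.commutes, algebraMap_smul]
  have hN := isUnit_algebraMap_end_of_isLocalization (S := m.primeCompl) Z' (N := N)
  obtain ⟨M, hM, hι⟩ := exists_finite_submodule_isLocalizedModule φ hφN hN
  have : Module.Finite Z M := Module.Finite.trans A M
  have : Nontrivial M := by
    by_contra hsub
    rw [not_nontrivial_iff_subsingleton] at hsub
    exact not_subsingleton N (IsLocalizedModule.subsingleton_of_subsingleton m.primeCompl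
      (M.subtype.restrictScalars Z))
  obtain ⟨k, hk⟩ := exists_supportDim_eq_natCast hdim (M := M)
  obtain ⟨rs, hrM, hrs, hlen, p, hp, hMp⟩ := hd.exists_isWeaklyRegular_annihilator hdim hY hk
  have hrN : ∀ r ∈ rs, r ∈ Module.annihilator Z N := fun r hr =>
    annihilator_le_of_isLocalizedModule m.primeCompl (M.subtype.restrictScalars Z) (hrM r hr)
  have hrsY : IsWeaklyRegular Y' rs := (isWeaklyRegular_map_algebraMap_iff Z' Y' rs).mp
    (hrs.of_isLocalizedModule Z' m.primeCompl g)
  obtain ⟨f, hf⟩ := hom M hM rs hrM hrs p hp hMp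
  exact ⟨rs, hrN, hrsY, (extGrade_eq_length_iff (fun r hr =>
    Module.mem_annihilator.mp (hrN r hr)) hrsY).mpr <|
      hd.exists_linearMap_localization_ne_zero (m := m) Z' g φ hg (M.subtype.restrictScalars Z)
        M.injective_subtype (fun _ _ => rfl) hk hrs hlen hf⟩

variable [IsScalarTower Z Z' A'] [Module.Finite Z' A'] [Module.Finite Z' Y']

include m φ hg in
theorem HasEnoughHoms.localization (hom : HasEnoughHoms Z A Y) (hd : HasDepth Z Y d)
    (hdim : ringKrullDim Z = d) (hY : Module.annihilator Z Y = ⊥) : HasEnoughHoms Z' A' Y' := by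
  intro N _ _ _ _ hN rs' hrN' hrs' p hp hNp
  have : IsNoetherianRing Z' := IsLocalization.isNoetherianRing m.primeCompl Z' inferInstance
  have : Module.Finite Z' N := Module.Finite.trans A' N
  let _ : Module Z N := Module.compHom N (algebraMap Z Z')
  have : IsScalarTower Z Z' N := IsScalarTower.of_algebraMap_smul fun _ _ => rfl
  have : IsScalarTower Z A' N := IsScalarTower.of_algebraMap_smul fun z n => by
    rw [IsScalarTower.algebraMap_apply Z Z' A', algebraMap_smul, algebraMap_smul]
  have : Nontrivial N := Module.nonempty_support_iff.mp
    ⟨⟨p, hp.isPrime⟩, Module.mem_support_iff_of_finite.mpr hNp⟩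
  obtain ⟨rs, hrN, hrs, hgrade⟩ :=
    hom.exists_extGrade_localization_eq (m := m) Z' g φ hg hd hdim hY N
  have hkill : ∀ r ∈ rs', ∀ n : N, r • n = 0 := fun r hr => Module.mem_annihilator.mp (hrN' r hr)
  have hle : rs'.length ≤ rs.length := by
    exact_mod_cast hgrade ▸ length_le_extGrade (A := A') hkill hrs'
  have hge : rs.length ≤ rs'.length := by
    by_contra! hlt
    obtain ⟨z, hz, hreg⟩ := exists_isSMulRegular_of_length_lt hrs' hrN'
      ((isWeaklyRegular_map_algebraMap_iff Z' Y' rs).mpr hrs)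
      (List.forall_mem_map.mpr fun r hr => Module.mem_annihilator.mpr fun n => by
        rw [algebraMap_smul, Module.mem_annihilator.mp (hrN r hr)]) (by simpa using hlt)
    exact notMem_of_isSMulRegular hreg hp (hNp hz)
  rw [← extGrade_eq_length_iff hkill hrs', hgrade, hge.antisymm hle]

end LocalizationAtMaximal

section DescentFromLocalization

variable {Z : Type u} [CommRing Z] {m : Ideal Z} {Z' : Type u} [CommRing Z'] [Algebra Z Z']
  {Y Y' : Type u} [AddCommGroup Y] [Module Z Y] [AddCommGroup Y'] [Module Z Y'] [Module Z' Y']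
  [IsScalarTower Z Z' Y'] (g : Y →ₗ[Z] Y')

section Depth

variable [m.IsMaximal] [IsLocalization.AtPrime Z' m] [IsLocalizedModule m.primeCompl g]
  [IsNoetherianRing Z] [Module.Finite Z Y] [Module.Finite Z' Y'] {d : ℕ} (hd : HasDepth Z' Y' d)

include g hd

theorem HasDepth.exists_isSMulRegular_of_localization {rs : List Z} (hrs : IsWeaklyRegular Y rs)
    (hrm : ∀ r ∈ rs, r ∈ m) (hlt : rs.length < d) :
    ∃ x ∈ m, IsSMulRegular (Y ⧸ (Ideal.ofList rs • ⊤ : Submodule Z Y)) x := by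
  have : IsNoetherianRing Z' := IsLocalization.isNoetherianRing m.primeCompl Z' inferInstance
  have := IsLocalization.AtPrime.isLocalRing Z' m
  by_contra! hzero
  obtain ⟨p, hp, hmp⟩ := exists_le_associatedPrime_of_forall_not_isSMulRegular hzero
  obtain rfl : m = p := Ideal.IsMaximal.eq_of_le inferInstance hp.isPrime.ne_top hmp
  have hass := mem_associatedPrimes_localization (p := m) Z' g le_rfl hp
  rw [IsLocalization.AtPrime.map_eq_maximalIdeal m Z', Ideal.map_ofList] at hass
  obtain ⟨ss, rfl, hsm, hss⟩ :=
    hd (IsLocalRing.maximalIdeal Z') (IsLocalRing.maximalIdeal.isMaximal Z')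
  obtain ⟨z, hz, hreg⟩ := exists_isSMulRegular_of_length_lt
    (hrs.of_isLocalizedModule Z' m.primeCompl g)
    (List.forall_mem_map.mpr fun r hr =>
      (IsLocalization.AtPrime.to_map_mem_maximal_iff Z' m r).mpr (hrm r hr)) hss hsm
    (by simpa using hlt)
  exact notMem_of_isSMulRegular hreg hass hz

theorem HasDepth.exists_isWeaklyRegular_of_localization {n : ℕ} (hn : n ≤ d) :
    ∃ rs : List Z, rs.length = n ∧ (∀ r ∈ rs, r ∈ m) ∧ IsWeaklyRegular Y rs := by
  induction n with
  | zero => exact ⟨[], rfl, by simp, by simp⟩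
  | succ n ih =>
    obtain ⟨rs, rfl, hrm, hrs⟩ := ih (by omega)
    obtain ⟨x, hxm, hx⟩ := hd.exists_isSMulRegular_of_localization g hrs hrm (by omega)
    exact ⟨rs ++ [x], by simp, by simpa [or_imp, forall_and, hxm] using hrm,
      isWeaklyRegular_concat hrs hx⟩

end Depth

section EnoughHoms

variable [m.IsPrime] [IsLocalization.AtPrime Z' m] [IsLocalizedModule m.primeCompl g]
  {A' : Type u} [Ring A'] [Algebra Z A'] [Algebra Z' A'] [Module A' Y']
  [IsScalarTower Z A' Y'] [IsScalarTower Z' A' Y'] {rs : List Z} {p : Ideal Z}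

include g in
theorem HasEnoughHoms.exists_linearMap_localization_ne_zero (hom : HasEnoughHoms Z' A' Y')
    {M N : Type u} [AddCommGroup M] [Module Z M] [Module.Finite Z M] [AddCommGroup N] [Module A' N]
    [Module Z N] [Module Z' N] [IsScalarTower Z Z' N] [IsScalarTower Z' A' N]
    (ι : M →ₗ[Z] N) [IsLocalizedModule m.primeCompl ι]
    (hrM : ∀ r ∈ rs, r ∈ Module.annihilator Z M) (hrs : IsWeaklyRegular Y rs)
    (hp : p ∈ associatedPrimes Z (Y ⧸ (Ideal.ofList rs • ⊤ : Submodule Z Y)))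
    (hMp : Module.annihilator Z M ≤ p) (hpm : p ≤ m) :
    ∃ F : N →ₗ[A'] Y' ⧸ idealSMulTop A' (Ideal.ofList rs) Y', F ≠ 0 := by
  have : Module.Finite Z' N := Module.Finite.of_isLocalizedModule m.primeCompl ι
  have : Module.Finite A' N := Module.Finite.of_restrictScalars_finite Z' A' N
  have hass := mem_associatedPrimes_localization (p := m) Z' g hpm hp
  rw [Ideal.map_ofList] at hass
  rw [← idealSMulTop_map_algebraMap Z', Ideal.map_ofList]
  refine hom N inferInstance _ (List.forall_mem_map.mpr fun r hr => ?_)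
    (hrs.of_isLocalizedModule Z' m.primeCompl g) _ hass ?_
  · rw [← Ideal.mem_comap, Module.comap_annihilator]
    exact annihilator_le_of_isLocalizedModule m.primeCompl ι (hrM r hr)
  · exact (annihilator_le_map_of_isLocalizedModule (S := m.primeCompl) Z' ι).trans
      (Ideal.map_mono hMp)

include g in
theorem HasEnoughHoms.exists_linearMap_of_localization [IsNoetherianRing Z]
    [Module.Finite Z Y] [IsScalarTower Z Z' A'] {A : Type u} [Ring A] [Algebra Z A]
    [Module.Finite Z A] [Module A Y] [IsScalarTower Z A Y] (hom : HasEnoughHoms Z' A' Y')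
    (φ : A →ₐ[Z] A') [IsLocalizedModule m.primeCompl φ.toLinearMap]
    (hg : ∀ a y, g (a • y) = φ a • g y) {M : Type u} [AddCommGroup M]
    [Module A M] [Module Z M] [IsScalarTower Z A M] [Module.Finite A M]
    (hrM : ∀ r ∈ rs, r ∈ Module.annihilator Z M) (hrs : IsWeaklyRegular Y rs)
    (hp : p ∈ associatedPrimes Z (Y ⧸ (Ideal.ofList rs • ⊤ : Submodule Z Y)))
    (hMp : Module.annihilator Z M ≤ p) (hpm : p ≤ m) :
    ∃ f : M →ₗ[A] Y ⧸ idealSMulTop A (Ideal.ofList rs) Y, f ≠ 0 := by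
  have : Module.Finite Z M := Module.Finite.trans A M
  let N := LocalizedModule m.primeCompl M
  let ι : M →ₗ[Z] N := LocalizedModule.mkLinearMap m.primeCompl M
  let _ : Module A' N := Module.compHom N (localizedAction m.primeCompl φ ι).toRingHom
  have hsmul : ∀ (a : A') (n : N), a • n = localizedAction m.primeCompl φ ι a n := fun _ _ => rfl
  have : IsScalarTower Z A' N := IsScalarTower.of_algebraMap_smul fun z n => by
    rw [hsmul, AlgHom.commutes, Module.algebraMap_end_apply]
  let _ : Module Z' N := Module.compHom N (algebraMap Z' A')
  have : IsScalarTower Z' A' N := IsScalarTower.of_algebraMap_smul fun _ _ => rfl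
  have : IsScalarTower Z Z' N := IsScalarTower.of_algebraMap_smul fun z n => by
    rw [← algebraMap_smul A' (algebraMap Z Z' z), ← IsScalarTower.algebraMap_apply,
      algebraMap_smul]
  obtain ⟨F, hF⟩ := hom.exists_linearMap_localization_ne_zero g ι hrM hrs hp hMp hpm
  obtain ⟨h, hloc, hh⟩ :=
    exists_isLocalizedModule_quotient (S := m.primeCompl) Z' g φ hg (Ideal.ofList rs)
  have : Module.Finite Z (Y ⧸ idealSMulTop A (Ideal.ofList rs) Y) :=
    Module.Finite.of_surjective _ (idealSMulTopQuotEquiv A (Ideal.ofList rs) Y).surjective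
  exact exists_linearMap_ne_zero_of_isLocalizedModule (S := m.primeCompl) φ ι
    (fun a x => by rw [hsmul, localizedAction_apply]) h hh hF

end EnoughHoms

end DescentFromLocalization

/-! ### The Eakin–Nagata theorem -/

section EakinNagata

variable {Z : Type*} [CommRing Z]

theorem isNoetherian_quotient_annihilator (X : Type*) [AddCommGroup X] [Module Z X]
    [IsNoetherian Z X] : IsNoetherian Z (Z ⧸ Module.annihilator Z X) := by
  let f : Z →ₗ[Z] Module.End Z X := Algebra.linearMap Z (Module.End Z X)
  have hker : LinearMap.ker f = Module.annihilator Z X := by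
    ext z
    exact LinearMap.ext_iff.trans Module.mem_annihilator.symm
  rw [← hker]
  exact isNoetherian_of_linearEquiv f.quotKerEquivRange.symm

variable {Q : Type*} [AddCommGroup Q] [Module Z Q]

theorem smul_top_le_iff_mem_annihilator_quotient {z : Z} {N : Submodule Z Q} :
    (z • ⊤ : Submodule Z Q) ≤ N ↔ z ∈ Module.annihilator Z (Q ⧸ N) := by
  rw [Submodule.annihilator_quotient, ← Submodule.top_coe (R := Z), Submodule.mem_colon_iff_le]

variable [Module.Finite Z Q]

theorem isNoetherian_of_le_annihilator {I : Ideal Z} [IsNoetherian Z (Z ⧸ I)]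
    (hI : I ≤ Module.annihilator Z Q) : IsNoetherian Z Q := by
  obtain ⟨n, x, hx⟩ := Module.Finite.exists_fin (R := Z) (M := Q)
  let t : (Fin n → Z ⧸ I) →ₗ[Z] Q :=
    LinearMap.lsum Z _ Z fun i => I.liftQ (LinearMap.toSpanSingleton Z Q (x i))
      fun z hz => LinearMap.mem_ker.mpr (Module.mem_annihilator.mp (hI hz) (x i))
  refine isNoetherian_of_surjective t ?_
  rw [eq_top_iff, ← hx, Submodule.span_le]
  rintro _ ⟨i, rfl⟩
  refine ⟨Pi.single i (Submodule.Quotient.mk 1), ?_⟩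
  rw [LinearMap.lsum_piSingle, Submodule.liftQ_apply, LinearMap.toSpanSingleton_apply, one_smul]

variable (Z Q) in
theorem exists_maximal_annihilator_quotient_le :
    ∃ N : Submodule Z Q, Maximal
      (fun N => Module.annihilator Z (Q ⧸ N) ≤ Module.annihilator Z Q) N := by
  have hcompact (z : Z) : IsCompactElement (z • ⊤ : Submodule Z Q) :=
    (Submodule.fg_iff_compact _).mp (Module.Finite.fg_top.map _)
  obtain ⟨N, -, hN⟩ := zorn_le_nonempty₀
    {N : Submodule Z Q | Module.annihilator Z (Q ⧸ N) ≤ Module.annihilator Z Q}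
    (fun c hc hchain N hNc => ⟨sSup c, fun z hz => by
      obtain ⟨N', hN', hzN'⟩ :=
        (CompleteLattice.isCompactElement_iff_le_of_directed_sSup_le _ _).mp (hcompact z) c
          ⟨N, hNc⟩ hchain.directedOn (smul_top_le_iff_mem_annihilator_quotient.mpr hz)
      exact hc hN' (smul_top_le_iff_mem_annihilator_quotient.mp hzN'), fun N hN => le_sSup hN⟩)
    ⊥ ((Submodule.quotEquivOfEqBot ⊥ rfl).annihilator_eq.le)
  exact ⟨N, hN⟩

theorem fg_of_isNoetherian_quotient_smul {z : Z} [IsNoetherian Z (Q ⧸ (z • ⊤ : Submodule Z Q))]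
    {W : Submodule Z Q} (hz : z • ⊤ ≤ W) : W.FG := by
  refine Submodule.fg_of_fg_map_of_fg_inf_ker (z • ⊤ : Submodule Z Q).mkQ
    (IsNoetherian.noetherian _) ?_
  rw [Submodule.ker_mkQ, inf_eq_right.mpr hz]
  exact Module.Finite.fg_top.map _

section CyclicQuotients

variable (h : ∀ z : Z, z ∉ Module.annihilator Z Q →
  IsNoetherian Z (Q ⧸ (z • ⊤ : Submodule Z Q)))

include h

theorem isNoetherian_quotient_of_maximal {N : Submodule Z Q}
    (hN : Maximal (fun N => Module.annihilator Z (Q ⧸ N) ≤ Module.annihilator Z Q) N) :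
    IsNoetherian Z (Q ⧸ N) := by
  refine ⟨fun W => ?_⟩
  rw [← Submodule.map_comap_eq_of_surjective N.mkQ_surjective W]
  have hNW : N ≤ W.comap N.mkQ := N.le_comap_mkQ W
  by_cases hW : Module.annihilator Z (Q ⧸ W.comap N.mkQ) ≤ Module.annihilator Z Q
  · rw [← hN.eq_of_le hW hNW, Submodule.mkQ_map_self]
    exact Submodule.fg_bot
  · obtain ⟨z, hzW, hz⟩ := SetLike.not_le_iff_exists.mp hW
    have := h z hz
    exact (fg_of_isNoetherian_quotient_smul
      (smul_top_le_iff_mem_annihilator_quotient.mpr hzW)).map _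

/- Formanek's argument: a quotient of `Q` by a submodule maximal among those that do not enlarge
the annihilator is noetherian, and it bounds `Q` because it has the same annihilator. -/
theorem isNoetherian_of_isNoetherian_quotient_smul : IsNoetherian Z Q := by
  obtain ⟨N, hN⟩ := exists_maximal_annihilator_quotient_le Z Q
  have := isNoetherian_quotient_of_maximal h hN
  have := isNoetherian_quotient_annihilator (Z := Z) (Q ⧸ N)
  exact isNoetherian_of_le_annihilator hN.prop

end CyclicQuotients

omit [Module.Finite Z Q] in
theorem isNoetherian_quotient_quotient_smul {I : Ideal Z} {z : Z}
    [IsNoetherian Z (Q ⧸ ((I ⊔ Ideal.span {z}) • ⊤ : Submodule Z Q))] :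
    IsNoetherian Z
      ((Q ⧸ (I • ⊤ : Submodule Z Q)) ⧸ (z • ⊤ : Submodule Z (Q ⧸ (I • ⊤ : Submodule Z Q)))) := by
  have hmap : (z • ⊤ : Submodule Z (Q ⧸ (I • ⊤ : Submodule Z Q))) =
      (z • ⊤ : Submodule Z Q).map (I • ⊤ : Submodule Z Q).mkQ := by
    rw [Submodule.map_pointwise_smul, Submodule.map_top, Submodule.range_mkQ]
  have hsup : ((I ⊔ Ideal.span {z}) • ⊤ : Submodule Z Q) = I • ⊤ ⊔ z • ⊤ := by
    rw [Submodule.sup_smul, Submodule.ideal_span_singleton_smul]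
  rw [hmap]
  exact isNoetherian_of_linearEquiv ((Submodule.quotEquivOfEq _ _ hsup).trans
    (Submodule.quotientQuotientEquivQuotientSup _ _).symm)

variable {R : Type*} [Ring R] [Algebra Z R]

theorem idealSMulTop_lt_idealSMulTop_sup {I : Ideal Z} {z : Z}
    (hz : z ∉ Module.annihilator Z (R ⧸ (I • ⊤ : Submodule Z R))) :
    idealSMulTop R I R < idealSMulTop R (I ⊔ Ideal.span {z}) R := by
  have hle : (I • ⊤ : Submodule Z R) ≤ (I ⊔ Ideal.span {z}) • ⊤ :=
    Submodule.smul_mono_left le_sup_left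
  refine lt_of_le_of_ne hle fun he => hz (smul_top_le_iff_mem_annihilator_quotient.mp ?_)
  rintro _ ⟨r, -, rfl⟩
  rw [← mem_idealSMulTop (A := R), he, mem_idealSMulTop]
  exact Submodule.smul_mem_smul (Ideal.mem_sup_right (Ideal.mem_span_singleton_self z)) trivial

variable [IsNoetherianRing R] [Module.Finite Z R]

theorem isNoetherian_quotient_ideal_smul_top (I : Ideal Z) :
    IsNoetherian Z (R ⧸ (I • ⊤ : Submodule Z R)) := by
  induction hJ : idealSMulTop R I R using WellFoundedGT.induction generalizing I with | _ J ih
  subst hJ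
  refine isNoetherian_of_isNoetherian_quotient_smul fun z hz => ?_
  have := ih _ (idealSMulTop_lt_idealSMulTop_sup hz) (I ⊔ Ideal.span {z}) rfl
  exact isNoetherian_quotient_quotient_smul

theorem isNoetherianRing_of_annihilator_eq_bot (hR : Module.annihilator Z R = ⊥) :
    IsNoetherianRing Z := by
  have hquot : IsNoetherian Z (R ⧸ ((⊥ : Ideal Z) • ⊤ : Submodule Z R)) :=
    isNoetherian_quotient_ideal_smul_top ⊥
  have : IsNoetherian Z R :=
    isNoetherian_of_linearEquiv (Submodule.quotEquivOfEqBot ((⊥ : Ideal Z) • ⊤)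
      (Submodule.bot_smul ⊤))
  have := isNoetherian_quotient_annihilator (Z := Z) R
  exact isNoetherian_of_linearEquiv (Submodule.quotEquivOfEqBot _ hR)

end EakinNagata

/-! ### Regular sequences in maximal ideals and equicodimensionality -/

section SeqGrade

variable {Z : Type u} [CommRing Z] {Y : Type u} [AddCommGroup Y] [Module Z Y] [Module.Finite Z Y]

section Prime

variable {m : Ideal Z} [m.IsPrime]

theorem isRegular_of_isWeaklyRegular_of_mem (hY : Module.annihilator Z Y = ⊥) {rs : List Z}
    (hrs : IsWeaklyRegular Y rs) (hm : ∀ r ∈ rs, r ∈ m) : IsRegular Y rs := by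
  have hmem : (⟨m, inferInstance⟩ : PrimeSpectrum Z) ∈
      Module.support Z (Y ⧸ (Ideal.ofList rs • ⊤ : Submodule Z Y)) :=
    (mem_support_quotient_ofList hY).mpr hm
  exact ⟨hrs, fun h => Submodule.Quotient.nontrivial_iff.mp
    (Module.nonempty_support_iff.mp ⟨_, hmem⟩) h.symm⟩

theorem natCast_le_seqGrade_iff (hY : Module.annihilator Z Y = ⊥) {n : ℕ} :
    (n : ℕ∞) ≤ seqGrade m Y ↔
      ∃ rs : List Z, rs.length = n ∧ (∀ r ∈ rs, r ∈ m) ∧ IsWeaklyRegular Y rs := by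
  constructor
  · intro h
    cases n with
    | zero => exact ⟨[], rfl, by simp, by simp⟩
    | succ n =>
      have hlt : (n : ℕ∞) < seqGrade m Y := lt_of_lt_of_le (by exact_mod_cast n.lt_succ_self) h
      simp only [seqGrade, lt_iSup_iff] at hlt
      obtain ⟨rs, ⟨hrm, hrs⟩, hlen⟩ := hlt
      have hlen' : n + 1 ≤ rs.length := by exact_mod_cast hlen
      have hsplit : IsWeaklyRegular Y (rs.take (n + 1) ++ rs.drop (n + 1)) := by
        rw [List.take_append_drop]
        exact hrs.toIsWeaklyRegular
      exact ⟨rs.take (n + 1), by simpa using hlen', fun r hr => hrm r (List.mem_of_mem_take hr),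
        ((isWeaklyRegular_append_iff Y _ _).mp hsplit).1⟩
  · rintro ⟨rs, rfl, hrm, hrs⟩
    exact le_iSup₂ (f := fun (rs : List Z) (_ : (∀ r ∈ rs, r ∈ m) ∧ IsRegular Y rs) =>
      (rs.length : ℕ∞)) rs ⟨hrm, isRegular_of_isWeaklyRegular_of_mem hY hrs hrm⟩

theorem seqGrade_le_height [IsNoetherianRing Z] (hY : Module.annihilator Z Y = ⊥) :
    seqGrade m Y ≤ m.height :=
  iSup₂_le fun _ h => length_le_height_of_isWeaklyRegular hY h.2.toIsWeaklyRegular h.1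

end Prime

variable [IsNoetherianRing Z]

theorem HasDepth.seqGrade_eq {m : Ideal Z} [m.IsMaximal] {d : ℕ} (hd : HasDepth Z Y d)
    (hdim : ringKrullDim Z = d) (hY : Module.annihilator Z Y = ⊥) : seqGrade m Y = d :=
  le_antisymm ((seqGrade_le_height hY).trans_eq (hd.height_eq hdim hY))
    ((natCast_le_seqGrade_iff hY).mpr (hd m inferInstance))

theorem exists_hasDepth_of_seqGrade_eq [Nontrivial Z] (hY : Module.annihilator Z Y = ⊥)
    (h : ∀ m : Ideal Z, m.IsMaximal → (seqGrade m Y : WithBot ℕ∞) = ringKrullDim Z) :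
    ∃ d : ℕ, ringKrullDim Z = d ∧ HasDepth Z Y d := by
  obtain ⟨m, hm⟩ := Ideal.exists_maximal Z
  obtain ⟨d, hd⟩ := ENat.ne_top_iff_exists.mp
    (ne_top_of_le_ne_top (Ideal.height_ne_top hm.ne_top) (seqGrade_le_height (m := m) hY))
  have hdim : ringKrullDim Z = d := by
    rw [← h m hm, ← hd]
    rfl
  exact ⟨d, hdim, fun n hn => (natCast_le_seqGrade_iff hY).mp
    (WithBot.coe_inj.mp ((h n hn).trans hdim)).ge⟩

end SeqGrade

section Equicodimensional

variable {Z : Type u} [CommRing Z] [IsNoetherianRing Z] {R : Type u} [Ring R] [Algebra Z R]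
  [Module.Finite Z R]

theorem height_eq_height_contraction_of_height_le_seqGrade {P : TwoSidedIdeal R} (hP : IsCoatom P)
    (hR : Module.annihilator Z R = ⊥)
    (h : ∀ m : Ideal Z, m.IsMaximal → m.height ≤ seqGrade m R) :
    Order.height (⟨P, isPrimeIdeal_of_isCoatom hP⟩ : PrimeIdeals R) =
      (contraction Z ⟨P, isPrimeIdeal_of_isCoatom hP⟩).asIdeal.height := by
  have : IsNoetherianRing R := IsNoetherianRing.of_finite Z R
  set p := contraction Z ⟨P, isPrimeIdeal_of_isCoatom hP⟩
  have hpm : p.asIdeal.IsMaximal := isMaximal_contraction hP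
  obtain ⟨n, hn⟩ := ENat.ne_top_iff_exists.mp (Ideal.height_ne_top hpm.ne_top)
  obtain ⟨rs, rfl, hrm, hrs⟩ := (natCast_le_seqGrade_iff hR).mp (hn.trans_le (h p.asIdeal hpm))
  refine le_antisymm ?_ ?_
  · rw [PrimeSpectrum.height_eq_orderHeight]
    exact height_le_height_contraction _
  · rw [← hn]
    exact length_le_height hrs _ fun r hr => mem_contraction.mp (hrm r hr)

theorem HasDepth.isEquicodimensional {d : ℕ} (hd : HasDepth Z R d) (hdim : ringKrullDim Z = d)
    (hR : Module.annihilator Z R = ⊥) : IsEquicodimensional R := by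
  have hheight (P : TwoSidedIdeal R) (hP : IsCoatom P) :
      Order.height (⟨P, isPrimeIdeal_of_isCoatom hP⟩ : PrimeIdeals R) = d := by
    have := isMaximal_contraction (Z := Z) hP
    rw [height_eq_height_contraction_of_height_le_seqGrade hP hR fun m hm => by
      rw [hd.height_eq hdim hR, hd.seqGrade_eq hdim hR], hd.height_eq hdim hR]
  intro M N hM hN
  rw [hheight M hM, hheight N hN]

section HeightLeSeqGrade

variable (hE : IsEquicodimensional R) (hR : Module.annihilator Z R = ⊥)
  (h : ∀ m : Ideal Z, m.IsMaximal → m.height ≤ seqGrade m R)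

include hE hR h

theorem IsEquicodimensional.height_eq_height (m n : Ideal Z) [m.IsMaximal] [n.IsMaximal] :
    m.height = n.height := by
  have : IsNoetherianRing R := IsNoetherianRing.of_finite Z R
  obtain ⟨P, hP, hPm⟩ := exists_isCoatom_contraction_eq hR m
  obtain ⟨Q, hQ, hQn⟩ := exists_isCoatom_contraction_eq hR n
  have hmP := height_eq_height_contraction_of_height_le_seqGrade hP hR h
  have hnQ := height_eq_height_contraction_of_height_le_seqGrade hQ hR h
  rw [hPm] at hmP
  rw [hQn] at hnQ
  rw [← hmP, ← hnQ, hE P Q hP hQ]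

theorem IsEquicodimensional.exists_hasDepth [Nontrivial Z] :
    ∃ d : ℕ, ringKrullDim Z = d ∧ HasDepth Z R d := by
  obtain ⟨m, hm⟩ := Ideal.exists_maximal Z
  obtain ⟨d, hd⟩ := ENat.ne_top_iff_exists.mp (Ideal.height_ne_top hm.ne_top)
  have hheight (n : Ideal Z) (hn : n.IsMaximal) : n.height = d :=
    (hE.height_eq_height hR h n m).trans hd.symm
  refine ⟨d, le_antisymm ?_ ?_, fun n hn => (natCast_le_seqGrade_iff hR).mp ?_⟩
  · rw [← Ideal.sup_isMaximal_height_eq_ringKrullDim]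
    exact WithBot.coe_le_coe.mpr (iSup₂_le fun n hn => (hheight n hn).le)
  · have := Ideal.height_le_ringKrullDim_of_ne_top hm.ne_top
    rwa [← hd] at this
  · exact (hheight n hn).ge.trans (h n hn)

end HeightLeSeqGrade

end Equicodimensional

/-! ### Krull-Macaulay rings -/

section KrullMacaulay

theorem kdim_eq_ringKrullDim {Z : Type*} [CommRing Z] [IsNoetherianRing Z] (A : Type*) [Ring A]
    [Algebra Z A] {Y : Type*} [AddCommGroup Y] [Module A Y] [Module Z Y] [IsScalarTower Z A Y]
    [Module.Finite Z Y] (hY : Module.annihilator Z Y = ⊥) : Kdim A Y = ringKrullDim Z := by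
  rw [kdim_eq_supportDim Z, supportDim_eq_ringKrullDim_of_annihilator_eq_bot hY]

variable {Z : Type u} [CommRing Z] [IsNoetherianRing Z] {R : Type u} [Ring R] [Algebra Z R]
  [Module.Finite Z R] (hR : Module.annihilator Z R = ⊥)

include hR

theorem isKrullMacaulay_iff_hasGradeFormula : IsKrullMacaulay R ↔
    ringKrullDim Z < ⊤ ∧ HasGradeFormula R R ∧ HasGradeFormula Rᵐᵒᵖ R :=
  ⟨fun h => ⟨kdim_eq_ringKrullDim R hR ▸ h.left_finite, h.left_eq, h.right_eq⟩,
    fun ⟨hfin, hl, hr⟩ => ⟨(kdim_eq_ringKrullDim R hR).trans_lt hfin,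
      (kdim_eq_ringKrullDim Rᵐᵒᵖ hR).trans_lt hfin, hl, hr⟩⟩

theorem isKrullMacaulay_iff_hasDepth [Nontrivial Z] : IsKrullMacaulay R ↔
    ∃ d : ℕ, ringKrullDim Z = d ∧ HasDepth Z R d ∧ HasEnoughHoms Z R R ∧
      HasEnoughHoms Z Rᵐᵒᵖ R := by
  rw [isKrullMacaulay_iff_hasGradeFormula hR]
  constructor
  · rintro ⟨hfin, hl, hr⟩
    have : FiniteRingKrullDim Z :=
      finiteRingKrullDim_iff_ne_bot_and_top.mpr ⟨Order.bot_lt_krullDim.ne', hfin.ne⟩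
    have hdim := Order.krullDim_eq_length_of_finiteDimensionalOrder (α := PrimeSpectrum Z)
    exact ⟨_, hdim, hl.hasDepth hdim hR, hl.hasEnoughHoms hdim hR, hr.hasEnoughHoms hdim hR⟩
  · rintro ⟨d, hdim, hd, hl, hr⟩
    refine ⟨?_, hd.hasGradeFormula hdim hR hl, hd.hasGradeFormula hdim hR hr⟩
    rw [hdim]
    exact WithBot.coe_lt_coe.mpr (ENat.natCast_lt_top d)

end KrullMacaulay

section LocalizedKrullMacaulay

theorem isLocalizedModule_op {Z : Type*} [CommRing Z] (S : Submonoid Z) {A A' : Type*} [Ring A]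
    [Ring A'] [Algebra Z A] [Algebra Z A'] (φ : A →ₐ[Z] A') [IsLocalizedModule S φ.toLinearMap] :
    IsLocalizedModule S (AlgHom.op φ).toLinearMap :=
  inferInstanceAs (IsLocalizedModule S ((MulOpposite.opLinearEquiv Z).toLinearMap ∘ₗ
    φ.toLinearMap ∘ₗ (MulOpposite.opLinearEquiv Z).symm.toLinearMap))

variable {Z : Type u} [CommRing Z] [IsNoetherianRing Z] {R : Type u} [Ring R] [Algebra Z R]
  [Module.Finite Z R] (hR : Module.annihilator Z R = ⊥)

include hR

section AtMaximal

variable {m : Ideal Z} [m.IsMaximal]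

theorem isKrullMacaulay_localization_iff_hasDepth :
    let _ := localizedAlgebra m.primeCompl R
    IsKrullMacaulay (LocalizedModule m.primeCompl R) ↔ ∃ d : ℕ, m.height = d ∧
      HasDepth (Localization.AtPrime m) (LocalizedModule m.primeCompl R) d ∧
      HasEnoughHoms (Localization.AtPrime m) (LocalizedModule m.primeCompl R)
        (LocalizedModule m.primeCompl R) ∧
      HasEnoughHoms (Localization.AtPrime m) (LocalizedModule m.primeCompl R)ᵐᵒᵖ
        (LocalizedModule m.primeCompl R) := by
  intro _
  have : IsNoetherianRing (Localization.AtPrime m) :=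
    IsLocalization.isNoetherianRing m.primeCompl _ inferInstance
  rw [isKrullMacaulay_iff_hasDepth (annihilator_eq_bot_of_isLocalizedModule (S := m.primeCompl)
      (Localization.AtPrime m) (localizationAlgHom m.primeCompl R).toLinearMap hR),
    IsLocalization.AtPrime.ringKrullDim_eq_height m]
  norm_cast

theorem IsKrullMacaulay.localization (h : IsKrullMacaulay R) :
    IsKrullMacaulay (LocalizedModule m.primeCompl R) := by
  have : Nontrivial Z := (algebraMap Z (Localization.AtPrime m)).domain_nontrivial
  let _ := localizedAlgebra m.primeCompl R
  let φ := localizationAlgHom m.primeCompl R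
  have := isLocalizedModule_op m.primeCompl φ
  obtain ⟨d, hdim, hd, hl, hr⟩ := (isKrullMacaulay_iff_hasDepth hR).mp h
  exact (isKrullMacaulay_localization_iff_hasDepth hR).mpr ⟨d, hd.height_eq hdim hR,
    hd.localization (m := m) (Localization.AtPrime m) φ.toLinearMap,
    hl.localization (m := m) _ φ.toLinearMap φ (fun a y => map_mul φ a y) hd hdim hR,
    hr.localization (m := m) _ φ.toLinearMap (AlgHom.op φ) (fun a y => map_mul φ y a.unop) hd hdim
      hR⟩

theorem height_le_seqGrade_of_isKrullMacaulay_localization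
    (h : IsKrullMacaulay (LocalizedModule m.primeCompl R)) : m.height ≤ seqGrade m R := by
  let _ := localizedAlgebra m.primeCompl R
  obtain ⟨d, hheight, hd, -⟩ := (isKrullMacaulay_localization_iff_hasDepth hR).mp h
  rw [hheight, natCast_le_seqGrade_iff hR]
  exact hd.exists_isWeaklyRegular_of_localization
    (localizationAlgHom m.primeCompl R).toLinearMap le_rfl

end AtMaximal

section Global

variable (h : ∀ (m : Ideal Z) [m.IsMaximal], IsKrullMacaulay (LocalizedModule m.primeCompl R))

include h

theorem hasEnoughHoms_of_isKrullMacaulay_localization : HasEnoughHoms Z R R := by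
  intro M _ _ _ _ hM rs hrM hrs p hp hMp
  obtain ⟨m, hm, hpm⟩ := Ideal.exists_le_maximal p hp.isPrime.ne_top
  let _ := localizedAlgebra m.primeCompl R
  let φ := localizationAlgHom m.primeCompl R
  obtain ⟨-, -, -, hl, -⟩ := (isKrullMacaulay_localization_iff_hasDepth hR).mp (h m)
  exact hl.exists_linearMap_of_localization φ.toLinearMap φ (fun a y => map_mul φ a y) hrM hrs hp
    hMp hpm

theorem hasEnoughHoms_op_of_isKrullMacaulay_localization : HasEnoughHoms Z Rᵐᵒᵖ R := by
  intro M _ _ _ _ hM rs hrM hrs p hp hMp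
  obtain ⟨m, hm, hpm⟩ := Ideal.exists_le_maximal p hp.isPrime.ne_top
  let _ := localizedAlgebra m.primeCompl R
  let φ := localizationAlgHom m.primeCompl R
  have := isLocalizedModule_op m.primeCompl φ
  obtain ⟨-, -, -, -, hr⟩ := (isKrullMacaulay_localization_iff_hasDepth hR).mp (h m)
  exact hr.exists_linearMap_of_localization φ.toLinearMap (AlgHom.op φ)
    (fun a y => map_mul φ y a.unop) hrM hrs hp hMp hpm

theorem IsEquicodimensional.isKrullMacaulay_of_localization [Nontrivial Z]
    (hE : IsEquicodimensional R) : IsKrullMacaulay R := by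
  obtain ⟨d, hdim, hd⟩ := hE.exists_hasDepth hR fun m _ =>
    height_le_seqGrade_of_isKrullMacaulay_localization hR (h m)
  exact (isKrullMacaulay_iff_hasDepth hR).mpr ⟨d, hdim, hd,
    hasEnoughHoms_of_isKrullMacaulay_localization hR h,
    hasEnoughHoms_op_of_isKrullMacaulay_localization hR h⟩

end Global

end LocalizedKrullMacaulay

section MaximalCohenMacaulay

variable {Z : Type*} [CommRing Z] [IsNoetherianRing Z] {m : Ideal Z} [m.IsPrime]

theorem kdim_localization_self :
    Kdim (Localization.AtPrime m) (Localization.AtPrime m) = m.height := by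
  have : IsNoetherianRing (Localization.AtPrime m) :=
    IsLocalization.isNoetherianRing m.primeCompl _ inferInstance
  rw [kdim_eq_supportDim (Localization.AtPrime m), Module.supportDim_self_eq_ringKrullDim,
    IsLocalization.AtPrime.ringKrullDim_eq_height m]

variable {Y : Type*} [AddCommGroup Y] [Module Z Y] [Module.Finite Z Y]
  (hY : Module.annihilator Z Y = ⊥)

include hY

theorem kdim_localizedModule :
    Kdim (Localization.AtPrime m) (LocalizedModule m.primeCompl Y) = m.height := by
  have : IsNoetherianRing (Localization.AtPrime m) :=
    IsLocalization.isNoetherianRing m.primeCompl _ inferInstance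
  rw [kdim_eq_ringKrullDim (Localization.AtPrime m)
      (annihilator_eq_bot_of_isLocalizedModule (S := m.primeCompl) (Localization.AtPrime m)
        (LocalizedModule.mkLinearMap m.primeCompl Y) hY),
    IsLocalization.AtPrime.ringKrullDim_eq_height m]

omit m [m.IsPrime] in
theorem isMaximalCohenMacaulayModule_iff : IsMaximalCohenMacaulayModule Z Y ↔
    ∀ m : Ideal Z, m.IsMaximal → seqGrade m Y = m.height := by
  refine ⟨fun h m _ => WithBot.coe_inj.mp ((h.maximal m).trans kdim_localization_self), fun h =>
    ⟨fun m hm => ?_, fun m hm => ?_⟩⟩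
  · rw [kdim_localizedModule hY, h m hm]
  · rw [kdim_localization_self, h m hm]

end MaximalCohenMacaulay

section Center

variable {R : Type u} [Ring R]

variable (R) in
theorem annihilator_center_eq_bot : Module.annihilator (Subring.center R) R = ⊥ :=
  Module.annihilator_eq_bot.mpr inferInstance

theorem extGrade_eq_top_of_subsingleton (M Y : Type u) [AddCommGroup M] [Module R M]
    [Subsingleton M] [AddCommGroup Y] [Module R Y] : extGrade R M Y = ⊤ := by
  rw [extGrade, iInf₂_eq_top]
  intro i hi
  have hzero := ModuleCat.isZero_of_subsingleton (ModuleCat.of R M)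
  refine absurd ⟨fun x y => ?_⟩ (not_subsingleton_iff_nontrivial.mpr hi)
  rw [← CategoryTheory.Abelian.Ext.mk₀_id_comp x, ← CategoryTheory.Abelian.Ext.mk₀_id_comp y,
    hzero.eq_of_src (CategoryTheory.CategoryStruct.id _) 0]
  simp

theorem isEquicodimensional_of_subsingleton [Subsingleton R] : IsEquicodimensional R :=
  fun P _ hP _ => absurd ((TwoSidedIdeal.one_mem_iff P).mp
    (Subsingleton.elim (0 : R) 1 ▸ P.zero_mem)) hP.1

variable [Module.Finite (Subring.center R) R] [IsNoetherianRing R]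

instance : IsNoetherianRing (Subring.center R) :=
  isNoetherianRing_of_annihilator_eq_bot (annihilator_center_eq_bot R)

theorem isKrullMacaulay_of_subsingleton [Subsingleton R] : IsKrullMacaulay R := by
  refine (isKrullMacaulay_iff_hasGradeFormula (annihilator_center_eq_bot R)).mpr
    ⟨?_, fun M _ _ _ hM => ?_, fun M _ _ _ hM => ?_⟩
  · rw [ringKrullDim_eq_bot_of_subsingleton]
    exact bot_lt_top
  · exact absurd (Module.subsingleton R M) (not_subsingleton M)
  · exact absurd (Module.subsingleton Rᵐᵒᵖ M) (not_subsingleton M)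

theorem IsKrullMacaulay.isGradeSymmetric (h : IsKrullMacaulay R) : IsGradeSymmetric R := by
  intro M _ _ _ _ hM _ hcen
  rcases subsingleton_or_nontrivial M with _ | _
  · rw [leftGrade, rightGrade, extGrade_eq_top_of_subsingleton, extGrade_eq_top_of_subsingleton]
  have : Nontrivial R := Module.nontrivial R M
  obtain ⟨d, hdim, -⟩ := (isKrullMacaulay_iff_hasDepth (annihilator_center_eq_bot R)).mp h
  let _ : Module (Subring.center R) M := Module.compHom M (algebraMap (Subring.center R) R)
  have : IsScalarTower (Subring.center R) R M := IsScalarTower.of_algebraMap_smul fun _ _ => rfl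
  have : IsScalarTower (Subring.center R) Rᵐᵒᵖ M :=
    IsScalarTower.of_algebraMap_smul fun z x => (hcen z z.2 x).symm
  have : Module.Finite (Subring.center R) M := Module.Finite.trans R M
  obtain ⟨k, hk⟩ := exists_supportDim_eq_natCast hdim (M := M)
  have hl : HasGradeFormula R R := h.left_eq
  have hr : HasGradeFormula Rᵐᵒᵖ R := h.right_eq
  exact ENat.add_right_injective_of_ne_top (ENat.natCast_ne_top k)
    ((hl.eq_add_extGrade hdim (annihilator_center_eq_bot R) hk).symm.trans
      (hr.eq_add_extGrade hdim (annihilator_center_eq_bot R) hk))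

variable [Nontrivial R]

theorem IsKrullMacaulay.isEquicodimensional (h : IsKrullMacaulay R) : IsEquicodimensional R := by
  obtain ⟨d, hdim, hd, -⟩ := (isKrullMacaulay_iff_hasDepth (annihilator_center_eq_bot R)).mp h
  exact hd.isEquicodimensional hdim (annihilator_center_eq_bot R)

theorem IsKrullMacaulay.isCenterMacaulay (h : IsKrullMacaulay R) : IsCenterMacaulay R := by
  obtain ⟨d, hdim, hd, -⟩ := (isKrullMacaulay_iff_hasDepth (annihilator_center_eq_bot R)).mp h
  refine (isMaximalCohenMacaulayModule_iff (annihilator_center_eq_bot R)).mpr fun m _ => ?_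
  rw [hd.seqGrade_eq hdim (annihilator_center_eq_bot R),
    hd.height_eq hdim (annihilator_center_eq_bot R)]

theorem IsCenterMacaulay.seqGrade_eq_kdim (hC : IsCenterMacaulay R) (hE : IsEquicodimensional R)
    (m : Ideal (Subring.center R)) [m.IsMaximal] : (seqGrade m R : WithBot ℕ∞) = Kdim R R := by
  obtain ⟨d, hdim, hd⟩ := hE.exists_hasDepth (annihilator_center_eq_bot R) fun m hm =>
    ((isMaximalCohenMacaulayModule_iff (annihilator_center_eq_bot R)).mp hC m hm).ge
  rw [hd.seqGrade_eq hdim (annihilator_center_eq_bot R),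
    kdim_eq_ringKrullDim R (annihilator_center_eq_bot R), hdim]
  rfl

theorem IsGradeSymmetric.isKrullMacaulay (hG : IsGradeSymmetric R)
    (h : ∀ m : Ideal (Subring.center R), m.IsMaximal → (seqGrade m R : WithBot ℕ∞) = Kdim R R) :
    IsKrullMacaulay R := by
  rw [kdim_eq_ringKrullDim R (annihilator_center_eq_bot R)] at h
  obtain ⟨d, hdim, hd⟩ := exists_hasDepth_of_seqGrade_eq (annihilator_center_eq_bot R) h
  exact (isKrullMacaulay_iff_hasDepth (annihilator_center_eq_bot R)).mpr ⟨d, hdim, hd,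
    hG.tensorGradeSymmetric_left.hasEnoughHoms, hG.tensorGradeSymmetric_right.hasEnoughHoms⟩

end Center

end CentrallyMacaulay

end

theorem mainTheorem1 (R : Type*) [Ring R] [IsNoetherianRing R] [IsNoetherianRing Rᵐᵒᵖ]
    [Module.Finite (Subring.center R) R] :
    List.TFAE [
      CentrallyMacaulay.IsKrullMacaulay R,
      CentrallyMacaulay.IsEquicodimensional R ∧ CentrallyMacaulay.IsLocallyKrullMacaulay R,
      CentrallyMacaulay.IsCenterMacaulay R ∧ CentrallyMacaulay.IsEquicodimensional R ∧
        CentrallyMacaulay.IsGradeSymmetric R,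
      (∀ (m : Ideal (Subring.center R)), m.IsMaximal →
        (CentrallyMacaulay.seqGrade m R : WithBot ℕ∞) = CentrallyMacaulay.Kdim R R) ∧
        CentrallyMacaulay.IsGradeSymmetric R] := by
  rcases subsingleton_or_nontrivial R with _ | _
  · have hmax (m : Ideal (Subring.center R)) : ¬ m.IsMaximal :=
      fun hm => hm.ne_top (Subsingleton.elim _ _)
    have hKM : CentrallyMacaulay.IsKrullMacaulay R :=
      CentrallyMacaulay.isKrullMacaulay_of_subsingleton
    have hC : CentrallyMacaulay.IsCenterMacaulay R :=
      ⟨fun m hm => absurd hm (hmax m), fun m hm => absurd hm (hmax m)⟩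
    exact List.tfae_of_forall True _ (by
      simp [hKM, hC, hKM.isGradeSymmetric, CentrallyMacaulay.isEquicodimensional_of_subsingleton,
        CentrallyMacaulay.IsLocallyKrullMacaulay, hmax])
  have hbot : Module.annihilator (Subring.center R) R = ⊥ :=
    CentrallyMacaulay.annihilator_center_eq_bot R
  tfae_have 1 → 2 := fun h => ⟨h.isEquicodimensional, fun m _ => h.localization hbot⟩
  tfae_have 2 → 1 := fun ⟨hE, hL⟩ => hE.isKrullMacaulay_of_localization hbot hL
  tfae_have 1 → 3 := fun h => ⟨h.isCenterMacaulay, h.isEquicodimensional, h.isGradeSymmetric⟩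
  tfae_have 3 → 4 := fun ⟨hC, hE, hG⟩ => ⟨fun m _ => hC.seqGrade_eq_kdim hE m, hG⟩
  tfae_have 4 → 1 := fun ⟨h, hG⟩ => hG.isKrullMacaulay h
  tfae_finish
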